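/- Let $d\ge 2$, let $\mathcal X\subset\mathbb R^d$ be nonempty, compact and convex, let $\tau>0$ and $\mathcal X_\tau=\mathcal X+\tau B$, where $B$ is the closed Euclidean unit ball. Let $\xi\sim\mathcal D$ be a random element and let $f(x,\xi)$ be integrable in $\xi$ for every $x\in\mathcal X_\tau$; put $f(x)=\mathbb E_\xi f(x,\xi)$. Let $\kappa\in(0,1]$, $M_2\ge 0$, $\Delta\ge0$, with $M_2$ and $\Delta$ not both zero. Assume: (1) for every $\xi$, $f(\cdot,\xi)$ is convex on $\mathcal X_\tau$; (2) for every $\xi$, $|f(x,\xi)-f(y,\xi)|\le M(\xi)\|x-y\|_2$ for all $x,y\in\mathcal X_\tau$, where $\mathbb E_\xi[M(\xi)^{1+\kappa}]\le M_2^{1+\kappa}$; (3) the deterministic measurable noise $\mathbf n$ satisfies $|\mathbf n(x)|\le\Delta$ for all $x\in\mathcal X_\tau$. The oracle returns $\phi(x,\xi)=f(x,\xi)+\mathbf n(x)$. Let $q\in[2,\infty]$ and $1/p+1/q=1$. Let $\Psi:\mathbb R^d\to\mathbb R$ be a differentiable convex prox-function that is $1$-strongly convex with respect to the $\ell_p$-norm: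 $D_\Psi(y,x):=\Psi(y)-\Psi(x)-\langle\nabla\Psi(x),y-x\rangle\ge\frac12\|x-y\|_p^2$ for all $x,y\in\mathbb R^d$. Let $\Psi^*$ be its Fenchel conjugate, and put $\mathcal D_\Psi=\bigl(2\sup_{x,y\in\mathcal X}D_\Psi(x,y)\bigr)^{1/2}$, $a_q=d^{\frac1q-\frac12}\min\{\sqrt{32\ln d-8},\sqrt{2q-1}\}$ (for $q=\infty$: $a_\infty=d^{-1/2}\sqrt{32\ln d-8}$), and $$\sigma_q^{1+\kappa}=2^\kappa\Bigl(\frac{\sqrt d}{2^{1/4}}a_qM_2\Bigr)^{1+\kappa}+2^\kappa\Bigl(\frac{d a_q\Delta}{\tau}\Bigr)^{1+\kappa}.$$ Let $T\ge1$, $c=T^{1/(1+\kappa)}\sigma_q$ and $\nu=\mathcal D_\Psi/c$. The algorithm ZO-Clip-SMD starts from $x_0=\arg\min_{\mathcal X}\Psi$. For $k=0,\dots,T-1$ it draws $\mathbf e_k$ uniformly from the Euclidean unit sphere and $\xi_k\sim\mathcal D$, all draws being independent, and sets $$g_{k+1}=\frac d{2\tau}\bigl(\phi(x_k+\tau\mathbf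 e_k,\xi_k)-\phi(x_k-\tau\mathbf e_k,\xi_k)\bigr)\mathbf e_k,\qquad \hat g_{k+1}=\frac{g_{k+1}}{\|g_{k+1}\|_q}\min(\|g_{k+1}\|_q,c)$$ (with $\hat g_{k+1}=0$ if $g_{k+1}=0$), $$y_{k+1}=\nabla\Psi^*(\nabla\Psi(x_k)-\nu\hat g_{k+1}),\qquad x_{k+1}=\arg\min_{x\in\mathcal X}D_\Psi(x,y_{k+1}).$$ It returns $\bar x_T=\frac1T\sum_{k=0}^{T-1}x_k$. Let $x^*\in\arg\min_{\mathcal X}f$. There is an absolute constant $C>0$, depending on none of the data above, such that for every $\delta\in(0,1)$: 1. With probability at least $1-\delta$, $$f(\bar x_T)-f(x^*)\le 2M_2\tau+\frac{\Delta\sqrt d}{\tau}\mathcal D_\Psi+C\Bigl(1+\log\frac1\delta\Bigr)\frac{\mathcal D_\Psi\sigma_q}{T^{\kappa/(1+\kappa)}}.$$ 2. If moreover $\tau=\sqrt{\dfrac{\sqrt d\,\Delta\mathcal D_\Psi+4\mathcal D_\Psi d a_q\Delta T^{-\kappa/(1+\kappa)}}{2M_2}}$ (with $M_2>0$), then with probability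 at least $1-\delta$, $$f(\bar x_T)-f(x^*)\le C\Bigl(1+\log\frac1\delta\Bigr)\left(\sqrt{8M_2\sqrt d\,\Delta\mathcal D_\Psi}+\sqrt{\frac{32M_2\mathcal D_\Psi d a_q\Delta}{T^{\kappa/(1+\kappa)}}}+\frac{2\sqrt d\,a_qM_2\mathcal D_\Psi}{T^{\kappa/(1+\kappa)}}\right).$$ -/

import Mathlib

open MeasureTheory ProbabilityTheory
open scoped ENNReal Pointwise

namespace ZOClipSMD

/-- The space `ℝ^d` with its Euclidean norm and inner product. -/
abbrev Vec (d : ℕ) : Type := EuclideanSpace ℝ (Fin d)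

/-- The `ℓ_r`-norm on `ℝ^d`, for `r ∈ [1, ∞]`. -/
noncomputable def ellNorm {d : ℕ} (r : ℝ≥0∞) (x : Vec d) : ℝ :=
  ‖(WithLp.toLp r x.ofLp : PiLp r (fun _ : Fin d => ℝ))‖

/-- The enlarged set `X_τ = X + τ B`, where `B` is the closed Euclidean unit ball. -/
def enlargement {d : ℕ} (X : Set (Vec d)) (τ : ℝ) : Set (Vec d) :=
  X + τ • Metric.closedBall (0 : Vec d) 1

/-- The uniform probability measure on the Euclidean unit sphere, as a measure on `ℝ^d`. -/
noncomputable def uniformSphere (d : ℕ) : Measure (Vec d) :=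
  (((volume : Measure (Vec d)).toSphere Set.univ)⁻¹ •
    (volume : Measure (Vec d)).toSphere).map Subtype.val

/-- The objective `f(x) = E_ξ f(x, ξ)`. -/
noncomputable def objective {d : ℕ} {Ξ : Type*} [MeasurableSpace Ξ] (𝒟 : Measure Ξ)
    (f : Vec d → Ξ → ℝ) (x : Vec d) : ℝ :=
  ∫ s, f x s ∂𝒟

/-- The function `f(·, ξ)` is convex on `X_τ` for every `ξ`. -/
def ConvexRealizations {d : ℕ} {Ξ : Type*} (X : Set (Vec d)) (τ : ℝ)
    (f : Vec d → Ξ → ℝ) : Prop :=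
  ∀ s, ConvexOn ℝ (enlargement X τ) (fun x => f x s)

/-- The function `f(·, ξ)` is `M(ξ)`-Lipschitz on `X_τ` in the Euclidean norm for every `ξ`, and
`E_ξ [M(ξ)^(1+κ)] ≤ M₂^(1+κ)`. -/
structure LipschitzRealizations {d : ℕ} {Ξ : Type*} [MeasurableSpace Ξ] (𝒟 : Measure Ξ)
    (X : Set (Vec d)) (τ κ : ℝ) (f : Vec d → Ξ → ℝ) (M : Ξ → ℝ) (M₂ : ℝ) : Prop where
  lipschitz : ∀ s, ∀ x ∈ enlargement X τ, ∀ y ∈ enlargement X τ,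
    |f x s - f y s| ≤ M s * ‖x - y‖
  moment_integrable : Integrable (fun s => M s ^ (1 + κ)) 𝒟
  moment_le : ∫ s, M s ^ (1 + κ) ∂𝒟 ≤ M₂ ^ (1 + κ)

/-- The deterministic oracle noise is measurable on `X_τ` and bounded there by `Δ`. -/
structure BoundedNoise {d : ℕ} (X : Set (Vec d)) (τ : ℝ) (noise : Vec d → ℝ) (Δ : ℝ) :
    Prop where
  measurable : Measurable ((enlargement X τ).domRestrict noise)
  bound : ∀ x ∈ enlargement X τ, |noise x| ≤ Δ

/-- The Bregman divergence
`D_Ψ(y, x) = Ψ(y) - Ψ(x) - ⟨∇Ψ(x), y - x⟩`. -/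
noncomputable def bregman {d : ℕ} (Ψ : Vec d → ℝ) (y x : Vec d) : ℝ :=
  Ψ y - Ψ x - inner ℝ (gradient Ψ x) (y - x)

/-- The Fenchel conjugate `Ψ*(y) = sup_x {⟨x, y⟩ - Ψ(x)}`. -/
noncomputable def fenchelConjugate {d : ℕ} (Ψ : Vec d → ℝ) (y : Vec d) : ℝ :=
  ⨆ x : Vec d, (inner ℝ x y - Ψ x)

/-- A differentiable convex function on `ℝ^d` that is `1`-strongly convex with respect to the
`ℓ_p`-norm. -/
structure IsProxFunction {d : ℕ} (p : ℝ≥0∞) (Ψ : Vec d → ℝ) : Prop where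
  differentiable : Differentiable ℝ Ψ
  convex : ConvexOn ℝ Set.univ Ψ
  strong : ∀ x y : Vec d,
    Ψ y - Ψ x - inner ℝ (gradient Ψ x) (y - x) ≥ 1 / 2 * ellNorm p (x - y) ^ 2

/-- The Bregman diameter, given by `𝒟_Ψ² = 2 sup_{x, y ∈ X} D_Ψ(x, y)`. -/
noncomputable def bregmanDiam {d : ℕ} (X : Set (Vec d)) (Ψ : Vec d → ℝ) : ℝ :=
  √(2 * sSup {b : ℝ | ∃ x ∈ X, ∃ y ∈ X, b = bregman Ψ x y})

/-- `a_q = d^(1/q - 1/2) min {√(32 ln d - 8), √(2q - 1)}`, where `1/q = 0` and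
`√(2q - 1) = ∞` for `q = ∞`. -/
noncomputable def aCoef (d : ℕ) (q : ℝ≥0∞) : ℝ :=
  if q = ∞ then (d : ℝ) ^ (-(1 / 2) : ℝ) * √(32 * Real.log d - 8)
  else (d : ℝ) ^ (1 / q.toReal - 1 / 2) *
    min (√(32 * Real.log d - 8)) (√(2 * q.toReal - 1))

/-- `σ_q`, given by
`σ_q^(1+κ) = 2^κ (√d a_q M₂ / 2^(1/4))^(1+κ) + 2^κ (d a_q Δ / τ)^(1+κ)`. -/
noncomputable def sigma (d : ℕ) (q : ℝ≥0∞) (κ M₂ Δ τ : ℝ) : ℝ :=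
  ((2 : ℝ) ^ κ * (√d / (2 : ℝ) ^ (1 / 4 : ℝ) * aCoef d q * M₂) ^ (1 + κ) +
    (2 : ℝ) ^ κ * (d * aCoef d q * Δ / τ) ^ (1 + κ)) ^ (1 / (1 + κ))

/-- The noisy zeroth-order oracle `φ(x, ξ) = f(x, ξ) + δ(x)`. -/
def oracle {d : ℕ} {Ξ : Type*} (f : Vec d → Ξ → ℝ) (noise : Vec d → ℝ) (x : Vec d) (s : Ξ) : ℝ :=
  f x s + noise x

/-- The two-point gradient estimate
`g(x, ξ, e) = d / (2τ) (φ(x + τ e, ξ) - φ(x - τ e, ξ)) e`. -/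
noncomputable def gradEstimate {d : ℕ} {Ξ : Type*} (f : Vec d → Ξ → ℝ) (noise : Vec d → ℝ)
    (τ : ℝ) (x : Vec d) (s : Ξ) (e : Vec d) : Vec d :=
  ((d : ℝ) / (2 * τ) * (oracle f noise (x + τ • e) s - oracle f noise (x - τ • e) s)) • e

/-- Clipping at level `c` in the `ℓ_q`-norm: `g / ‖g‖_q * min (‖g‖_q, c)`, and `0` at `g = 0`. -/
noncomputable def clip {d : ℕ} (q : ℝ≥0∞) (c : ℝ) (g : Vec d) : Vec d :=
  (min (ellNorm q g) c / ellNorm q g) • g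

/-- The sequence `x₀, …, x_T` is a trajectory of ZO-Clip-SMD with `T` iterations, stepsize `ν`,
clipping constant `c`, prox-function `Ψ` and smoothing constant `τ`, driven by the samples
`ξ_k = s k` and `e_k = e k`, `k < T`. -/
structure IsTrajectory {d : ℕ} {Ξ : Type*} (X : Set (Vec d)) (f : Vec d → Ξ → ℝ)
    (noise : Vec d → ℝ) (q : ℝ≥0∞) (T : ℕ) (ν c : ℝ) (Ψ : Vec d → ℝ) (τ : ℝ)
    (s : ℕ → Ξ) (e : ℕ → Vec d) (x : ℕ → Vec d) : Prop where
  init_mem : x 0 ∈ X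
  init_min : IsMinOn Ψ X (x 0)
  step_mem : ∀ k < T, x (k + 1) ∈ X
  step_min : ∀ k < T, IsMinOn
    (fun z => bregman Ψ z (gradient (fenchelConjugate Ψ)
      (gradient Ψ (x k) - ν • clip q c (gradEstimate f noise τ (x k) (s k) (e k)))))
    X (x (k + 1))

/-- The output `(1/T) ∑_{k<T} x_k`. -/
noncomputable def average {d : ℕ} (T : ℕ) (x : ℕ → Vec d) : Vec d :=
  (1 / (T : ℝ)) • ∑ k ∈ Finset.range T, x k

end ZOClipSMD

namespace ZOClipSMD

/-! ### Polar coordinates and the standard Gaussian measure -/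

/-! The regret inequality of mirror descent controls the sum of ⟨ĝ_k, x_k - u⟩ by the Bregman
diameter D and the sum of ‖ĝ_k‖_q². It remains to compare this sum with the function gaps, with high
probability and with only a (1+κ)-th moment at hand.

Bias. The f-part of the estimate has as its mean the gradient of the average of f over x + τB
(`hasDerivAt_setIntegral_closedBall`). That average is convex in x and within M₂τ of f, whence the
term 2M₂τ (`sub_le_integral_uniformSphere`). The noise enters the mean only through E|⟨e, r⟩| ≤
‖r‖/√d, whence Δ√d D/τ.

Moments. E‖g‖_q^(1+κ) ≤ K σ_q^(1+κ) with K absolute. By Cauchy–Schwarz on the sphere this needs the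
fourth moments of ‖e‖_q, of order a_q, and of f(x+τe) - f(x-τe). The latter function is odd and
Lipschitz in e, hence of typical size τM/√d instead of τM. Homogeneity transfers both moments to the
standard Gaussian measure. There the first is a computation with even moments of the coordinates,
and the second follows by rotating an independent pair of Gaussian vectors
(`integral_pow_four_stdGaussian_le`).

Clipping. The level c = T^(1/(1+κ)) σ_q is the one at which E‖g‖_q^(1+κ) ≤ K c^(1+κ)/T.
Interpolation then bounds the second moment of the clipped vector by K c²/T and its bias by K c/T.
Take half of (function gap - linear term)/(cD) plus the normalized quadratic term of the regret
inequality. Its random part is bounded thanks to clipping, so its exponential has mean at most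
exp(2K/T) from any point of X (`integral_exp_clip_le`). The product over T steps and Markov's
inequality give a tail linear in log(1/δ). The quadratic terms cancel exactly against the regret
inequality, so they need no concentration argument of their own
(`RegularOracle.exists_exceptional_set`).

Measurability. Neither joint measurability of f nor measurability of the iterates is assumed. The
oracle is replaced by a jointly measurable one that agrees with it on X_τ for almost every ξ
(`exists_regularOracle`). Uniqueness of prox-points makes each trajectory the orbit of a measurable
recursion in the samples. The exceptional event is a measurable set of sample sequences, and Fubini
on the product space replaces conditional expectations (`lintegral_exp_chainSum_le`). -/

theorem measurable_homeomorphUnitSphereProd_symm_coe {d : ℕ} :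
    Measurable (fun z : Metric.sphere (0 : Vec d) 1 × Set.Ioi (0 : ℝ) => z.2.1 • (z.1.1 : Vec d)) :=
  by fun_prop

/-- Integration in polar coordinates. -/
theorem lintegral_polar {d : ℕ} (hd : 0 < d) {f : Vec d → ℝ≥0∞} (hf : Measurable f) :
    ∫⁻ x, f x = ∫⁻ e, (∫⁻ r in Set.Ioi (0 : ℝ), ENNReal.ofReal (r ^ (d - 1)) * f (r • e.1))
      ∂(volume : Measure (Vec d)).toSphere := by
  have : Nonempty (Fin d) := ⟨⟨0, hd⟩⟩
  have h1 : ∫⁻ x, f x = ∫⁻ x : ({(0)}ᶜ : Set (Vec d)), f x.1 ∂((volume : Measure (Vec d)).comap (↑)) := by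
    rw [lintegral_subtype_comap (measurableSet_singleton _).compl f, restrict_compl_singleton]
  have h2 : ∫⁻ x : ({(0)}ᶜ : Set (Vec d)), f x.1 ∂((volume : Measure (Vec d)).comap (↑))
      = ∫⁻ z : Metric.sphere (0 : Vec d) 1 × Set.Ioi (0 : ℝ), f (z.2.1 • z.1.1)
        ∂((volume : Measure (Vec d)).toSphere.prod (Measure.volumeIoiPow (d - 1))) := by
    have := (volume : Measure (Vec d)).measurePreserving_homeomorphUnitSphereProd
    rw [finrank_euclideanSpace, Fintype.card_fin] at this
    have h := this.lintegral_comp (f := fun z => f (z.2.1 • z.1.1))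
      (hf.comp measurable_homeomorphUnitSphereProd_symm_coe)
    rw [← h]
    refine lintegral_congr fun x => ?_
    have hx : ‖(x : Vec d)‖ ≠ 0 := norm_ne_zero_iff.2 x.2
    simp [smul_smul, hx]
  rw [h1, h2, lintegral_prod _ (by fun_prop)]
  refine lintegral_congr fun e => ?_
  have hm : Measurable fun r : ℝ => f (r • e.1) := hf.comp (by fun_prop)
  rw [Measure.volumeIoiPow, lintegral_withDensity_eq_lintegral_mul _ (by fun_prop)
    (g := fun r : Set.Ioi (0 : ℝ) => f (r.1 • e.1)) (hm.comp measurable_subtype_coe)]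
  exact lintegral_subtype_comap measurableSet_Ioi
    (fun r : ℝ => ENNReal.ofReal (r ^ (d - 1)) * f (r • e.1))

/-- The density of the standard Gaussian measure on `ℝ^d`. -/
noncomputable def gaussianDensity (d : ℕ) (r : ℝ) : ℝ :=
  ((2 * Real.pi) ^ ((d : ℝ) / 2))⁻¹ * Real.exp (-r ^ 2 / 2)

theorem continuous_gaussianDensity (d : ℕ) : Continuous (gaussianDensity d) := by
  unfold gaussianDensity; fun_prop

theorem gaussianDensity_nonneg (d : ℕ) (r : ℝ) : 0 ≤ gaussianDensity d r := by
  unfold gaussianDensity; positivity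

theorem integrable_gaussianDensity (d : ℕ) :
    Integrable (fun x : Vec d => gaussianDensity d ‖x‖) := by
  have h := (GaussianFourier.integrable_cexp_neg_mul_sq_norm_add (V := Vec d) (b := 1 / 2)
    (by simp) 0 0).norm
  refine (h.const_mul ((2 * Real.pi) ^ ((d : ℝ) / 2))⁻¹).congr (Filter.Eventually.of_forall ?_)
  intro x
  simp only [gaussianDensity, Complex.norm_exp]
  congr 2
  rw [show (-(1 / 2) * (‖x‖ : ℂ) ^ 2 + 0 * ((inner ℝ 0 x : ℝ) : ℂ)) = ((-(1 / 2) * ‖x‖ ^ 2 : ℝ) : ℂ) by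
    push_cast; ring, Complex.ofReal_re]
  ring

/-- The standard Gaussian measure on `ℝ^d` has the Gaussian density. -/
theorem stdGaussian_eq_withDensity (d : ℕ) :
    stdGaussian (Vec d) = volume.withDensity (fun x => ENNReal.ofReal (gaussianDensity d ‖x‖)) := by
  have hc : Continuous fun x : Vec d => gaussianDensity d ‖x‖ :=
    (continuous_gaussianDensity d).comp continuous_norm
  have : IsFiniteMeasure ((volume : Measure (Vec d)).withDensity
      (fun x => ENNReal.ofReal (gaussianDensity d ‖x‖))) :=
    isFiniteMeasure_withDensity_ofReal (integrable_gaussianDensity d).2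
  refine Measure.ext_of_charFun (funext fun t => ?_)
  rw [charFun_stdGaussian, charFun_apply, integral_withDensity_eq_integral_toReal_smul
    (by have := (continuous_gaussianDensity d).measurable; fun_prop) (by simp)]
  have h := GaussianFourier.integral_cexp_neg_mul_sq_norm_add (V := Vec d) (b := 1 / 2)
    (by simp) Complex.I t
  have h2 : ∀ x : Vec d, (ENNReal.ofReal (gaussianDensity d ‖x‖)).toReal •
      Complex.exp (inner ℝ x t * Complex.I) = (((2 * Real.pi) ^ ((d : ℝ) / 2))⁻¹ : ℝ) *
      Complex.exp (-(1 / 2) * ‖x‖ ^ 2 + Complex.I * inner ℝ t x) := by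
    intro x
    rw [ENNReal.toReal_ofReal (gaussianDensity_nonneg _ _), gaussianDensity, Complex.real_smul,
      Complex.exp_add, real_inner_comm]
    push_cast
    rw [mul_assoc]
    congr 3 <;> ring_nf
  simp_rw [h2]
  rw [integral_const_mul, h, finrank_euclideanSpace, Fintype.card_fin]
  have h3 : ((Real.pi : ℂ) / (1 / 2)) ^ ((d : ℂ) / 2) = (((2 * Real.pi) ^ ((d : ℝ) / 2) : ℝ) : ℂ) := by
    rw [Complex.ofReal_cpow (by positivity)]
    push_cast
    congr 1
    ring
  rw [h3, ← mul_assoc, ← Complex.ofReal_mul, inv_mul_cancel₀ (by positivity)]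
  simp
  ring_nf

/-- Lets Rademacher's theorem, an almost-everywhere statement for Lebesgue measure, be used under
the Gaussian measure. -/
theorem stdGaussian_absolutelyContinuous (d : ℕ) :
    stdGaussian (Vec d) ≪ (volume : Measure (Vec d)) := by
  rw [stdGaussian_eq_withDensity]
  exact withDensity_absolutelyContinuous _ _

/-! ### The uniform measure on the sphere -/

theorem toSphere_univ_ne_zero {d : ℕ} (hd : 0 < d) :
    (volume : Measure (Vec d)).toSphere Set.univ ≠ 0 := by
  have : Nonempty (Fin d) := ⟨⟨0, hd⟩⟩
  rw [Measure.toSphere_apply_univ, finrank_euclideanSpace, Fintype.card_fin]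
  exact mul_ne_zero (by exact_mod_cast hd.ne') (Metric.measure_ball_pos _ _ one_pos).ne'

theorem lintegral_uniformSphere {d : ℕ} {f : Vec d → ℝ≥0∞} (hf : Measurable f) :
    ∫⁻ e, f e ∂uniformSphere d = ((volume : Measure (Vec d)).toSphere Set.univ)⁻¹ *
      ∫⁻ e, f e.1 ∂(volume : Measure (Vec d)).toSphere := by
  rw [uniformSphere, lintegral_map hf measurable_subtype_coe, lintegral_smul_measure, smul_eq_mul]

theorem isProbabilityMeasure_uniformSphere {d : ℕ} (hd : 0 < d) :
    IsProbabilityMeasure (uniformSphere d) := by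
  constructor
  have := lintegral_uniformSphere (d := d) (f := fun _ => 1) measurable_const
  simp only [lintegral_const, one_mul] at this
  rw [this, ENNReal.inv_mul_cancel (toSphere_univ_ne_zero hd) (measure_ne_top _ _)]

theorem ae_norm_eq_one_uniformSphere (d : ℕ) : ∀ᵐ e ∂uniformSphere d, ‖e‖ = 1 := by
  rw [uniformSphere, ae_map_iff (by fun_prop) (measurableSet_eq_fun (by fun_prop) (by fun_prop))]
  exact Filter.Eventually.of_forall fun e => by simp

theorem integral_uniformSphere {d : ℕ} (f : Vec d → ℝ) (hf : Measurable f) :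
    ∫ e, f e ∂uniformSphere d = ((volume : Measure (Vec d)).toSphere.real Set.univ)⁻¹ *
      ∫ e, f e.1 ∂(volume : Measure (Vec d)).toSphere := by
  rw [uniformSphere, integral_map (by fun_prop) hf.aestronglyMeasurable, integral_smul_measure,
    smul_eq_mul, ENNReal.toReal_inv]
  rfl

/-- Gaussian integrals of homogeneous functions are products of a radial and a spherical part. -/
theorem lintegral_stdGaussian_of_homogeneous {d : ℕ} (hd : 0 < d) (k : ℕ) {H : Vec d → ℝ≥0∞}
    (hH : Measurable H)
    (hom : ∀ r : ℝ, 0 < r → ∀ e : Vec d, ‖e‖ = 1 → H (r • e) = ENNReal.ofReal (r ^ k) * H e) :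
    ∫⁻ x, H x ∂stdGaussian (Vec d) =
      (∫⁻ x, ENNReal.ofReal (‖x‖ ^ k) ∂stdGaussian (Vec d)) * ∫⁻ e, H e ∂uniformSphere d := by
  have key : ∀ G : Vec d → ℝ≥0∞, Measurable G →
      (∀ r : ℝ, 0 < r → ∀ e : Vec d, ‖e‖ = 1 → G (r • e) = ENNReal.ofReal (r ^ k) * G e) →
      ∫⁻ x, G x ∂stdGaussian (Vec d) =
        (∫⁻ r in Set.Ioi (0 : ℝ), ENNReal.ofReal (r ^ (d - 1)) *
          (ENNReal.ofReal (gaussianDensity d r) * ENNReal.ofReal (r ^ k))) *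
        ∫⁻ e, G e.1 ∂(volume : Measure (Vec d)).toSphere := by
    intro G hG hom
    have hc : Measurable fun x : Vec d => ENNReal.ofReal (gaussianDensity d ‖x‖) :=
      ((continuous_gaussianDensity d).comp continuous_norm).measurable.ennreal_ofReal
    rw [stdGaussian_eq_withDensity, lintegral_withDensity_eq_lintegral_mul _ hc hG,
      lintegral_polar hd (hc.mul hG)]
    have hin : ∀ e : Metric.sphere (0 : Vec d) 1,
        ∫⁻ r in Set.Ioi (0 : ℝ), ENNReal.ofReal (r ^ (d - 1)) *
          ((fun x : Vec d => ENNReal.ofReal (gaussianDensity d ‖x‖)) * G) (r • e.1) =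
        (∫⁻ r in Set.Ioi (0 : ℝ), ENNReal.ofReal (r ^ (d - 1)) *
          (ENNReal.ofReal (gaussianDensity d r) * ENNReal.ofReal (r ^ k))) * G e.1 := by
      intro e
      have hm : Measurable fun r : ℝ => ENNReal.ofReal (r ^ (d - 1)) *
          (ENNReal.ofReal (gaussianDensity d r) * ENNReal.ofReal (r ^ k)) := by
        have := (continuous_gaussianDensity d).measurable
        fun_prop
      rw [← lintegral_mul_const _ hm]
      refine setLIntegral_congr_fun measurableSet_Ioi fun r hr => ?_
      have he : ‖e.1‖ = 1 := by simp
      simp only [Pi.mul_apply, hom r hr e.1 he, norm_smul, he, mul_one, Real.norm_eq_abs,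
        abs_of_pos (show (0 : ℝ) < r from hr)]
      ring
    simp_rw [hin]
    rw [lintegral_const_mul _ (by fun_prop)]
  rw [key H hH hom, key (fun x => ENNReal.ofReal (‖x‖ ^ k)) (by fun_prop), lintegral_uniformSphere hH]
  · have hs : ∫⁻ e : Metric.sphere (0 : Vec d) 1, ENNReal.ofReal (‖e.1‖ ^ k)
        ∂(volume : Measure (Vec d)).toSphere = (volume : Measure (Vec d)).toSphere Set.univ := by
      simp
    rw [hs, mul_assoc, ← mul_assoc ((volume : Measure (Vec d)).toSphere Set.univ),
      ENNReal.mul_inv_cancel (toSphere_univ_ne_zero hd) (measure_ne_top _ _), one_mul]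
  · intro r hr e he
    rw [norm_smul, he, mul_one, one_pow, ENNReal.ofReal_one, mul_one, Real.norm_eq_abs,
      abs_of_pos hr]

/-- A spherical integral as a quotient of Gaussian integrals, in real form. -/
theorem integral_stdGaussian_of_homogeneous {d : ℕ} (hd : 0 < d) (k : ℕ) {H : Vec d → ℝ}
    (hH : Measurable H) (h0 : ∀ x, 0 ≤ H x)
    (hom : ∀ r : ℝ, 0 < r → ∀ e : Vec d, ‖e‖ = 1 → H (r • e) = r ^ k * H e) :
    ∫ x, H x ∂stdGaussian (Vec d) =
      (∫ x, ‖x‖ ^ k ∂stdGaussian (Vec d)) * ∫ e, H e ∂uniformSphere d := by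
  rw [integral_eq_lintegral_of_nonneg_ae (.of_forall h0) (by fun_prop),
    integral_eq_lintegral_of_nonneg_ae (.of_forall fun x => by positivity) (by fun_prop),
    integral_eq_lintegral_of_nonneg_ae (.of_forall h0) (by fun_prop), ← ENNReal.toReal_mul,
    lintegral_stdGaussian_of_homogeneous hd k (by fun_prop)]
  intro r hr e he
  rw [hom r hr e he, ENNReal.ofReal_mul (by positivity)]

theorem integrable_norm_pow_stdGaussian (d k : ℕ) :
    Integrable (fun x => ‖x‖ ^ k) (stdGaussian (Vec d)) :=
  (IsGaussian.memLp_id (stdGaussian (Vec d)) k (by simp)).integrable_norm_pow'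

theorem integral_inner_sq_stdGaussian {d : ℕ} (v : Vec d) :
    ∫ x, inner ℝ v x ^ 2 ∂stdGaussian (Vec d) = ‖v‖ ^ 2 := by
  have h := variance_dual_stdGaussian (E := Vec d) (innerSL ℝ v)
  rw [variance_of_integral_eq_zero (by fun_prop) (integral_strongDual_stdGaussian _),
    innerSL_apply_norm] at h
  simpa using h

theorem integral_norm_sq_stdGaussian (d : ℕ) :
    ∫ x, ‖x‖ ^ 2 ∂stdGaussian (Vec d) = d := by
  have h1 : ∀ x : Vec d, ‖x‖ ^ 2 = ∑ i, inner ℝ (EuclideanSpace.single i (1 : ℝ)) x ^ 2 := by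
    intro x
    simp [EuclideanSpace.norm_sq_eq, EuclideanSpace.inner_single_left]
  have h2 : ∀ i : Fin d, Integrable
      (fun x => inner ℝ (EuclideanSpace.single i (1 : ℝ)) x ^ 2) (stdGaussian (Vec d)) := by
    intro i
    refine (integrable_norm_pow_stdGaussian d 2).mono' (by fun_prop) (.of_forall fun x => ?_)
    rw [Real.norm_of_nonneg (by positivity), ← sq_abs]
    gcongr
    simpa using abs_real_inner_le_norm (EuclideanSpace.single i (1 : ℝ)) x
  simp_rw [h1]
  rw [integral_finsetSum _ fun i _ => h2 i]
  simp_rw [integral_inner_sq_stdGaussian]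
  simp

/-- The variance of ‖x‖² is nonnegative and its mean is d. Dividing a Gaussian fourth moment by this
radial factor produces the gain d⁻² on the sphere. -/
theorem sq_le_integral_norm_pow_four_stdGaussian (d : ℕ) :
    (d : ℝ) ^ 2 ≤ ∫ x, ‖x‖ ^ 4 ∂stdGaussian (Vec d) := by
  have h4 := integrable_norm_pow_stdGaussian d 4
  have h2 := integrable_norm_pow_stdGaussian d 2
  have h : 0 ≤ ∫ x : Vec d, (‖x‖ ^ 4 - 2 * d * ‖x‖ ^ 2 + d ^ 2) ∂stdGaussian (Vec d) := by
    refine integral_nonneg fun x => ?_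
    have : ‖x‖ ^ 4 - 2 * d * ‖x‖ ^ 2 + d ^ 2 = (‖x‖ ^ 2 - d) ^ 2 := by ring
    simp only [Pi.zero_apply, this]
    positivity
  have h' : Integrable (fun x : Vec d => ‖x‖ ^ 4 - 2 * d * ‖x‖ ^ 2) (stdGaussian (Vec d)) :=
    h4.sub (h2.const_mul _)
  rw [integral_add h' (integrable_const _), integral_sub h4 (h2.const_mul _),
    integral_const_mul, integral_norm_sq_stdGaussian] at h
  simp at h
  nlinarith

/-- Second moments of the uniform measure on the sphere. -/
theorem integral_inner_sq_uniformSphere {d : ℕ} (hd : 0 < d) (v : Vec d) :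
    ∫ e, inner ℝ v e ^ 2 ∂uniformSphere d = ‖v‖ ^ 2 / d := by
  have h := integral_stdGaussian_of_homogeneous hd 2 (H := fun e => inner ℝ v e ^ 2)
    (by fun_prop) (fun _ => by positivity)
    (fun r _ e _ => by rw [inner_smul_right]; ring)
  rw [integral_inner_sq_stdGaussian, integral_norm_sq_stdGaussian] at h
  field_simp
  linarith

/-- The variance of |⟨v, e⟩| is nonnegative. This is why the noise biases the mean by a factor √d
rather than d. -/
theorem integral_abs_inner_uniformSphere_le {d : ℕ} (hd : 0 < d) (v : Vec d) :
    ∫ e, |inner ℝ v e| ∂uniformSphere d ≤ ‖v‖ / √d := by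
  have := isProbabilityMeasure_uniformSphere hd
  have hm : MemLp (fun e => |inner ℝ v e|) 2 (uniformSphere d) := by
    refine MemLp.of_bound (by fun_prop) ‖v‖ ?_
    filter_upwards [ae_norm_eq_one_uniformSphere d] with e he
    simpa [he] using abs_real_inner_le_norm v e
  have hv := variance_nonneg (fun e => |inner ℝ v e|) (uniformSphere d)
  rw [variance_eq_sub hm] at hv
  simp only [Pi.pow_apply, sq_abs, integral_inner_sq_uniformSphere hd] at hv
  refine abs_le_of_sq_le_sq' ?_ (by positivity) |>.2
  rw [div_pow, Real.sq_sqrt (by positivity)]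
  linarith

end ZOClipSMD

namespace ZOClipSMD

/-! ### Gaussian moments -/

theorem mgf_strongDual_stdGaussian {d : ℕ} (L : StrongDual ℝ (Vec d)) (t : ℝ) :
    mgf L (stdGaussian (Vec d)) t = Real.exp (‖L‖ ^ 2 * t ^ 2 / 2) := by
  rw [mgf_gaussianReal (IsGaussian.map_eq_gaussianReal L), integral_strongDual_stdGaussian,
    variance_dual_stdGaussian, Real.coe_toNNReal _ (by positivity)]
  simp

theorem integrable_exp_mul_strongDual_stdGaussian {d : ℕ} (L : StrongDual ℝ (Vec d)) (t : ℝ) :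
    Integrable (fun x => Real.exp (t * L x)) (stdGaussian (Vec d)) := by
  rw [← mgf_pos_iff, mgf_strongDual_stdGaussian]
  positivity

theorem integrable_strongDual_pow_stdGaussian {d : ℕ} (L : StrongDual ℝ (Vec d)) (k : ℕ) :
    Integrable (fun x => L x ^ k) (stdGaussian (Vec d)) := by
  refine ((integrable_norm_pow_stdGaussian d k).const_mul (‖L‖ ^ k)).mono' (by fun_prop)
    (.of_forall fun x => ?_)
  rw [norm_pow, ← mul_pow]
  gcongr
  exact L.le_opNorm x

/-- Even moments of a linear functional of norm at most one under the standard Gaussian measure. -/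
theorem integral_strongDual_pow_stdGaussian_le {d : ℕ} (L : StrongDual ℝ (Vec d)) (hL : ‖L‖ ≤ 1)
    {m : ℕ} (hm : 0 < m) :
    ∫ x, L x ^ (2 * m) ∂stdGaussian (Vec d) ≤ 2 * (2 * Real.exp 1 * m) ^ m := by
  -- With t² = 2m the bound y^(2m) ≤ (2m)! exp y at y = t|L x| meets a moment generating function of
  -- size at most exp(t²/2) = e^m, so that only (2m)!/(2m)^m ≤ (2m)^m is left as a factor.
  set t : ℝ := √(2 * m) with ht
  have ht2 : t ^ 2 = 2 * m := Real.sq_sqrt (by positivity)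
  have hm' : (0 : ℝ) < m := by exact_mod_cast hm
  have ht2m : t ^ (2 * m) = (2 * m) ^ m := by rw [pow_mul, ht2]
  have hpt : ∀ x, L x ^ (2 * m) ≤
      (2 * m) ^ m * (Real.exp (t * L x) + Real.exp (-t * L x)) := by
    intro x
    have h1 := Real.pow_div_factorial_le_exp (t * |L x|) (by positivity) (2 * m)
    have h2 : Real.exp (t * |L x|) ≤ Real.exp (t * L x) + Real.exp (-t * L x) := by
      rcases abs_cases (L x) with ⟨h, _⟩ | ⟨h, _⟩ <;> rw [h]
      · linarith [Real.exp_pos (-t * L x)]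
      · rw [show t * -L x = -t * L x by ring]
        linarith [Real.exp_pos (t * L x)]
    have h3 : ((2 * m).factorial : ℝ) ≤ (2 * m) ^ m * (2 * m) ^ m := by
      rw [← pow_add, ← two_mul]
      exact_mod_cast Nat.factorial_le_pow (2 * m)
    have h4 : (t * |L x|) ^ (2 * m) = (2 * m) ^ m * L x ^ (2 * m) := by
      rw [mul_pow, ht2m, pow_mul, pow_mul, sq_abs]
    rw [h4, div_le_iff₀ (by positivity)] at h1
    have h5 : 0 < (2 * (m : ℝ)) ^ m := by positivity
    have h6 := Real.exp_pos (t * |L x|)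
    have : (2 * (m : ℝ)) ^ m * L x ^ (2 * m) ≤ (2 * (m : ℝ)) ^ m *
      ((2 * m) ^ m * (Real.exp (t * L x) + Real.exp (-t * L x))) := by
      calc _ ≤ _ := h1
        _ ≤ Real.exp (t * |L x|) * ((2 * m) ^ m * (2 * m) ^ m) := by gcongr
        _ = (2 * (m : ℝ)) ^ m * ((2 * m) ^ m * Real.exp (t * |L x|)) := by ring
        _ ≤ _ := by gcongr
    exact le_of_mul_le_mul_left this h5
  have hi := integrable_exp_mul_strongDual_stdGaussian L
  have hmgf : ∀ s : ℝ, s ^ 2 = 2 * m →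
      ∫ x, Real.exp (s * L x) ∂stdGaussian (Vec d) ≤ Real.exp 1 ^ m := by
    intro s hs
    have := mgf_strongDual_stdGaussian L s
    rw [mgf] at this
    rw [this, hs, ← Real.exp_nat_mul]
    gcongr
    have : ‖L‖ ^ 2 ≤ 1 := by nlinarith [norm_nonneg L]
    nlinarith
  calc _ ≤ ∫ x, (2 * m) ^ m * (Real.exp (t * L x) + Real.exp (-t * L x)) ∂stdGaussian (Vec d) :=
        integral_mono (integrable_strongDual_pow_stdGaussian L _)
          (((hi t).add (hi (-t))).const_mul _) hpt
    _ = (2 * m) ^ m * (∫ x, Real.exp (t * L x) ∂stdGaussian (Vec d) +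
          ∫ x, Real.exp (-t * L x) ∂stdGaussian (Vec d)) := by
        rw [integral_const_mul, integral_add (hi t) (hi (-t))]
    _ ≤ (2 * m) ^ m * (Real.exp 1 ^ m + Real.exp 1 ^ m) := by
        gcongr
        · exact hmgf t ht2
        · exact hmgf (-t) (by rw [neg_sq, ht2])
    _ = _ := by rw [mul_pow, mul_pow, mul_pow]; ring

/-! ### Concentration of odd Lipschitz functions -/

/-- Fourth moments of odd Lipschitz functions of a Gaussian vector, bounded by rotating an
independent pair of Gaussian vectors. -/
theorem integral_pow_four_stdGaussian_le {d : ℕ} {H : Vec d → ℝ} (hH : LipschitzWith 1 H)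
    (hodd : ∀ x, H (-x) = -H x) :
    ∫ x, H x ^ 4 ∂stdGaussian (Vec d) ≤ Real.pi ^ 4 * (2 * Real.exp 1) ^ 2 := by
  set γ := stdGaussian (Vec d) with hγ
  have hHc := hH.continuous
  -- integrability of fourth powers controlled by the sum of the norms
  have hdom : Integrable (fun z : Vec d × Vec d => (Real.pi * (‖z.1‖ + ‖z.2‖)) ^ 4) (γ.prod γ) := by
    have h1 : MemLp (fun z : Vec d × Vec d => ‖z.1‖) 4 (γ.prod γ) :=
      ((IsGaussian.memLp_id γ 4 (by simp)).comp_fst γ).norm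
    have h2 : MemLp (fun z : Vec d × Vec d => ‖z.2‖) 4 (γ.prod γ) :=
      ((IsGaussian.memLp_id γ 4 (by simp)).comp_snd γ).norm
    have := ((h1.add h2).const_mul Real.pi).integrable_norm_pow' (p := 4)
    refine this.congr (.of_forall fun z => ?_)
    simp only [Pi.add_apply, Real.norm_eq_abs]
    rw [abs_of_nonneg (by positivity)]
  -- difference quotients along the rotation
  let q : ℕ → Vec d × Vec d → ℝ := fun n z =>
    (n : ℝ) * (H (Real.cos (Real.pi / n) • z.1 + Real.sin (Real.pi / n) • z.2) - H z.1)
  have hqc : ∀ n, Continuous (q n) := fun n => by fun_prop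
  have hqb : ∀ n z, |q n z| ≤ Real.pi * (‖z.1‖ + ‖z.2‖) := by
    intro n z
    rcases Nat.eq_zero_or_pos n with rfl | hn
    · simp only [q, CharP.cast_eq_zero, zero_mul, abs_zero]
      positivity
    have hn' : (0 : ℝ) < n := by exact_mod_cast hn
    have h1 : |Real.cos (Real.pi / n) - 1| ≤ Real.pi / n := by
      have := Real.abs_cos_sub_cos_le (Real.pi / n) 0
      rwa [Real.cos_zero, sub_zero, abs_of_pos (by positivity : 0 < Real.pi / n)] at this
    have h2 : |Real.sin (Real.pi / n)| ≤ Real.pi / n := by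
      have := Real.abs_sin_sub_sin_le (Real.pi / n) 0
      rwa [Real.sin_zero, sub_zero, sub_zero, abs_of_pos (by positivity : 0 < Real.pi / n)] at this
    have h3 := hH.dist_le_mul (Real.cos (Real.pi / n) • z.1 + Real.sin (Real.pi / n) • z.2) z.1
    rw [Real.dist_eq, dist_eq_norm, NNReal.coe_one, one_mul,
      show Real.cos (Real.pi / n) • z.1 + Real.sin (Real.pi / n) • z.2 - z.1 =
        (Real.cos (Real.pi / n) - 1) • z.1 + Real.sin (Real.pi / n) • z.2 by module] at h3
    have h4 : ‖(Real.cos (Real.pi / n) - 1) • z.1 + Real.sin (Real.pi / n) • z.2‖ ≤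
        Real.pi / n * (‖z.1‖ + ‖z.2‖) := by
      refine (norm_add_le _ _).trans ?_
      rw [norm_smul, norm_smul, mul_add]
      gcongr <;> assumption
    simp only [q, abs_mul, Nat.abs_cast]
    calc _ ≤ (n : ℝ) * (Real.pi / n * (‖z.1‖ + ‖z.2‖)) := by gcongr; exact h3.trans h4
      _ = _ := by field_simp
  -- H is only Lipschitz, so the derivative along the rotation exists just almost everywhere, by
  -- Rademacher. At angle 0 the path passes through z.1 with velocity z.2. The factor π is n times
  -- the step π/n.
  have hqlim : ∀ᵐ z ∂γ.prod γ,
      Filter.Tendsto (fun n => q n z) Filter.atTop (nhds (Real.pi * fderiv ℝ H z.1 z.2)) := by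
    have hae : ∀ᵐ x ∂γ, DifferentiableAt ℝ H x :=
      (stdGaussian_absolutelyContinuous d).ae_le hH.ae_differentiableAt
    filter_upwards [Measure.quasiMeasurePreserving_fst.ae hae] with z hz
    have hg : HasDerivAt (fun θ : ℝ => H (Real.cos θ • z.1 + Real.sin θ • z.2))
        (fderiv ℝ H z.1 z.2) 0 := by
      have hp : HasDerivAt (fun θ : ℝ => Real.cos θ • z.1 + Real.sin θ • z.2) z.2 0 := by
        have := ((Real.hasDerivAt_cos 0).smul_const z.1).fun_add
          ((Real.hasDerivAt_sin 0).smul_const z.2)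
        rw [show -Real.sin 0 • z.1 + Real.cos 0 • z.2 = z.2 by simp] at this
        exact this
      have hz' : HasFDerivAt H (fderiv ℝ H z.1) (Real.cos 0 • z.1 + Real.sin 0 • z.2) := by
        simpa using hz.hasFDerivAt
      exact hz'.comp_hasDerivAt (0 : ℝ) hp
    have ht : Filter.Tendsto (fun n : ℕ => Real.pi / n) Filter.atTop (nhdsWithin 0 {0}ᶜ) := by
      refine tendsto_nhdsWithin_iff.2 ⟨tendsto_const_div_atTop_nhds_zero_nat _, ?_⟩
      filter_upwards [Filter.eventually_gt_atTop 0] with n hn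
      have : (0 : ℝ) < n := by exact_mod_cast hn
      have : 0 < Real.pi / n := by positivity
      simpa using this.ne'
    have := ((hasDerivAt_iff_tendsto_slope_zero.1 hg).comp ht).const_mul Real.pi
    refine this.congr fun n => ?_
    rcases Nat.eq_zero_or_pos n with rfl | hn
    · simp [q]
    · have hn' : (0 : ℝ) < n := by exact_mod_cast hn
      simp only [Function.comp, q, zero_add, Real.cos_zero, Real.sin_zero, one_smul, zero_smul,
        add_zero, smul_eq_mul]
      field_simp
  -- Rotating by the total angle π takes z.1 to -z.1, so by oddness the n increments telescope to -2
  -- H z.1, and 16 = 2⁴. Each increment is `q n` at a rotated pair. Convexity of the fourth power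
  -- averages the increments, and rotation invariance of γ ⊗ γ makes all n averages equal.
  have hbound : ∀ n : ℕ, 0 < n → 16 * ∫ x, H x ^ 4 ∂γ ≤ ∫ z, q n z ^ 4 ∂γ.prod γ := by
    intro n hn
    have hn' : (0 : ℝ) < n := by exact_mod_cast hn
    set ε := Real.pi / n with hε
    let a : ℕ → Vec d × Vec d → ℝ := fun i z =>
      H (Real.cos (i * ε) • z.1 + Real.sin (i * ε) • z.2)
    have hstep : ∀ i z, a (i + 1) z - a i z =
        (n : ℝ)⁻¹ * q n (ContinuousLinearMap.rotation (i * ε) z) := by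
      intro i z
      simp only [q, a, ContinuousLinearMap.rotation_apply, ← hε]
      rw [inv_mul_cancel_left₀ hn'.ne']
      congr 2
      push_cast
      rw [add_mul, one_mul, Real.cos_add, Real.sin_add]
      module
    have hpt : ∀ z, 16 * H z.1 ^ 4 ≤
        (n : ℝ)⁻¹ * ∑ i ∈ Finset.range n, q n (ContinuousLinearMap.rotation (i * ε) z) ^ 4 := by
      intro z
      have h1 : ∑ i ∈ Finset.range n, (a (i + 1) z - a i z) = -2 * H z.1 := by
        rw [Finset.sum_range_sub (fun i => a i z)]
        have : (n : ℝ) * ε = Real.pi := by rw [hε]; field_simp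
        simp only [a, this, CharP.cast_eq_zero, zero_mul, Real.cos_pi, Real.sin_pi, Real.cos_zero,
          Real.sin_zero, zero_smul, add_zero, one_smul, neg_smul, hodd]
        ring
      simp_rw [hstep] at h1
      rw [← Finset.mul_sum] at h1
      set b : ℕ → ℝ := fun i => q n (ContinuousLinearMap.rotation (i * ε) z)
      have h2 : (∑ i ∈ Finset.range n, b i) ^ 2 ≤ n * ∑ i ∈ Finset.range n, b i ^ 2 := by
        simpa using sq_sum_le_card_mul_sum_sq (s := Finset.range n) (f := b)
      have h3 : (∑ i ∈ Finset.range n, b i ^ 2) ^ 2 ≤ n * ∑ i ∈ Finset.range n, b i ^ 4 := by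
        have := sq_sum_le_card_mul_sum_sq (s := Finset.range n) (f := fun i => b i ^ 2)
        simpa [← pow_mul] using this
      calc 16 * H z.1 ^ 4 = ((n : ℝ)⁻¹ * ∑ i ∈ Finset.range n, b i) ^ 4 := by rw [h1]; ring
        _ = ((n : ℝ)⁻¹) ^ 4 * ((∑ i ∈ Finset.range n, b i) ^ 2) ^ 2 := by ring
        _ ≤ ((n : ℝ)⁻¹) ^ 4 * (n * ∑ i ∈ Finset.range n, b i ^ 2) ^ 2 := by gcongr
        _ = ((n : ℝ)⁻¹) ^ 4 * (n ^ 2 * (∑ i ∈ Finset.range n, b i ^ 2) ^ 2) := by ring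
        _ ≤ ((n : ℝ)⁻¹) ^ 4 * (n ^ 2 * (n * ∑ i ∈ Finset.range n, b i ^ 4)) := by gcongr
        _ = _ := by field_simp; rfl
    have hqi : Integrable (fun z => q n z ^ 4) (γ.prod γ) := by
      refine hdom.mono' ((hqc n).pow 4).aestronglyMeasurable (.of_forall fun z => ?_)
      rw [norm_pow]
      gcongr
      exact hqb n z
    have hrot : ∀ θ : ℝ, MeasurePreserving (ContinuousLinearMap.rotation θ) (γ.prod γ) (γ.prod γ) :=
      fun θ => ⟨by fun_prop, IsGaussian.map_rotation_eq_self
        (by simpa using integral_id_stdGaussian) θ⟩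
    have hri : ∀ θ : ℝ, Integrable
        (fun z => q n (ContinuousLinearMap.rotation θ z) ^ 4) (γ.prod γ) :=
      fun θ => (hrot θ).integrable_comp_of_integrable hqi
    have hre : ∀ θ : ℝ, ∫ z, q n (ContinuousLinearMap.rotation θ z) ^ 4 ∂γ.prod γ =
        ∫ z, q n z ^ 4 ∂γ.prod γ := by
      intro θ
      have h := integral_map (hrot θ).aemeasurable
        (f := fun z => q n z ^ 4) (by rw [(hrot θ).map_eq]; exact hqi.1)
      rw [← h, (hrot θ).map_eq]
    have hfst : ∫ z : Vec d × Vec d, 16 * H z.1 ^ 4 ∂γ.prod γ = 16 * ∫ x, H x ^ 4 ∂γ := by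
      rw [integral_const_mul, integral_fun_fst (fun x => H x ^ 4)]
      simp
    rw [← hfst]
    calc _ ≤ ∫ z, (n : ℝ)⁻¹ * ∑ i ∈ Finset.range n,
          q n (ContinuousLinearMap.rotation (i * ε) z) ^ 4 ∂γ.prod γ := by
          refine integral_mono_of_nonneg (.of_forall fun z => ?_)
            ((integrable_finsetSum _ fun i _ => hri _).const_mul _) (.of_forall hpt)
          simp only [Pi.zero_apply]
          positivity
      _ = ∫ z, q n z ^ 4 ∂γ.prod γ := by
          rw [integral_const_mul, integral_finsetSum _ fun i _ => hri _]
          simp_rw [hre]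
          rw [Finset.sum_const, Finset.card_range, nsmul_eq_mul]
          field_simp
  have hlim : Filter.Tendsto (fun n => ∫ z, q n z ^ 4 ∂γ.prod γ) Filter.atTop
      (nhds (∫ z, (Real.pi * fderiv ℝ H z.1 z.2) ^ 4 ∂γ.prod γ)) := by
    refine tendsto_integral_of_dominated_convergence _
      (fun n => ((hqc n).pow 4).aestronglyMeasurable) hdom (fun n => .of_forall fun z => ?_) ?_
    · rw [norm_pow]
      gcongr
      exact hqb n z
    · filter_upwards [hqlim] with z hz using hz.pow 4
  -- For fixed z.1 the integrand involves a linear functional of norm at most 1 of the Gaussian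
  -- vector z.2, so the moment bound with m = 2 applies.
  have hfin : ∫ z, (Real.pi * fderiv ℝ H z.1 z.2) ^ 4 ∂γ.prod γ ≤
      Real.pi ^ 4 * (2 * (2 * Real.exp 1 * 2) ^ 2) := by
    have hmeas : AEStronglyMeasurable
        (fun z : Vec d × Vec d => (Real.pi * fderiv ℝ H z.1 z.2) ^ 4) (γ.prod γ) :=
      ((aestronglyMeasurable_of_tendsto_ae _ (fun n => (hqc n).aestronglyMeasurable) hqlim).pow 4)
    have hL : ∀ x, ‖fderiv ℝ H x‖ ≤ 1 := fun x => norm_fderiv_le_of_lipschitz ℝ hH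
    have hint : Integrable
        (fun z : Vec d × Vec d => (Real.pi * fderiv ℝ H z.1 z.2) ^ 4) (γ.prod γ) := by
      refine hdom.mono' hmeas (.of_forall fun z => ?_)
      rw [norm_pow, norm_mul, Real.norm_of_nonneg Real.pi_pos.le]
      gcongr
      refine ((fderiv ℝ H z.1).le_opNorm z.2).trans ?_
      nlinarith [hL z.1, norm_nonneg z.2, norm_nonneg z.1]
    rw [integral_prod _ hint]
    have hin : ∀ x, ∫ y, (Real.pi * fderiv ℝ H x y) ^ 4 ∂γ ≤
        Real.pi ^ 4 * (2 * (2 * Real.exp 1 * 2) ^ 2) := by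
      intro x
      simp_rw [mul_pow]
      rw [integral_const_mul]
      gcongr
      simpa [mul_pow] using integral_strongDual_pow_stdGaussian_le (fderiv ℝ H x) (hL x) two_pos
    calc _ ≤ ∫ _x : Vec d, Real.pi ^ 4 * (2 * (2 * Real.exp 1 * 2) ^ 2) ∂γ :=
          integral_mono_of_nonneg (.of_forall fun x => integral_nonneg fun y => by positivity)
            (integrable_const _) (.of_forall hin)
      _ = _ := by simp
  have h16 : 16 * ∫ x, H x ^ 4 ∂γ ≤ Real.pi ^ 4 * (2 * (2 * Real.exp 1 * 2) ^ 2) :=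
    (ge_of_tendsto hlim (Filter.eventually_atTop.2 ⟨1, fun n hn => hbound n hn⟩)).trans hfin
  have : 0 < Real.pi ^ 4 * Real.exp 1 ^ 2 := by positivity
  nlinarith

/-- Fourth moments of odd Lipschitz functions on the sphere. -/
theorem integral_pow_four_uniformSphere_le {d : ℕ} (hd : 0 < d) {h : Vec d → ℝ} {L : ℝ}
    (hL : ∀ x y, |h x - h y| ≤ L * ‖x - y‖) (hodd : ∀ x, h (-x) = -h x) :
    ∫ e, h e ^ 4 ∂uniformSphere d ≤ Real.pi ^ 4 * (2 * Real.exp 1) ^ 2 * (3 * L) ^ 4 / d ^ 2 := by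
  have h0 : h 0 = 0 := by have := hodd 0; simp only [neg_zero] at this; linarith
  have hL0 : 0 ≤ L := by
    have hne : (EuclideanSpace.single (⟨0, hd⟩ : Fin d) (1 : ℝ) : Vec d) ≠ 0 := by simp
    have := (abs_nonneg _).trans (hL (EuclideanSpace.single (⟨0, hd⟩ : Fin d) (1 : ℝ)) 0)
    simpa using this
  have hb : ∀ x, |h x| ≤ L * ‖x‖ := fun x => by simpa [h0] using hL x 0
  have hc : Continuous h := by
    refine LipschitzWith.continuous (K := L.toNNReal) (LipschitzWith.of_dist_le_mul fun x y => ?_)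
    rw [Real.dist_eq, dist_eq_norm, Real.coe_toNNReal _ hL0]
    exact hL x y
  rcases hL0.eq_or_lt with rfl | hLpos
  · have : ∀ x, h x = 0 := fun x => by simpa using hb x
    simp [this]
  -- the homogeneous extension of the restriction to the sphere
  let H : Vec d → ℝ := fun z => ‖z‖ * h (‖z‖⁻¹ • z)
  -- The constant 3 is 1 + 2: the change of radius costs L, because |h| ≤ L on the sphere, and the
  -- change of direction costs 2L, because normalization moves points by at most 2‖z - w‖/‖w‖.
  have hHs : ∀ z w : Vec d, ‖w‖ ≤ ‖z‖ → |H z - H w| ≤ 3 * L * ‖z - w‖ := by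
    intro z w hzw
    rcases eq_or_ne w 0 with rfl | hw
    · simp only [H, norm_zero, zero_mul, sub_zero, abs_mul, abs_norm]
      have h1 : ‖z‖ * ‖‖z‖⁻¹ • z‖ = ‖z‖ := by
        rcases eq_or_ne z 0 with rfl | hz
        · simp
        · rw [norm_smul, norm_inv, norm_norm, inv_mul_cancel₀ (norm_ne_zero_iff.2 hz), mul_one]
      have h2 := hb (‖z‖⁻¹ • z)
      calc _ ≤ ‖z‖ * (L * ‖‖z‖⁻¹ • z‖) := by gcongr
        _ = L * ‖z‖ := by rw [mul_left_comm, h1]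
        _ ≤ _ := by nlinarith [norm_nonneg z]
    have hwp : 0 < ‖w‖ := norm_pos_iff.2 hw
    have hzp : 0 < ‖z‖ := hwp.trans_le hzw
    have hsub : ‖z‖ - ‖w‖ ≤ ‖z - w‖ := norm_sub_norm_le z w
    have hz1 : ‖‖z‖⁻¹ • z‖ = 1 := by
      rw [norm_smul, norm_inv, norm_norm, inv_mul_cancel₀ hzp.ne']
    have h1 : |h (‖z‖⁻¹ • z)| ≤ L := by simpa [hz1] using hb (‖z‖⁻¹ • z)
    have h2 : ‖w‖ * ‖‖z‖⁻¹ • z - ‖w‖⁻¹ • w‖ ≤ 2 * ‖z - w‖ := by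
      have : ‖w‖ * ‖‖z‖⁻¹ • z - ‖w‖⁻¹ • w‖ = ‖(‖w‖ - ‖z‖) • (‖z‖⁻¹ • z) + (z - w)‖ := by
        rw [← norm_norm w, ← norm_smul, norm_norm w, smul_sub, smul_inv_smul₀ hwp.ne', sub_smul,
          smul_inv_smul₀ hzp.ne']
        congr 1
        abel
      rw [this]
      refine (norm_add_le _ _).trans ?_
      rw [norm_smul, hz1, mul_one, Real.norm_eq_abs, abs_sub_comm, abs_of_nonneg (by linarith)]
      linarith
    have h3 := hL (‖z‖⁻¹ • z) (‖w‖⁻¹ • w)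
    calc |H z - H w| = |(‖z‖ - ‖w‖) * h (‖z‖⁻¹ • z) +
          ‖w‖ * (h (‖z‖⁻¹ • z) - h (‖w‖⁻¹ • w))| := by congr 1; simp only [H]; ring
      _ ≤ (‖z‖ - ‖w‖) * |h (‖z‖⁻¹ • z)| + ‖w‖ * |h (‖z‖⁻¹ • z) - h (‖w‖⁻¹ • w)| := by
          refine (abs_add_le _ _).trans ?_
          rw [abs_mul, abs_mul, abs_norm, abs_of_nonneg (by linarith : 0 ≤ ‖z‖ - ‖w‖)]
      _ ≤ ‖z - w‖ * L + ‖w‖ * (L * ‖‖z‖⁻¹ • z - ‖w‖⁻¹ • w‖) := by gcongr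
      _ ≤ 3 * L * ‖z - w‖ := by nlinarith
  have hHL : ∀ z w : Vec d, |H z - H w| ≤ 3 * L * ‖z - w‖ := by
    intro z w
    rcases le_total ‖w‖ ‖z‖ with hzw | hzw
    · exact hHs z w hzw
    · rw [abs_sub_comm, norm_sub_rev]
      exact hHs w z hzw
  have hH1 : LipschitzWith 1 (fun z => (3 * L)⁻¹ * H z) := by
    refine LipschitzWith.of_dist_le_mul fun z w => ?_
    rw [Real.dist_eq, ← mul_sub, abs_mul, abs_of_pos (by positivity), dist_eq_norm, NNReal.coe_one,
      one_mul, inv_mul_le_iff₀ (by positivity)]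
    exact hHL z w
  have hγ := integral_pow_four_stdGaussian_le hH1 (fun z => by
    simp only [H, norm_neg, smul_neg, hodd]; ring)
  simp_rw [mul_pow _ (H _)] at hγ
  rw [integral_const_mul, inv_pow, inv_mul_le_iff₀ (by positivity)] at hγ
  have hHm : Measurable fun z => H z ^ 4 := by fun_prop
  have hhom := integral_stdGaussian_of_homogeneous hd 4 hHm (fun _ => by positivity)
    (fun r hr e he => by
      simp only [H, norm_smul, he, mul_one, Real.norm_eq_abs, abs_of_pos hr, inv_one, one_smul,
        inv_smul_smul₀ hr.ne', one_mul, mul_pow])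
  have hsph : ∫ e, H e ^ 4 ∂uniformSphere d = ∫ e, h e ^ 4 ∂uniformSphere d := by
    refine integral_congr_ae ?_
    filter_upwards [ae_norm_eq_one_uniformSphere d] with e he
    simp [H, he]
  rw [hhom, hsph] at hγ
  have h4 := sq_le_integral_norm_pow_four_stdGaussian d
  have hd' : (0 : ℝ) < d := by exact_mod_cast hd
  rw [le_div_iff₀ (by positivity)]
  have : 0 ≤ ∫ e, h e ^ 4 ∂uniformSphere d := integral_nonneg fun e => by positivity
  nlinarith

/-- The symmetric difference is odd in e with Lipschitz constant 2τK, so it is centred automatically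
and nothing has to be subtracted. The 6 is 3 · 2. -/
theorem integral_two_point_pow_four_le {d : ℕ} (hd : 0 < d) {F : Vec d → ℝ} {K : ℝ}
    (hF : ∀ x y, |F x - F y| ≤ K * ‖x - y‖) (x : Vec d) {τ : ℝ} (hτ : 0 < τ) :
    ∫ e, (F (x + τ • e) - F (x - τ • e)) ^ 4 ∂uniformSphere d ≤
      Real.pi ^ 4 * (2 * Real.exp 1) ^ 2 * (6 * τ * K) ^ 4 / d ^ 2 := by
  have h := integral_pow_four_uniformSphere_le hd (h := fun e => F (x + τ • e) - F (x - τ • e))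
    (L := 2 * τ * K) (fun y z => ?_) (fun y => ?_)
  · rwa [show 3 * (2 * τ * K) = 6 * τ * K by ring] at h
  · have h1 := hF (x + τ • y) (x + τ • z)
    have h2 := hF (x - τ • y) (x - τ • z)
    rw [show x + τ • y - (x + τ • z) = τ • (y - z) by module, norm_smul, Real.norm_of_nonneg hτ.le]
      at h1
    rw [show x - τ • y - (x - τ • z) = -(τ • (y - z)) by module, norm_neg, norm_smul,
      Real.norm_of_nonneg hτ.le] at h2
    rw [abs_le] at *
    constructor <;> linarith
  · simp only [smul_neg, sub_neg_eq_add, ← sub_eq_add_neg]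
    ring

end ZOClipSMD

namespace ZOClipSMD

/-! ### The `ℓ_r` norms -/

section EllNorm

variable {d : ℕ}

theorem ellNorm_nonneg (r : ℝ≥0∞) [Fact (1 ≤ r)] (x : Vec d) : 0 ≤ ellNorm r x := norm_nonneg _

theorem ellNorm_smul (r : ℝ≥0∞) [Fact (1 ≤ r)] (a : ℝ) (x : Vec d) :
    ellNorm r (a • x) = |a| * ellNorm r x := by
  have := norm_smul a (WithLp.toLp r x.ofLp : PiLp r (fun _ : Fin d => ℝ))
  simpa [ellNorm] using this

theorem ellNorm_eq_zero (r : ℝ≥0∞) [Fact (1 ≤ r)] {x : Vec d} : ellNorm r x = 0 ↔ x = 0 := by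
  rw [ellNorm, norm_eq_zero]
  constructor
  · intro h
    ext i
    simpa using congrArg (fun z : PiLp r (fun _ : Fin d => ℝ) => z i) h
  · rintro rfl
    rfl

theorem continuous_ellNorm (r : ℝ≥0∞) [Fact (1 ≤ r)] : Continuous (ellNorm (d := d) r) := by
  unfold ellNorm
  fun_prop

theorem ellNorm_top (x : Vec d) : ellNorm ∞ x = ⨆ i, |x i| := by
  simp [ellNorm, PiLp.norm_eq_ciSup]

theorem ellNorm_eq_sum {r : ℝ≥0∞} (hr : 0 < r.toReal) (x : Vec d) :
    ellNorm r x = (∑ i, |x i| ^ r.toReal) ^ (1 / r.toReal) := by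
  simp [ellNorm, PiLp.norm_eq_sum hr]

theorem ellNorm_one (x : Vec d) : ellNorm 1 x = ∑ i, |x i| := by
  rw [ellNorm_eq_sum (by simp)]
  simp

theorem abs_apply_le_ellNorm_top (x : Vec d) (i : Fin d) : |x i| ≤ ellNorm ∞ x := by
  rw [ellNorm_top]
  exact le_ciSup (f := fun i => |x i|) (Set.finite_range _).bddAbove i

theorem inner_eq_sum (x y : Vec d) : inner ℝ x y = ∑ i, x i * y i := by
  simp [PiLp.inner_apply, mul_comm]

/-- Hölder's inequality for the Euclidean inner product. -/
theorem abs_inner_le_ellNorm_mul {p q : ℝ≥0∞} (hpq : p.HolderConjugate q) (x y : Vec d) :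
    |inner ℝ x y| ≤ ellNorm p x * ellNorm q y := by
  have key : ∀ x y : Vec d, |inner ℝ x y| ≤ ellNorm 1 x * ellNorm ∞ y := by
    intro x y
    rw [inner_eq_sum, ellNorm_one, Finset.sum_mul]
    refine (Finset.abs_sum_le_sum_abs _ _).trans (Finset.sum_le_sum fun i _ => ?_)
    rw [abs_mul]
    gcongr
    exact abs_apply_le_ellNorm_top y i
  have hsum := ENNReal.holderConjugate_iff.1 hpq
  rcases eq_or_ne q ∞ with rfl | hq
  · have : p = 1 := by simpa using hsum
    subst this
    exact key x y
  rcases eq_or_ne p ∞ with rfl | hp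
  · have : q = 1 := by simpa using hsum
    subst this
    rw [real_inner_comm, mul_comm]
    exact key y x
  have hp1 : 1 < p := by
    have h1 : p⁻¹ < 1 := by
      rw [← hsum]
      refine ENNReal.lt_add_right ?_ (by simpa using hq)
      intro h
      rw [h] at hsum
      simp at hsum
    exact ENNReal.inv_lt_one.1 h1
  have hconj : p.toReal.HolderConjugate q.toReal := by
    rw [Real.holderConjugate_iff]
    have hp0 : p ≠ 0 := (zero_lt_one.trans hp1).ne'
    have hq0 : q ≠ 0 := by
      rintro rfl
      simp at hsum
    refine ⟨?_, ?_⟩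
    · rw [← ENNReal.toReal_one]
      exact (ENNReal.toReal_lt_toReal (by simp) hp).2 hp1
    · rw [← ENNReal.toReal_inv, ← ENNReal.toReal_inv, ← ENNReal.toReal_add (by simpa using hp0)
        (by simpa using hq0), hsum, ENNReal.toReal_one]
  rw [inner_eq_sum, ellNorm_eq_sum hconj.pos, ellNorm_eq_sum hconj.symm.pos]
  refine abs_le.2 ⟨?_, Real.inner_le_Lp_mul_Lq _ _ _ hconj⟩
  have := Real.inner_le_Lp_mul_Lq Finset.univ (fun i => -x i) y hconj
  simp only [neg_mul, Finset.sum_neg_distrib, abs_neg] at this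
  linarith

theorem ellNorm_le_norm {q : ℝ≥0∞} (hq : 2 ≤ q) (x : Vec d) : ellNorm q x ≤ ‖x‖ := by
  have habs : ∀ i, |x i| ≤ ‖x‖ := fun i => by simpa using PiLp.norm_apply_le x i
  rcases eq_or_ne q ∞ with rfl | hqt
  · rw [ellNorm_top]
    exact Real.iSup_le habs (norm_nonneg _)
  have hq2 : 2 ≤ q.toReal := by
    rw [← ENNReal.toReal_ofNat]
    exact (ENNReal.toReal_le_toReal (by simp) hqt).2 hq
  have hq0 : 0 < q.toReal := by linarith
  rw [ellNorm_eq_sum hq0, one_div, Real.rpow_inv_le_iff_of_pos (by positivity) (norm_nonneg _) hq0]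
  calc ∑ i, |x i| ^ q.toReal = ∑ i, |x i| ^ (2 : ℝ) * |x i| ^ (q.toReal - 2) := by
        refine Finset.sum_congr rfl fun i _ => ?_
        rw [← Real.rpow_add_of_nonneg (abs_nonneg _) (by norm_num) (by linarith)]
        ring_nf
    _ ≤ ∑ i, |x i| ^ (2 : ℝ) * ‖x‖ ^ (q.toReal - 2) := by
        gcongr with i
        exact habs i
    _ = ‖x‖ ^ (2 : ℝ) * ‖x‖ ^ (q.toReal - 2) := by
        rw [← Finset.sum_mul]
        congr 1
        rw [Real.rpow_two, EuclideanSpace.norm_sq_eq]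
        simp
    _ = ‖x‖ ^ q.toReal := by
        rw [← Real.rpow_add_of_nonneg (norm_nonneg _) (by norm_num) (by linarith)]
        ring_nf

/-- By duality: ‖x‖² ≤ ‖x‖_p ‖x‖_q ≤ ‖x‖_p ‖x‖. -/
theorem norm_le_ellNorm {p q : ℝ≥0∞} [Fact (1 ≤ p)] (hpq : p.HolderConjugate q) (hq : 2 ≤ q)
    (x : Vec d) : ‖x‖ ≤ ellNorm p x := by
  rcases eq_or_ne x 0 with rfl | hx
  · simpa using ellNorm_nonneg p (0 : Vec d)
  have h := abs_inner_le_ellNorm_mul hpq x x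
  rw [real_inner_self_eq_norm_sq, abs_of_nonneg (by positivity)] at h
  have h2 := ellNorm_le_norm hq x
  have h3 : 0 < ‖x‖ := norm_pos_iff.2 hx
  nlinarith [ellNorm_nonneg p x]

/-- Comparison of the `ℓ_q` norm with the norm of even order `2 m ≥ q`. -/
theorem ellNorm_pow_four_le_of_le {q : ℝ≥0∞} (hq : 2 ≤ q) (hqt : q ≠ ∞) {m : ℕ} (hm : 0 < m)
    (hqm : q.toReal ≤ 2 * m) (x : Vec d) :
    ellNorm q x ^ 4 ≤ (d : ℝ) ^ (4 / q.toReal) * (d : ℝ) ^ (-(2 / m) : ℝ) *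
      (∑ i, x i ^ (2 * m)) ^ (2 / m : ℝ) := by
  have hm' : (0 : ℝ) < m := by exact_mod_cast hm
  have hq2 : 2 ≤ q.toReal := by
    rw [← ENNReal.toReal_ofNat]
    exact (ENNReal.toReal_le_toReal (by simp) hqt).2 hq
  set r := q.toReal with hr
  have hq0 : 0 < r := by linarith
  have h := Real.rpow_sum_le_const_mul_sum_rpow Finset.univ (fun i => |x i| ^ r)
    (p := 2 * m / r) ((one_le_div hq0).2 hqm)
  have h2 : ∀ i, |(|x i| ^ r)| = |x i| ^ r := fun i => abs_of_nonneg (by positivity)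
  have h3 : ∀ i, (|x i| ^ r) ^ (2 * m / r) = x i ^ (2 * m) := fun i => by
    rw [← Real.rpow_mul (abs_nonneg _), mul_div_cancel₀ _ hq0.ne',
      show (2 * m : ℝ) = ((2 * m : ℕ) : ℝ) by push_cast; ring, Real.rpow_natCast, pow_mul, sq_abs,
      pow_mul]
  simp only [h2, h3, Finset.card_univ, Fintype.card_fin] at h
  set S := ∑ i, |x i| ^ r with hS
  set V := ∑ i, x i ^ (2 * m) with hV
  have hS0 : 0 ≤ S := by positivity
  have hV0 : 0 ≤ V := Finset.sum_nonneg fun i _ => by rw [pow_mul]; positivity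
  have h4 : ellNorm q x ^ 4 = (S ^ (2 * m / r)) ^ (2 / m : ℝ) := by
    rw [ellNorm_eq_sum hq0, ← hr, ← hS, ← Real.rpow_mul hS0, ← Real.rpow_natCast,
      ← Real.rpow_mul hS0]
    congr 1
    field_simp
    norm_num
  rcases Nat.eq_zero_or_pos d with rfl | hd
  · simp [h4, S, V, div_ne_zero two_ne_zero hm'.ne', hm'.ne', hq0.ne']
  have hd' : (0 : ℝ) < d := by exact_mod_cast hd
  calc ellNorm q x ^ 4 = (S ^ (2 * m / r)) ^ (2 / m : ℝ) := h4
    _ ≤ ((d : ℝ) ^ (2 * m / r - 1) * V) ^ (2 / m : ℝ) := by gcongr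
    _ = (d : ℝ) ^ (4 / r - 2 / m) * V ^ (2 / m : ℝ) := by
        rw [Real.mul_rpow (by positivity) hV0, ← Real.rpow_mul hd'.le]
        congr 2
        field_simp
        ring
    _ = _ := by rw [sub_eq_add_neg, Real.rpow_add hd']

/-- Comparison of the `ℓ_q` norm with a norm of even order. -/
theorem ellNorm_pow_four_le {q : ℝ≥0∞} (hq : 2 ≤ q) {m : ℕ} (hm : 0 < m) (x : Vec d) :
    ellNorm q x ^ 4 ≤ (d : ℝ) ^ (4 / q.toReal) * (∑ i, x i ^ (2 * m)) ^ (2 / m : ℝ) := by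
  have hm' : (0 : ℝ) < m := by exact_mod_cast hm
  set V := ∑ i, x i ^ (2 * m) with hV
  have hV0 : 0 ≤ V := Finset.sum_nonneg fun i _ => by rw [pow_mul]; positivity
  set N := V ^ (1 / (2 * m) : ℝ) with hN
  have hN0 : 0 ≤ N := by positivity
  have habs : ∀ i, |x i| ≤ N := by
    intro i
    rw [hN, one_div, Real.le_rpow_inv_iff_of_pos (abs_nonneg _) hV0 (by positivity),
      show (2 * m : ℝ) = ((2 * m : ℕ) : ℝ) by push_cast; ring, Real.rpow_natCast, pow_mul, sq_abs,
      ← pow_mul]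
    exact Finset.single_le_sum (f := fun i => x i ^ (2 * m))
      (fun i _ => by rw [pow_mul]; positivity) (Finset.mem_univ i)
  have hle : ellNorm q x ≤ (d : ℝ) ^ (1 / q.toReal) * N := by
    -- For q = ∞ one has `q.toReal = 0` and division by zero gives exponent 0, so the power of d is
    -- 1, as the maximum norm requires.
    rcases eq_or_ne q ∞ with rfl | hqt
    · rw [ellNorm_top]
      simpa using Real.iSup_le habs hN0
    have hq2 : 2 ≤ q.toReal := by
      rw [← ENNReal.toReal_ofNat]
      exact (ENNReal.toReal_le_toReal (by simp) hqt).2 hq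
    have hq0 : 0 < q.toReal := by linarith
    rw [ellNorm_eq_sum hq0]
    calc (∑ i, |x i| ^ q.toReal) ^ (1 / q.toReal) ≤
          (∑ _i : Fin d, N ^ q.toReal) ^ (1 / q.toReal) := by
          gcongr with i
          exact habs i
      _ = _ := by
          rw [Finset.sum_const, Finset.card_univ, Fintype.card_fin, nsmul_eq_mul,
            Real.mul_rpow (by positivity) (by positivity), ← Real.rpow_mul hN0,
            mul_one_div_cancel hq0.ne', Real.rpow_one]
  have h0 : 0 ≤ ellNorm q x := by
    have : Fact (1 ≤ q) := ⟨one_le_two.trans hq⟩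
    exact ellNorm_nonneg q x
  calc ellNorm q x ^ 4 ≤ ((d : ℝ) ^ (1 / q.toReal) * N) ^ 4 := by gcongr
    _ = _ := by
      rw [mul_pow, hN, ← Real.rpow_natCast, ← Real.rpow_natCast, ← Real.rpow_mul (by positivity),
        ← Real.rpow_mul hV0]
      congr 2
      · push_cast; ring
      · push_cast; field_simp; norm_num

end EllNorm

/-! ### Moments of the `ℓ_q` norm on the sphere -/

theorem integrable_rpow_of_le_one {α : Type*} [MeasurableSpace α] {μ : Measure α}
    [IsFiniteMeasure μ] {g : α → ℝ} (hg : Integrable g μ) (h0 : ∀ x, 0 ≤ g x) {s : ℝ}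
    (hs0 : 0 ≤ s) (hs1 : s ≤ 1) : Integrable (fun x => g x ^ s) μ := by
  refine (hg.add (integrable_const 1)).mono' (hg.1.aemeasurable.pow_const s).aestronglyMeasurable
    (.of_forall fun x => ?_)
  rw [Real.norm_of_nonneg (Real.rpow_nonneg (h0 x) s), Pi.add_apply]
  rcases le_total 1 (g x) with h | h
  · calc g x ^ s ≤ g x ^ (1 : ℝ) := Real.rpow_le_rpow_of_exponent_le h hs1
      _ ≤ g x + 1 := by rw [Real.rpow_one]; linarith
  · linarith [Real.rpow_le_one (h0 x) h hs0, h0 x]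

/-- Jensen's inequality for a concave power. -/
theorem integral_rpow_le_rpow_integral {α : Type*} [MeasurableSpace α] {μ : Measure α}
    [IsProbabilityMeasure μ] {g : α → ℝ} (hg : Integrable g μ) (h0 : ∀ x, 0 ≤ g x) {s : ℝ}
    (hs0 : 0 ≤ s) (hs1 : s ≤ 1) : ∫ x, g x ^ s ∂μ ≤ (∫ x, g x ∂μ) ^ s :=
  (Real.concaveOn_rpow hs0 hs1).le_map_integral
    (Real.continuous_rpow_const hs0).continuousOn isClosed_Ici
    (.of_forall h0) hg (integrable_rpow_of_le_one hg h0 hs0 hs1)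

/-- The exponent 2/m is at most 1 for m ≥ 2, so Jensen moves it outside the integral, where only
even moments of single coordinates are needed. -/
theorem integral_sum_pow_rpow_stdGaussian_le (d : ℕ) {m : ℕ} (hm : 2 ≤ m) :
    Integrable (fun x : Vec d => (∑ i, x i ^ (2 * m)) ^ (2 / m : ℝ)) (stdGaussian (Vec d)) ∧
    ∫ x : Vec d, (∑ i, x i ^ (2 * m)) ^ (2 / m : ℝ) ∂stdGaussian (Vec d) ≤
      (d : ℝ) ^ (2 / m : ℝ) * (8 * Real.exp 1 ^ 2 * m ^ 2) := by
  have hm' : (2 : ℝ) ≤ m := by exact_mod_cast hm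
  have hpos : ∀ x : Vec d, 0 ≤ ∑ i, x i ^ (2 * m) := fun x =>
    Finset.sum_nonneg fun i _ => by rw [pow_mul]; positivity
  let L : Fin d → StrongDual ℝ (Vec d) := fun i => innerSL ℝ (EuclideanSpace.single i (1 : ℝ))
  have hL : ∀ i (x : Vec d), L i x = x i := fun i x => by
    simp [L, EuclideanSpace.inner_single_left]
  have hL1 : ∀ i, ‖L i‖ ≤ 1 := fun i => by simp [L]
  have hi : ∀ i, Integrable (fun x : Vec d => x i ^ (2 * m)) (stdGaussian (Vec d)) := fun i => by
    simpa [hL] using integrable_strongDual_pow_stdGaussian (L i) (2 * m)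
  have hI : Integrable (fun x : Vec d => ∑ i, x i ^ (2 * m)) (stdGaussian (Vec d)) :=
    integrable_finsetSum _ fun i _ => hi i
  have hs0 : (0 : ℝ) ≤ 2 / m := by positivity
  have hs1 : (2 / m : ℝ) ≤ 1 := (div_le_one (by linarith)).2 hm'
  refine ⟨integrable_rpow_of_le_one hI hpos hs0 hs1,
    (integral_rpow_le_rpow_integral hI hpos hs0 hs1).trans ?_⟩
  have hsum : ∫ x : Vec d, ∑ i, x i ^ (2 * m) ∂stdGaussian (Vec d) ≤
      d * (2 * (2 * Real.exp 1 * m) ^ m) := by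
    rw [integral_finsetSum _ fun i _ => hi i]
    calc _ ≤ ∑ _i : Fin d, 2 * (2 * Real.exp 1 * m) ^ m := by
          refine Finset.sum_le_sum fun i _ => ?_
          simpa [hL] using integral_strongDual_pow_stdGaussian_le (L i) (hL1 i) (by omega : 0 < m)
      _ = _ := by simp
  calc _ ≤ (d * (2 * (2 * Real.exp 1 * m) ^ m)) ^ (2 / m : ℝ) :=
        Real.rpow_le_rpow (integral_nonneg hpos) hsum hs0
    _ = (d : ℝ) ^ (2 / m : ℝ) * (2 ^ (2 / m : ℝ) * (2 * Real.exp 1 * m) ^ 2) := by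
        rw [Real.mul_rpow (by positivity) (by positivity),
          Real.mul_rpow (by positivity) (by positivity), ← Real.rpow_natCast,
          ← Real.rpow_mul (by positivity), mul_div_cancel₀ _ (by positivity)]
        norm_num
    _ ≤ (d : ℝ) ^ (2 / m : ℝ) * (2 ^ (1 : ℝ) * (2 * Real.exp 1 * m) ^ 2) := by
        gcongr
        norm_num
    _ = _ := by rw [Real.rpow_one]; ring

theorem aCoef_pos {d : ℕ} (hd : 2 ≤ d) {q : ℝ≥0∞} (hq : 2 ≤ q) : 0 < aCoef d q := by
  have hd' : (2 : ℝ) ≤ d := by exact_mod_cast hd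
  have hlog : Real.log 2 ≤ Real.log d := Real.log_le_log (by norm_num) hd'
  have h2 := Real.log_two_gt_d9
  have h32 : 0 < √(32 * Real.log d - 8) := Real.sqrt_pos.2 (by linarith)
  unfold aCoef
  split_ifs with h
  · positivity
  · have hq2 : 2 ≤ q.toReal := by
      rw [← ENNReal.toReal_ofNat]
      exact (ENNReal.toReal_le_toReal (by simp) h).2 hq
    have : 0 < √(2 * q.toReal - 1) := Real.sqrt_pos.2 (by linarith)
    positivity

/-- Fourth moment of the `ℓ_q` norm on the sphere. -/
theorem integral_ellNorm_pow_four_uniformSphere_le {d : ℕ} (hd : 2 ≤ d) {q : ℝ≥0∞} (hq : 2 ≤ q) :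
    ∫ e, ellNorm q e ^ 4 ∂uniformSphere d ≤ 8 * Real.exp 1 ^ 4 * aCoef d q ^ 4 := by
  have : Fact (1 ≤ q) := ⟨one_le_two.trans hq⟩
  have hd2 : (2 : ℝ) ≤ d := by exact_mod_cast hd
  have hd' : (0 : ℝ) < d := by linarith
  have hlog : Real.log 2 ≤ Real.log d := Real.log_le_log (by norm_num) hd2
  have hlog2 := Real.log_two_gt_d9
  have he : 1 ≤ Real.exp 1 := Real.one_le_exp (by norm_num)
  have hhom := integral_stdGaussian_of_homogeneous (by omega : 0 < d) 4
    (H := fun e => ellNorm q e ^ 4) ((continuous_ellNorm q).measurable.pow_const 4)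
    (fun _ => by positivity) (fun r hr e _ => by
      rw [ellNorm_smul, abs_of_pos hr, mul_pow])
  have h4 := sq_le_integral_norm_pow_four_stdGaussian d
  set I := ∫ e, ellNorm q e ^ 4 ∂uniformSphere d with hI
  have hI0 : 0 ≤ I := integral_nonneg fun e => by positivity
  -- The Gaussian integral is the spherical one times E‖x‖⁴ ≥ d², and d^(4/q)/d² is the fourth power
  -- of the prefactor of a_q.
  have hle : ∀ A : ℝ, ∫ x, ellNorm q x ^ 4 ∂stdGaussian (Vec d) ≤ (d : ℝ) ^ (4 / q.toReal) * A →
      I ≤ ((d : ℝ) ^ (1 / q.toReal - 1 / 2)) ^ 4 * A := by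
    intro A hA
    have h1 : ((d : ℝ) ^ (1 / q.toReal - 1 / 2)) ^ 4 = (d : ℝ) ^ (4 / q.toReal) / d ^ 2 := by
      rw [← Real.rpow_natCast, ← Real.rpow_mul hd'.le, ← Real.rpow_natCast (d : ℝ) 2,
        ← Real.rpow_sub hd']
      congr 1
      push_cast
      ring
    rw [h1, div_mul_eq_mul_div, le_div_iff₀ (by positivity)]
    nlinarith
  have hB : I ≤ ((d : ℝ) ^ (1 / q.toReal - 1 / 2)) ^ 4 *
      (8 * Real.exp 1 ^ 4 * (32 * Real.log d - 8) ^ 2) := by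
    -- With m ≥ log d the factor d^(2/m) is at most e². The summand 1 ensures m ≥ 2, and m ≤ log d +
    -- 2 ≤ 32 log d - 8 since d ≥ 2.
    set m := ⌈Real.log d⌉₊ + 1 with hm
    have hm1 : Real.log d ≤ m := (Nat.le_ceil _).trans (by rw [hm]; push_cast; linarith)
    have hm2 : (m : ℝ) ≤ 32 * Real.log d - 8 := by
      have := (Nat.ceil_lt_add_one (by linarith : 0 ≤ Real.log d)).le
      rw [hm]; push_cast; linarith
    have hmge : 2 ≤ m := by
      have : 0 < ⌈Real.log d⌉₊ := Nat.ceil_pos.2 (by linarith)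
      omega
    have hm0 : (0 : ℝ) < m := by positivity
    obtain ⟨hi, hb⟩ := integral_sum_pow_rpow_stdGaussian_le d hmge
    refine hle _ ?_
    calc _ ≤ ∫ x : Vec d, (d : ℝ) ^ (4 / q.toReal) * (∑ i, x i ^ (2 * m)) ^ (2 / m : ℝ)
          ∂stdGaussian (Vec d) := integral_mono_of_nonneg (.of_forall fun x => by positivity)
            (hi.const_mul _) (.of_forall fun x => ellNorm_pow_four_le hq (by omega) x)
      _ ≤ (d : ℝ) ^ (4 / q.toReal) * ((d : ℝ) ^ (2 / m : ℝ) * (8 * Real.exp 1 ^ 2 * m ^ 2)) := by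
          rw [integral_const_mul]; gcongr
      _ ≤ (d : ℝ) ^ (4 / q.toReal) *
          (Real.exp 1 ^ 2 * (8 * Real.exp 1 ^ 2 * (32 * Real.log d - 8) ^ 2)) := by
          gcongr
          rw [Real.rpow_def_of_pos hd', ← Real.exp_nat_mul]
          refine Real.exp_le_exp.2 ?_
          rw [mul_div_assoc', div_le_iff₀ hm0]
          push_cast
          linarith
      _ = _ := by ring
  unfold aCoef
  split_ifs with h
  · rw [mul_pow, show √(32 * Real.log d - 8) ^ 4 = (√(32 * Real.log d - 8) ^ 2) ^ 2 by ring,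
      Real.sq_sqrt (by linarith)]
    subst h
    simp only [ENNReal.toReal_top, div_zero, zero_sub] at hB
    linarith
  · have hq2 : 2 ≤ q.toReal := by
      rw [← ENNReal.toReal_ofNat]
      exact (ENNReal.toReal_le_toReal (by simp) h).2 hq
    have hA : I ≤ ((d : ℝ) ^ (1 / q.toReal - 1 / 2)) ^ 4 *
        (8 * Real.exp 1 ^ 4 * (2 * q.toReal - 1) ^ 2) := by
      -- Now 2m ≥ q, so the power mean inequality supplies d^(-2/m) and cancels the factor d^(2/m).
      -- The bound m ≤ q/2 + 2 ≤ 2q - 1 is exactly q ≥ 2.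
      set m := ⌈q.toReal / 2⌉₊ + 1 with hm
      have hm1 : q.toReal ≤ 2 * m := by
        have := Nat.le_ceil (q.toReal / 2)
        rw [hm]; push_cast; linarith
      have hm2 : (m : ℝ) ≤ 2 * q.toReal - 1 := by
        have := (Nat.ceil_lt_add_one (by linarith : 0 ≤ q.toReal / 2)).le
        rw [hm]; push_cast; linarith
      have hmge : 2 ≤ m := by
        have : 0 < ⌈q.toReal / 2⌉₊ := Nat.ceil_pos.2 (by linarith)
        omega
      obtain ⟨hi, hb⟩ := integral_sum_pow_rpow_stdGaussian_le d hmge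
      refine hle _ ?_
      calc _ ≤ ∫ x : Vec d, (d : ℝ) ^ (4 / q.toReal) * (d : ℝ) ^ (-(2 / m) : ℝ) *
            (∑ i, x i ^ (2 * m)) ^ (2 / m : ℝ) ∂stdGaussian (Vec d) :=
            integral_mono_of_nonneg (.of_forall fun x => by positivity)
              (hi.const_mul _)
              (.of_forall fun x => ellNorm_pow_four_le_of_le hq h (by omega) hm1 x)
        _ ≤ (d : ℝ) ^ (4 / q.toReal) * (d : ℝ) ^ (-(2 / m) : ℝ) *
            ((d : ℝ) ^ (2 / m : ℝ) * (8 * Real.exp 1 ^ 2 * m ^ 2)) := by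
            rw [integral_const_mul]; gcongr
        _ = (d : ℝ) ^ (4 / q.toReal) * (8 * Real.exp 1 ^ 2 * m ^ 2) := by
            rw [Real.rpow_neg hd'.le]; field_simp
        _ ≤ (d : ℝ) ^ (4 / q.toReal) * (8 * Real.exp 1 ^ 4 * (2 * q.toReal - 1) ^ 2) := by
            gcongr
            · norm_num
    rw [mul_pow]
    rcases min_cases (√(32 * Real.log d - 8)) (√(2 * q.toReal - 1)) with ⟨hmin, _⟩ | ⟨hmin, _⟩
    · rw [hmin, show √(32 * Real.log d - 8) ^ 4 = (√(32 * Real.log d - 8) ^ 2) ^ 2 by ring,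
        Real.sq_sqrt (by linarith)]
      linarith
    · rw [hmin, show √(2 * q.toReal - 1) ^ 4 = (√(2 * q.toReal - 1) ^ 2) ^ 2 by ring,
        Real.sq_sqrt (by linarith)]
      linarith

end ZOClipSMD

namespace ZOClipSMD

/-! ### The gradient of the ball average -/

/-- Bochner integration in polar coordinates. -/
theorem integral_polar {d : ℕ} (hd : 0 < d) {f : Vec d → ℝ} (hf : Integrable f) :
    ∫ x, f x = ∫ e, (∫ r in Set.Ioi (0 : ℝ), r ^ (d - 1) * f (r • e.1))
      ∂(volume : Measure (Vec d)).toSphere := by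
  have : Nonempty (Fin d) := ⟨⟨0, hd⟩⟩
  have hmp := (volume : Measure (Vec d)).measurePreserving_homeomorphUnitSphereProd
  rw [finrank_euclideanSpace, Fintype.card_fin] at hmp
  have hemb := (homeomorphUnitSphereProd (Vec d)).measurableEmbedding
  let g : Metric.sphere (0 : Vec d) 1 × Set.Ioi (0 : ℝ) → ℝ := fun z => f (z.2.1 • z.1.1)
  have hg : ∀ x : ({(0)}ᶜ : Set (Vec d)), g (homeomorphUnitSphereProd (Vec d) x) = f x.1 := by
    intro x
    have hx : ‖(x : Vec d)‖ ≠ 0 := norm_ne_zero_iff.2 x.2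
    simp [g, smul_smul, hx]
  have h1 : ∫ x, f x = ∫ z, g z
      ∂((volume : Measure (Vec d)).toSphere.prod (Measure.volumeIoiPow (d - 1))) := by
    rw [← hmp.integral_comp hemb]
    simp_rw [hg]
    rw [integral_subtype_comap (measurableSet_singleton _).compl f, restrict_compl_singleton]
  have h2 : Integrable g
      ((volume : Measure (Vec d)).toSphere.prod (Measure.volumeIoiPow (d - 1))) := by
    rw [← hmp.integrable_comp_emb hemb]
    have : g ∘ homeomorphUnitSphereProd (Vec d) = f ∘ Subtype.val := funext hg
    rw [this, ← integrableOn_iff_comap_subtypeVal (measurableSet_singleton _).compl]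
    exact hf.integrableOn
  rw [h1, integral_prod _ h2]
  refine integral_congr_ae (.of_forall fun e => ?_)
  simp only [Measure.volumeIoiPow, ENNReal.ofReal]
  rw [integral_withDensity_eq_integral_smul (by fun_prop),
    integral_subtype_comap measurableSet_Ioi
      (fun r : ℝ => Real.toNNReal (r ^ (d - 1)) • f (r • e.1))]
  refine setIntegral_congr_fun measurableSet_Ioi fun r hr => ?_
  rw [NNReal.smul_def, Real.coe_toNNReal _ (pow_nonneg (le_of_lt hr) _), smul_eq_mul]

/-- The radius in direction `e` of the unit ball centred at `t v`, where `a = ⟨e, v⟩` and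
`b = ‖v‖`. -/
noncomputable def shiftedRadius (a b t : ℝ) : ℝ := t * a + √(1 - t ^ 2 * (b ^ 2 - a ^ 2))

/-- The origin is interior to the shifted ball, so of the two roots of the quadratic in r one is
negative and only the larger one constrains r > 0. -/
theorem norm_smul_sub_smul_le_one_iff {d : ℕ} {e v : Vec d} (he : ‖e‖ = 1) {t r : ℝ}
    (ht : |t| * ‖v‖ < 1) (hr : 0 < r) :
    ‖r • e - t • v‖ ≤ 1 ↔ r ≤ shiftedRadius (inner ℝ e v) ‖v‖ t := by
  set a := inner ℝ e v with ha
  have hD : t ^ 2 * ‖v‖ ^ 2 < 1 := by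
    rw [← mul_pow, ← sq_abs, abs_mul, abs_norm]
    exact pow_lt_one₀ (by positivity) ht two_ne_zero
  have hn : ‖r • e - t • v‖ ^ 2 = (r - t * a) ^ 2 + t ^ 2 * (‖v‖ ^ 2 - a ^ 2) := by
    rw [norm_sub_sq_real, norm_smul, norm_smul, inner_smul_left, inner_smul_right, he, mul_pow,
      mul_pow, Real.norm_eq_abs, Real.norm_eq_abs, sq_abs, sq_abs, ← ha]
    simp only [conj_trivial]
    ring
  rw [← sq_le_one_iff₀ (norm_nonneg _), hn, shiftedRadius]
  have hs : |t * a| < √(1 - t ^ 2 * (‖v‖ ^ 2 - a ^ 2)) := by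
    refine Real.lt_sqrt_of_sq_lt ?_
    rw [sq_abs]
    nlinarith
  have hlow := (abs_lt.1 hs).2
  constructor
  · intro h
    have : r - t * a ≤ √(1 - t ^ 2 * (‖v‖ ^ 2 - a ^ 2)) := Real.le_sqrt_of_sq_le (by linarith)
    linarith
  · intro h
    have h1 : |r - t * a| ≤ √(1 - t ^ 2 * (‖v‖ ^ 2 - a ^ 2)) := abs_le.2 ⟨by linarith, by linarith⟩
    have h3 := pow_le_pow_left₀ (abs_nonneg _) h1 2
    rw [sq_abs, Real.sq_sqrt] at h3
    · linarith
    · by_contra hneg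
      rw [Real.sqrt_eq_zero_of_nonpos (by linarith)] at hs
      linarith [abs_nonneg (t * a)]

/-- Translating the ball instead of the integrand and passing to polar coordinates leaves t only in
the upper limit of the radial integral. Differentiation in t then needs continuity of f alone, which
replaces the divergence theorem. -/
theorem setIntegral_closedBall_shift_eq {d : ℕ} (hd : 0 < d) {f : Vec d → ℝ} (hf : Continuous f)
    (v : Vec d) {t : ℝ} (ht : |t| * ‖v‖ < 1) :
    ∫ z in Metric.closedBall (0 : Vec d) 1, f (z + t • v) =
      ∫ e, (∫ r in (0 : ℝ)..shiftedRadius (inner ℝ e.1 v) ‖v‖ t, r ^ (d - 1) * f (r • e.1))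
        ∂(volume : Measure (Vec d)).toSphere := by
  have h1 : ∫ z in Metric.closedBall (0 : Vec d) 1, f (z + t • v) =
      ∫ y, (Metric.closedBall (t • v) 1).indicator f y := by
    rw [← integral_indicator Metric.isClosed_closedBall.measurableSet,
      ← integral_add_right_eq_self ((Metric.closedBall (t • v) 1).indicator f) (t • v)]
    refine integral_congr_ae (.of_forall fun z => ?_)
    simp [Set.indicator, Metric.mem_closedBall, dist_eq_norm]
  have hint : Integrable ((Metric.closedBall (t • v) 1).indicator f) :=
    (integrable_indicator_iff Metric.isClosed_closedBall.measurableSet).2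
      (hf.continuousOn.integrableOn_compact (isCompact_closedBall _ _))
  rw [h1, integral_polar hd hint]
  refine integral_congr_ae (.of_forall fun e => ?_)
  have he : ‖e.1‖ = 1 := by simp
  have hD : t ^ 2 * ‖v‖ ^ 2 < 1 := by
    rw [← mul_pow, ← sq_abs, abs_mul, abs_norm]
    exact pow_lt_one₀ (by positivity) ht two_ne_zero
  have hρ : 0 ≤ shiftedRadius (inner ℝ e.1 v) ‖v‖ t := by
    have hs : |t * inner ℝ e.1 v| ≤ √(1 - t ^ 2 * (‖v‖ ^ 2 - inner ℝ e.1 v ^ 2)) := by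
      refine Real.le_sqrt_of_sq_le ?_
      rw [sq_abs]
      nlinarith
    unfold shiftedRadius
    linarith [(abs_le.1 hs).1]
  simp only
  rw [intervalIntegral.integral_of_le hρ, ← integral_indicator measurableSet_Ioi,
    ← integral_indicator measurableSet_Ioc]
  refine integral_congr_ae (.of_forall fun r => ?_)
  simp only [Set.indicator, Set.mem_Ioi, Set.mem_Ioc, Metric.mem_closedBall, dist_eq_norm]
  by_cases hr : 0 < r
  · simp [hr, norm_smul_sub_smul_le_one_iff he ht hr]
  · simp [hr]

theorem hasDerivAt_shiftedRadius {a b t : ℝ} (h : t ^ 2 * (b ^ 2 - a ^ 2) < 1) :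
    HasDerivAt (shiftedRadius a b)
      (a - t * (b ^ 2 - a ^ 2) / √(1 - t ^ 2 * (b ^ 2 - a ^ 2))) t := by
  have h1 : HasDerivAt (fun t : ℝ => 1 - t ^ 2 * (b ^ 2 - a ^ 2)) (-(2 * t * (b ^ 2 - a ^ 2))) t := by
    have := ((hasDerivAt_pow 2 t).mul_const (b ^ 2 - a ^ 2)).const_sub 1
    simpa using this
  have h2 := ((hasDerivAt_id t).mul_const a).fun_add (h1.sqrt (by linarith))
  refine h2.congr_deriv ?_
  have : 0 < √(1 - t ^ 2 * (b ^ 2 - a ^ 2)) := Real.sqrt_pos.2 (by linarith)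
  field_simp
  ring

/-- The derivative of the integral over a moving ball is an integral over the sphere. -/
theorem hasDerivAt_setIntegral_closedBall {d : ℕ} (hd : 0 < d) {f : Vec d → ℝ} (hf : Continuous f)
    (v : Vec d) :
    HasDerivAt (fun t : ℝ => ∫ z in Metric.closedBall (0 : Vec d) 1, f (z + t • v))
      (∫ e, f e.1 * inner ℝ e.1 v ∂(volume : Measure (Vec d)).toSphere) 0 := by
  set b := ‖v‖ with hb
  have hb0 : 0 ≤ b := norm_nonneg v
  -- This ε forces |t| ‖v‖ ≤ 1/2, which keeps the radicand above 3/4 and the radius below 2, so one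
  -- constant dominates all the derivatives.
  set ε : ℝ := 1 / (2 * (b + 1)) with hε
  have hε0 : 0 < ε := by positivity
  have hεb : ε * b ≤ 1 / 2 := by
    rw [hε, div_mul_eq_mul_div, one_mul, div_le_div_iff₀ (by positivity) (by norm_num)]
    linarith
  let α : Metric.sphere (0 : Vec d) 1 → ℝ := fun e => inner ℝ e.1 v
  have hα : ∀ e, α e ^ 2 ≤ b ^ 2 := fun e => by
    rw [sq_le_sq, abs_of_nonneg hb0]
    simpa using abs_real_inner_le_norm e.1 v
  have hαc : Continuous α := by fun_prop
  obtain ⟨C, hC⟩ := (isCompact_closedBall (0 : Vec d) 2).exists_bound_of_continuousOn hf.continuousOn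
  have hC0 : 0 ≤ C := (norm_nonneg _).trans (hC 0 (by simp))
  let F : ℝ → Metric.sphere (0 : Vec d) 1 → ℝ := fun t e =>
    ∫ r in (0 : ℝ)..shiftedRadius (α e) b t, r ^ (d - 1) * f (r • e.1)
  let F' : ℝ → Metric.sphere (0 : Vec d) 1 → ℝ := fun t e =>
    (shiftedRadius (α e) b t) ^ (d - 1) * f (shiftedRadius (α e) b t • e.1) *
      (α e - t * (b ^ 2 - α e ^ 2) / √(1 - t ^ 2 * (b ^ 2 - α e ^ 2)))
  have hρc : ∀ t, Continuous fun e => shiftedRadius (α e) b t := fun t => by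
    unfold shiftedRadius; fun_prop
  have hFc : ∀ t, Continuous (F t) := fun t =>
    intervalIntegral.continuous_parametric_intervalIntegral_of_continuous
      (f := fun (e : Metric.sphere (0 : Vec d) 1) (r : ℝ) => r ^ (d - 1) * f (r • e.1))
      (by simp only [Function.uncurry_def]; fun_prop) (hρc t)
  have hsmall : ∀ t ∈ Metric.ball (0 : ℝ) ε, |t| * b ≤ 1 / 2 := fun t ht => by
    have : |t| < ε := by simpa using ht
    nlinarith
  have hsm2 : ∀ t ∈ Metric.ball (0 : ℝ) ε, ∀ e, 0 ≤ t ^ 2 * (b ^ 2 - α e ^ 2) ∧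
      t ^ 2 * (b ^ 2 - α e ^ 2) ≤ 1 / 4 := fun t ht e => by
    have h1 := hsmall t ht
    have h2 : t ^ 2 * b ^ 2 ≤ 1 / 4 := by
      rw [← sq_abs t, ← mul_pow]
      nlinarith [mul_nonneg (abs_nonneg t) hb0]
    constructor
    · exact mul_nonneg (sq_nonneg _) (by linarith [hα e])
    · nlinarith [mul_nonneg (sq_nonneg t) (sq_nonneg (α e))]
  have hd1 : HasDerivAt (fun t => ∫ e, F t e ∂(volume : Measure (Vec d)).toSphere)
      (∫ e, F' 0 e ∂(volume : Measure (Vec d)).toSphere) 0 := by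
    refine (hasDerivAt_integral_of_dominated_loc_of_deriv_le (F := F) (F' := F')
      (bound := fun _ => 2 ^ (d - 1) * C * (2 * b))
      (Metric.ball_mem_nhds _ hε0) (.of_forall fun t => (hFc t).aestronglyMeasurable) ?_ ?_ ?_
      (integrable_const _) ?_).2
    · exact (hFc 0).integrable_of_hasCompactSupport (HasCompactSupport.of_compactSpace _)
    · have : Continuous (F' 0) := by
        have h0 := hρc 0
        simp only [F', zero_mul, zero_div, sub_zero]
        fun_prop
      exact this.aestronglyMeasurable
    · refine .of_forall fun e t ht => ?_
      obtain ⟨h1, h2⟩ := hsm2 t ht e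
      have h3 := hsmall t ht
      have hαb : |α e| ≤ b := abs_le_of_sq_le_sq (hα e) hb0
      have hs : 1 / 2 ≤ √(1 - t ^ 2 * (b ^ 2 - α e ^ 2)) :=
        Real.le_sqrt_of_sq_le (by linarith)
      have hs1 : √(1 - t ^ 2 * (b ^ 2 - α e ^ 2)) ≤ 1 := Real.sqrt_le_one.2 (by linarith)
      have hta : |t * α e| ≤ 1 / 2 := by
        rw [abs_mul]
        exact (mul_le_mul_of_nonneg_left hαb (abs_nonneg t)).trans h3
      have hρ : |shiftedRadius (α e) b t| ≤ 2 := by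
        unfold shiftedRadius
        rw [abs_le] at hta ⊢
        constructor <;> linarith
      have hfb : ‖f (shiftedRadius (α e) b t • e.1)‖ ≤ C := hC _ (by simpa [norm_smul] using hρ)
      have hder : |α e - t * (b ^ 2 - α e ^ 2) / √(1 - t ^ 2 * (b ^ 2 - α e ^ 2))| ≤ 2 * b := by
        refine (abs_sub _ _).trans ?_
        have : |t * (b ^ 2 - α e ^ 2) / √(1 - t ^ 2 * (b ^ 2 - α e ^ 2))| ≤ b := by
          rw [abs_div, abs_mul, abs_of_nonneg (by linarith [hα e] : 0 ≤ b ^ 2 - α e ^ 2),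
            abs_of_pos (by linarith : 0 < √(1 - t ^ 2 * (b ^ 2 - α e ^ 2))),
            div_le_iff₀ (by linarith)]
          have h4 : |t| * (b ^ 2 - α e ^ 2) ≤ |t| * b ^ 2 :=
            mul_le_mul_of_nonneg_left (by linarith [sq_nonneg (α e)]) (abs_nonneg t)
          nlinarith
        linarith
      simp only [F', norm_mul, norm_pow, Real.norm_eq_abs] at hfb ⊢
      gcongr
    · refine .of_forall fun e t ht => ?_
      have h2 := (hsm2 t ht e).2
      have hk : Continuous fun r : ℝ => r ^ (d - 1) * f (r • e.1) := by fun_prop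
      have hi := intervalIntegral.integral_hasDerivAt_right
        (hk.intervalIntegrable 0 (shiftedRadius (α e) b t))
        (hk.stronglyMeasurableAtFilter _ _) hk.continuousAt
      exact hi.comp t (hasDerivAt_shiftedRadius (by linarith))
  have h0 : ∫ e, F' 0 e ∂(volume : Measure (Vec d)).toSphere =
      ∫ e, f e.1 * inner ℝ e.1 v ∂(volume : Measure (Vec d)).toSphere := by
    simp [F', shiftedRadius, α]
  rw [← h0]
  refine hd1.congr_of_eventuallyEq ?_
  filter_upwards [Metric.ball_mem_nhds (0 : ℝ) hε0] with t ht
  exact setIntegral_closedBall_shift_eq hd hf v (by linarith [hsmall t ht])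

theorem add_smul_mem_enlargement {d : ℕ} {X : Set (Vec d)} {x : Vec d} (hx : x ∈ X) (τ : ℝ)
    {z : Vec d} (hz : ‖z‖ ≤ 1) : x + τ • z ∈ enlargement X τ :=
  Set.add_mem_add hx (Set.smul_mem_smul_set (by simpa using hz))

/-- For a convex Lipschitz function, the spherical two-point gradient estimate behaves like a
subgradient up to a smoothing error. -/
theorem sub_le_integral_uniformSphere {d : ℕ} (hd : 0 < d) {X : Set (Vec d)}
    {τ : ℝ} (hτ : 0 < τ) {f : Vec d → ℝ} (hf : ConvexOn ℝ (enlargement X τ) f) {K : ℝ} (hK : 0 ≤ K)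
    (hL : ∀ x y, |f x - f y| ≤ K * ‖x - y‖) {x y : Vec d} (hx : x ∈ X) (hy : y ∈ X) :
    f x - f y ≤ d / τ * ∫ e, f (x + τ • e) * inner ℝ e (x - y) ∂uniformSphere d + 2 * K * τ := by
  have hfc : Continuous f := by
    refine LipschitzWith.continuous (K := K.toNNReal) (LipschitzWith.of_dist_le_mul fun x y => ?_)
    rw [Real.dist_eq, dist_eq_norm, Real.coe_toNNReal _ hK]
    exact hL x y
  set B := Metric.closedBall (0 : Vec d) 1 with hB
  have hBc : IsCompact B := isCompact_closedBall _ _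
  let g : Vec d → ℝ := fun z => f (x + τ • z)
  have hgc : Continuous g := by fun_prop
  -- In the rescaled variable, shifting the unit ball by t v moves the centre of the averaging ball
  -- from x towards y, reaching it at t = 1.
  set v : Vec d := τ⁻¹ • (y - x) with hv
  let φ : ℝ → ℝ := fun t => ∫ z in B, g (z + t • v)
  have hg : ∀ (z : Vec d) (t : ℝ), g (z + t • v) = f ((x + t • (y - x)) + τ • z) := by
    intro z t
    simp only [g, hv]
    congr 1
    rw [smul_add, smul_comm t τ⁻¹, smul_inv_smul₀ hτ.ne']
    abel
  have hg0 : ∀ z, g (z + (0 : ℝ) • v) = f (x + τ • z) := fun z => by simp [g]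
  have hg1 : ∀ z, g (z + (1 : ℝ) • v) = f (y + τ • z) := fun z => by rw [hg]; simp
  have hderiv : HasDerivAt φ _ 0 := hasDerivAt_setIntegral_closedBall hd hgc v
  have hi : ∀ t : ℝ, IntegrableOn (fun z => g (z + t • v)) B := fun t =>
    (by fun_prop : Continuous fun z => g (z + t • v)).continuousOn.integrableOn_compact hBc
  -- Ball averages inherit convexity along the segment, so the chord slopes at 0 are at most the
  -- full increment. Letting t → 0 bounds the derivative at 0.
  have hconv : ∀ t ∈ Set.Ioc (0 : ℝ) 1, t⁻¹ * (φ t - φ 0) ≤ φ 1 - φ 0 := by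
    intro t ht
    rw [inv_mul_le_iff₀ ht.1]
    have : φ t ≤ (1 - t) * φ 0 + t * φ 1 := by
      simp only [φ]
      rw [← integral_const_mul, ← integral_const_mul,
        ← integral_add ((hi 0).const_mul _) ((hi 1).const_mul _)]
      refine setIntegral_mono_on (hi t) (((hi 0).const_mul _).add ((hi 1).const_mul _))
        hBc.measurableSet fun z hz => ?_
      have hz1 : ‖z‖ ≤ 1 := by simpa [hB] using hz
      simp only [hg0, hg1, hg]
      have := hf.2 (add_smul_mem_enlargement hx τ hz1) (add_smul_mem_enlargement hy τ hz1)
        (by linarith [ht.2] : 0 ≤ 1 - t) ht.1.le (by ring)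
      rw [show (1 - t) • (x + τ • z) + t • (y + τ • z) = x + t • (y - x) + τ • z by module] at this
      simpa using this
    linarith
  have hle : ∫ e, g e.1 * inner ℝ e.1 v ∂(volume : Measure (Vec d)).toSphere ≤ φ 1 - φ 0 := by
    refine le_of_tendsto hderiv.tendsto_slope_zero_right ?_
    filter_upwards [Ioc_mem_nhdsGT one_pos] with t ht
    simpa using hconv t ht
  -- The ratio of the mass of the sphere to the volume of the ball is the source of the factor d in
  -- the gradient estimate.
  have hvol : (volume : Measure (Vec d)).toSphere.real Set.univ = d * volume.real B := by
    rw [Measure.toSphere_real_apply_univ, finrank_euclideanSpace, Fintype.card_fin, hB,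
      measureReal_def, measureReal_def, Measure.addHaar_unitClosedBall_eq_addHaar_unitBall]
  have hVpos : 0 < volume.real B :=
    ENNReal.toReal_pos (Metric.measure_closedBall_pos _ _ one_pos).ne' hBc.measure_lt_top.ne
  have hφ : φ 1 - φ 0 ≤ volume.real B * (f y - f x + 2 * K * τ) := by
    simp only [φ]
    rw [← integral_sub (hi 1) (hi 0)]
    calc _ ≤ ∫ _z in B, (f y - f x + 2 * K * τ) := by
          refine setIntegral_mono_on ((hi 1).sub (hi 0))
            (continuous_const.continuousOn.integrableOn_compact hBc)
            hBc.measurableSet fun z hz => ?_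
          have hz1 : ‖z‖ ≤ 1 := by simpa [hB] using hz
          simp only [hg0, hg1]
          have h1 := (abs_le.1 (hL (y + τ • z) y)).2
          have h2 := (abs_le.1 (hL (x + τ • z) x)).1
          rw [add_sub_cancel_left, norm_smul, Real.norm_of_nonneg hτ.le] at h1 h2
          have h3 : K * (τ * ‖z‖) ≤ K * τ := by
            have : τ * ‖z‖ ≤ τ := by nlinarith
            exact mul_le_mul_of_nonneg_left this hK
          linarith
      _ = _ := by simp
  have hd' : (0 : ℝ) < d := by exact_mod_cast hd
  have hsph : ∫ e, f (x + τ • e) * inner ℝ e (x - y) ∂uniformSphere d =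
      -(τ * (d * volume.real B)⁻¹ *
        ∫ e, g e.1 * inner ℝ e.1 v ∂(volume : Measure (Vec d)).toSphere) := by
    have hin : ∀ e : Metric.sphere (0 : Vec d) 1,
        f (x + τ • e.1) * inner ℝ e.1 (x - y) = -τ * (g e.1 * inner ℝ e.1 v) := by
      intro e
      rw [← neg_sub y x, inner_neg_right]
      simp only [g, hv, real_inner_smul_right]
      field_simp
    rw [integral_uniformSphere _ (by fun_prop), hvol]
    simp_rw [hin]
    rw [integral_const_mul]
    ring
  rw [hsph]
  have : d / τ * -(τ * (d * volume.real B)⁻¹ *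
      ∫ e, g e.1 * inner ℝ e.1 v ∂(volume : Measure (Vec d)).toSphere) =
      -((volume.real B)⁻¹ * ∫ e, g e.1 * inner ℝ e.1 v ∂(volume : Measure (Vec d)).toSphere) := by
    field_simp
  rw [this]
  have h5 : (volume.real B)⁻¹ * ∫ e, g e.1 * inner ℝ e.1 v ∂(volume : Measure (Vec d)).toSphere ≤
      f y - f x + 2 * K * τ := by
    rw [inv_mul_le_iff₀ hVpos]
    exact hle.trans hφ
  linarith

end ZOClipSMD

namespace ZOClipSMD

/-! ### Prox-functions and mirror descent -/

theorem one_le_of_holderConjugate {p q : ℝ≥0∞} (hpq : p.HolderConjugate q) : 1 ≤ p := by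
  have h := ENNReal.holderConjugate_iff.1 hpq
  rw [← ENNReal.inv_le_one, ← h]
  exact le_self_add

theorem measurable_gradient {d : ℕ} (Ψ : Vec d → ℝ) : Measurable (gradient Ψ) :=
  ((InnerProductSpace.toDual ℝ (Vec d)).symm.continuous.measurable).comp (measurable_fderiv ℝ Ψ)

section Prox

variable {d : ℕ} {p q : ℝ≥0∞} {Ψ : Vec d → ℝ}

theorem IsProxFunction.le_bregman (h : IsProxFunction p Ψ) (x y : Vec d) :
    1 / 2 * ellNorm p (x - y) ^ 2 ≤ bregman Ψ y x := h.strong x y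

theorem IsProxFunction.bregman_nonneg (h : IsProxFunction p Ψ) (x y : Vec d) :
    0 ≤ bregman Ψ x y := (by positivity : 0 ≤ 1 / 2 * ellNorm p (y - x) ^ 2).trans (h.le_bregman y x)

/-- Since q ≥ 2, the ℓ_p norm dominates the Euclidean norm, so Ψ is also strongly convex in the
Euclidean sense. This suffices for every qualitative fact about prox-points. -/
theorem IsProxFunction.half_norm_sq_le_bregman (h : IsProxFunction p Ψ)
    (hpq : p.HolderConjugate q) (hq : 2 ≤ q) (x y : Vec d) :
    1 / 2 * ‖x - y‖ ^ 2 ≤ bregman Ψ x y := by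
  have : Fact (1 ≤ p) := ⟨one_le_of_holderConjugate hpq⟩
  have h1 := h.le_bregman y x
  have h2 := norm_le_ellNorm hpq hq (y - x)
  rw [norm_sub_rev]
  refine le_trans ?_ h1
  gcongr

/-- The conjugate is attained, at a point whose gradient is the dual variable. -/
theorem IsProxFunction.exists_gradient_eq (h : IsProxFunction p Ψ)
    (hpq : p.HolderConjugate q) (hq : 2 ≤ q) (w : Vec d) : ∃ y, gradient Ψ y = w := by
  let G : Vec d → ℝ := fun z => Ψ z - inner ℝ w z
  have hGc : Continuous G := by have := h.differentiable.continuous; fun_prop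
  set c := gradient Ψ 0 - w with hc
  -- Strong convexity at 0 gives quadratic growth, hence a global minimizer of G. Its critical point
  -- equation is the claim.
  have hlow : ∀ z, G 0 - ‖c‖ * ‖z‖ + 1 / 2 * ‖z‖ ^ 2 ≤ G z := by
    intro z
    have h1 := h.half_norm_sq_le_bregman hpq hq z 0
    have h2 := (abs_le.1 (abs_real_inner_le_norm c z)).1
    rw [hc, inner_sub_left] at h2
    simp only [bregman, sub_zero] at h1
    simp only [G, inner_zero_right]
    linarith
  have hcoc : ∀ᶠ z in Filter.cocompact (Vec d), G 0 ≤ G z := by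
    have := tendsto_norm_cocompact_atTop (E := Vec d)
    filter_upwards [this.eventually_ge_atTop (2 * ‖c‖)] with z hz
    nlinarith [hlow z, norm_nonneg z, norm_nonneg c]
  obtain ⟨y, hy⟩ := hGc.exists_forall_le' 0 hcoc
  refine ⟨y, ?_⟩
  have hg : HasGradientAt G (gradient Ψ y - w) y := by
    rw [hasGradientAt_iff_hasFDerivAt, map_sub]
    have h1 := (h.differentiable y).hasGradientAt.hasFDerivAt
    have h2 : HasFDerivAt (fun z => inner ℝ w z) (InnerProductSpace.toDual ℝ (Vec d) w) y :=
      (InnerProductSpace.toDual ℝ (Vec d) w).hasFDerivAt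
    exact h1.sub h2
  have hmin : IsLocalMin G y := Filter.Eventually.of_forall hy
  have h0 := hmin.hasFDerivAt_eq_zero hg.hasFDerivAt
  rw [map_eq_zero_iff _ (InnerProductSpace.toDual ℝ (Vec d)).injective] at h0
  exact sub_eq_zero.1 h0

/-- The gradient of a prox-function is inverted by the gradient of its conjugate. -/
theorem IsProxFunction.gradient_fenchelConjugate (h : IsProxFunction p Ψ)
    (hpq : p.HolderConjugate q) (hq : 2 ≤ q) (y : Vec d) :
    gradient (fenchelConjugate Ψ) (gradient Ψ y) = y := by
  have hconj : ∀ z, fenchelConjugate Ψ (gradient Ψ z) = inner ℝ z (gradient Ψ z) - Ψ z := by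
    intro z
    have hle : ∀ x, inner ℝ x (gradient Ψ z) - Ψ x ≤ inner ℝ z (gradient Ψ z) - Ψ z := by
      intro x
      have := h.bregman_nonneg x z
      rw [bregman, inner_sub_right, real_inner_comm x, real_inner_comm z] at this
      linarith
    exact le_antisymm (ciSup_le hle) (le_ciSup (f := fun x => inner ℝ x (gradient Ψ z) - Ψ x)
      ⟨_, Set.forall_mem_range.2 hle⟩ z)
  -- Writing w = ∇Ψ(z), the remainder equals D_Ψ(y, z) ≥ 0. Also D_Ψ(y, z) + D_Ψ(z, y) = ⟨z - y,
  -- ∇Ψ(z) - ∇Ψ(y)⟩ and D_Ψ(z, y) ≥ ‖z - y‖²/2, so Young's inequality gives the upper bound.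
  have hbound : ∀ w, |fenchelConjugate Ψ w - fenchelConjugate Ψ (gradient Ψ y) -
      inner ℝ y (w - gradient Ψ y)| ≤ 1 / 2 * ‖w - gradient Ψ y‖ ^ 2 := by
    intro w
    obtain ⟨z, rfl⟩ := h.exists_gradient_eq hpq hq w
    have h1 := h.bregman_nonneg y z
    have h2 := h.half_norm_sq_le_bregman hpq hq z y
    have h3 := real_inner_le_norm (z - y) (gradient Ψ z - gradient Ψ y)
    have c1 := real_inner_comm y (gradient Ψ z)
    have c2 := real_inner_comm z (gradient Ψ z)
    have c3 := real_inner_comm y (gradient Ψ y)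
    have c4 := real_inner_comm z (gradient Ψ y)
    rw [hconj, hconj]
    simp only [bregman, inner_sub_right, inner_sub_left] at h1 h2 h3 ⊢
    rw [abs_le]
    constructor
    · have : (0 : ℝ) ≤ 1 / 2 * ‖gradient Ψ z - gradient Ψ y‖ ^ 2 := by positivity
      linarith
    · nlinarith [sq_nonneg (‖z - y‖ - ‖gradient Ψ z - gradient Ψ y‖)]
  refine HasGradientAt.gradient ?_
  rw [hasGradientAt_iff_isLittleO]
  refine Asymptotics.IsBigO.trans_isLittleO
    (g := fun w => ‖w - gradient Ψ y‖ ^ 2) ?_ ?_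
  · refine Asymptotics.IsBigO.of_bound (1 / 2) (.of_forall fun w => ?_)
    rw [Real.norm_eq_abs, Real.norm_of_nonneg (by positivity)]
    exact hbound w
  · exact Asymptotics.isLittleO_pow_sub_sub _ one_lt_two

theorem IsProxFunction.gradient_gradient_fenchelConjugate (h : IsProxFunction p Ψ)
    (hpq : p.HolderConjugate q) (hq : 2 ≤ q) (w : Vec d) :
    gradient Ψ (gradient (fenchelConjugate Ψ) w) = w := by
  obtain ⟨y, rfl⟩ := h.exists_gradient_eq hpq hq w
  rw [h.gradient_fenchelConjugate hpq hq]

/-- `x` satisfies the variational inequality characterizing the minimizer of `Ψ - ⟨w, ·⟩` over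
`X`. -/
def IsProxPoint (X : Set (Vec d)) (Ψ : Vec d → ℝ) (w x : Vec d) : Prop :=
  x ∈ X ∧ ∀ z ∈ X, 0 ≤ inner ℝ (gradient Ψ x - w) (z - x)

theorem isProxPoint_of_isMinOn {X : Set (Vec d)} (hX : Convex ℝ X) (hΨ : Differentiable ℝ Ψ)
    {w x : Vec d} (hx : x ∈ X) (hmin : ∀ z ∈ X, Ψ x - inner ℝ w x ≤ Ψ z - inner ℝ w z) :
    IsProxPoint X Ψ w x := by
  refine ⟨hx, fun z hz => ?_⟩
  have hpath : HasDerivAt (fun t : ℝ => x + t • (z - x)) (z - x) 0 := by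
    have := ((hasDerivAt_id (0 : ℝ)).smul_const (z - x)).const_add x
    rw [one_smul] at this
    exact this
  have hg : HasDerivAt (fun t : ℝ => Ψ (x + t • (z - x)) - inner ℝ w (x + t • (z - x)))
      (inner ℝ (gradient Ψ x - w) (z - x)) 0 := by
    have h1 : HasFDerivAt Ψ (InnerProductSpace.toDual ℝ (Vec d) (gradient Ψ x))
        (x + (0 : ℝ) • (z - x)) := by
      simpa using (hΨ x).hasGradientAt.hasFDerivAt
    have h2 : HasFDerivAt (fun z => inner ℝ w z) (InnerProductSpace.toDual ℝ (Vec d) w)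
        (x + (0 : ℝ) • (z - x)) := (InnerProductSpace.toDual ℝ (Vec d) w).hasFDerivAt
    have := (h1.comp_hasDerivAt (0 : ℝ) hpath).fun_sub (h2.comp_hasDerivAt (0 : ℝ) hpath)
    simpa [inner_sub_left] using this
  refine ge_of_tendsto hg.tendsto_slope_zero_right ?_
  filter_upwards [Ioc_mem_nhdsGT one_pos] with t ht
  have hmem : x + t • (z - x) ∈ X := hX.add_smul_sub_mem hx hz ⟨ht.1.le, ht.2⟩
  have := hmin _ hmem
  have ht0 : 0 ≤ t⁻¹ := inv_nonneg.2 ht.1.le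
  simp only [zero_add, zero_smul, add_zero, smul_eq_mul]
  exact mul_nonneg ht0 (by linarith)

/-- The Bregman divergence from ∇Ψ*(w) differs from Ψ - ⟨w, ·⟩ by a constant, because ∇Ψ inverts
∇Ψ*. This removes the conjugate from all later arguments. -/
theorem IsProxFunction.isProxPoint_step (h : IsProxFunction p Ψ) (hpq : p.HolderConjugate q)
    (hq : 2 ≤ q) {X : Set (Vec d)} (hX : Convex ℝ X) {w x : Vec d} (hx : x ∈ X)
    (hmin : IsMinOn (fun z => bregman Ψ z (gradient (fenchelConjugate Ψ) w)) X x) :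
    IsProxPoint X Ψ w x := by
  refine isProxPoint_of_isMinOn hX h.differentiable hx fun z hz => ?_
  have := isMinOn_iff.1 hmin z hz
  simp only [bregman, h.gradient_gradient_fenchelConjugate hpq hq, inner_sub_right] at this
  linarith

theorem IsProxFunction.isProxPoint_init (h : IsProxFunction p Ψ) {X : Set (Vec d)}
    (hX : Convex ℝ X) {x : Vec d} (hx : x ∈ X) (hmin : IsMinOn Ψ X x) : IsProxPoint X Ψ 0 x := by
  refine isProxPoint_of_isMinOn hX h.differentiable hx fun z hz => ?_
  simpa using isMinOn_iff.1 hmin z hz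

/-- Adding the two variational inequalities and using strong monotonicity of ∇Ψ gives ‖x₁ - x₂‖² ≤
⟨w₁ - w₂, x₁ - x₂⟩. Uniqueness and continuity of the prox-mapping both follow. -/
theorem IsProxFunction.norm_sub_le_of_isProxPoint (h : IsProxFunction p Ψ)
    (hpq : p.HolderConjugate q) (hq : 2 ≤ q) {X : Set (Vec d)} {w₁ w₂ x₁ x₂ : Vec d}
    (h₁ : IsProxPoint X Ψ w₁ x₁) (h₂ : IsProxPoint X Ψ w₂ x₂) : ‖x₁ - x₂‖ ≤ ‖w₁ - w₂‖ := by
  have e1 := h₁.2 x₂ h₂.1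
  have e2 := h₂.2 x₁ h₁.1
  have e3 := h.half_norm_sq_le_bregman hpq hq x₁ x₂
  have e4 := h.half_norm_sq_le_bregman hpq hq x₂ x₁
  have e5 := real_inner_le_norm (w₁ - w₂) (x₁ - x₂)
  rw [norm_sub_rev] at e4
  simp only [bregman, inner_sub_left, inner_sub_right] at e1 e2 e3 e4 e5
  rcases (norm_nonneg (x₁ - x₂)).eq_or_lt with h0 | h0
  · rw [← h0]; positivity
  · nlinarith

/-- Identifies an arbitrary trajectory, whose minimizers could a priori be chosen non-measurably,
with the orbit of a measurable recursion. -/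
theorem IsProxFunction.isProxPoint_unique (h : IsProxFunction p Ψ)
    (hpq : p.HolderConjugate q) (hq : 2 ≤ q) {X : Set (Vec d)} {w x₁ x₂ : Vec d}
    (h₁ : IsProxPoint X Ψ w x₁) (h₂ : IsProxPoint X Ψ w x₂) : x₁ = x₂ := by
  have := h.norm_sub_le_of_isProxPoint hpq hq h₁ h₂
  rw [sub_self, norm_zero] at this
  exact sub_eq_zero.1 (norm_le_zero_iff.1 this)

/-- The prox-mapping, sending a dual variable to its prox-point. -/
theorem IsProxFunction.exists_proxMap (h : IsProxFunction p Ψ) (hpq : p.HolderConjugate q)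
    (hq : 2 ≤ q) {X : Set (Vec d)} (hXc : IsCompact X) (hX : Convex ℝ X) (hne : X.Nonempty) :
    ∃ P : Vec d → Vec d, Continuous P ∧ ∀ w, IsProxPoint X Ψ w (P w) := by
  have hex : ∀ w, ∃ x, IsProxPoint X Ψ w x := by
    intro w
    have hc : Continuous fun z => Ψ z - inner ℝ w z := by
      have := h.differentiable.continuous; fun_prop
    obtain ⟨x, hx, hmin⟩ := hXc.exists_isMinOn hne hc.continuousOn
    exact ⟨x, isProxPoint_of_isMinOn hX h.differentiable hx fun z hz => isMinOn_iff.1 hmin z hz⟩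
  choose P hP using hex
  refine ⟨P, LipschitzWith.continuous (K := 1) (LipschitzWith.of_dist_le_mul fun w₁ w₂ => ?_), hP⟩
  rw [dist_eq_norm, dist_eq_norm, NNReal.coe_one, one_mul]
  exact h.norm_sub_le_of_isProxPoint hpq hq (hP w₁) (hP w₂)

/-- One step of mirror descent. -/
theorem IsProxFunction.inner_le_of_isProxPoint (h : IsProxFunction p Ψ)
    (hpq : p.HolderConjugate q) {X : Set (Vec d)} {g x x' u : Vec d}
    (hx' : IsProxPoint X Ψ (gradient Ψ x - g) x') (hu : u ∈ X) :
    inner ℝ g (x - u) ≤ bregman Ψ u x - bregman Ψ u x' + 1 / 2 * ellNorm q g ^ 2 := by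
  have e1 := hx'.2 u hu
  have e2 := h.le_bregman x x'
  have e3 := (abs_le.1 (abs_inner_le_ellNorm_mul hpq (x - x') g)).2
  rw [real_inner_comm] at e3
  simp only [bregman, inner_sub_left, inner_sub_right] at e1 e2 e3 ⊢
  -- Three-point identity: the strong convexity term ‖x - x'‖_p²/2 absorbs the cross term ⟨g, x -
  -- x'⟩ through Young's inequality.
  nlinarith [sq_nonneg (ellNorm p (x - x') - ellNorm q g)]

/-- The real `sSup` is meaningful only for a set bounded above. Convexity at the reflected point 2y
- x gives D_Ψ(x, y) ≤ Ψ(x) - 2Ψ(y) + Ψ(2y - x), which is continuous on a compact set, so no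
continuity of ∇Ψ is required. -/
theorem IsProxFunction.bregman_le_half_bregmanDiam_sq (h : IsProxFunction p Ψ) {X : Set (Vec d)}
    (hXc : IsCompact X) {x y : Vec d} (hx : x ∈ X) (hy : y ∈ X) :
    bregman Ψ x y ≤ 1 / 2 * bregmanDiam X Ψ ^ 2 := by
  have hc : Continuous fun z : Vec d × Vec d => Ψ z.1 - 2 * Ψ z.2 + Ψ (z.2 + (z.2 - z.1)) := by
    have := h.differentiable.continuous; fun_prop
  obtain ⟨B, hB⟩ := ((hXc.prod hXc).image hc).bddAbove
  have hbdd : BddAbove {b : ℝ | ∃ x ∈ X, ∃ y ∈ X, b = bregman Ψ x y} := by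
    refine ⟨B, ?_⟩
    rintro _ ⟨x, hx, y, hy, rfl⟩
    refine le_trans ?_ (hB ⟨(x, y), ⟨hx, hy⟩, rfl⟩)
    have := h.bregman_nonneg (y + (y - x)) y
    rw [bregman, add_sub_cancel_left, inner_sub_right] at this
    rw [bregman, inner_sub_right]
    simp only
    linarith
  have hle : bregman Ψ x y ≤ sSup {b : ℝ | ∃ x ∈ X, ∃ y ∈ X, b = bregman Ψ x y} :=
    le_csSup hbdd ⟨x, hx, y, hy, rfl⟩
  have h0 := h.bregman_nonneg x y
  rw [bregmanDiam, Real.sq_sqrt (by linarith)]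
  linarith

theorem IsProxFunction.ellNorm_sub_le_bregmanDiam (h : IsProxFunction p Ψ) {X : Set (Vec d)}
    (hXc : IsCompact X) {x y : Vec d} (hx : x ∈ X) (hy : y ∈ X) :
    ellNorm p (x - y) ≤ bregmanDiam X Ψ := by
  have h1 := h.le_bregman x y
  have h2 := h.bregman_le_half_bregmanDiam_sq hXc hy hx
  have h0 : 0 ≤ bregmanDiam X Ψ := Real.sqrt_nonneg _
  exact (le_abs_self _).trans (abs_le_of_sq_le_sq (by linarith) h0)

/-- Regret bound of mirror descent. -/
theorem IsProxFunction.sum_inner_le (h : IsProxFunction p Ψ) (hpq : p.HolderConjugate q)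
    {X : Set (Vec d)} (hXc : IsCompact X) (T : ℕ) {g x : ℕ → Vec d} (h0 : x 0 ∈ X)
    (hx : ∀ k < T, IsProxPoint X Ψ (gradient Ψ (x k) - g k) (x (k + 1))) {u : Vec d} (hu : u ∈ X) :
    ∑ k ∈ Finset.range T, inner ℝ (g k) (x k - u) ≤
      1 / 2 * bregmanDiam X Ψ ^ 2 + 1 / 2 * ∑ k ∈ Finset.range T, ellNorm q (g k) ^ 2 := by
  have hsum : ∑ k ∈ Finset.range T, inner ℝ (g k) (x k - u) ≤
      ∑ k ∈ Finset.range T, (bregman Ψ u (x k) - bregman Ψ u (x (k + 1)) +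
        1 / 2 * ellNorm q (g k) ^ 2) :=
    Finset.sum_le_sum fun k hk => h.inner_le_of_isProxPoint hpq (hx k (Finset.mem_range.1 hk)) hu
  rw [Finset.sum_add_distrib, Finset.sum_range_sub' (fun k => bregman Ψ u (x k)),
    ← Finset.mul_sum] at hsum
  have h1 := h.bregman_nonneg u (x T)
  have h2 := h.bregman_le_half_bregmanDiam_sq hXc hu h0
  linarith

end Prox

end ZOClipSMD

namespace ZOClipSMD

/-! ### The gradient estimate of a regular oracle -/

/-- The uniform measure on the sphere is invariant under the antipodal map. -/
theorem measurePreserving_neg_uniformSphere {d : ℕ} (hd : 0 < d) :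
    MeasurePreserving (fun e : Vec d => -e) (uniformSphere d) (uniformSphere d) := by
  have key : ∀ g : Vec d → ℝ≥0∞, Measurable g →
      ∫⁻ e, g e ∂uniformSphere d = ∫⁻ x, g (‖x‖⁻¹ • x) ∂stdGaussian (Vec d) := by
    intro g hg
    rw [lintegral_stdGaussian_of_homogeneous hd 0 (by fun_prop)]
    · simp only [pow_zero, ENNReal.ofReal_one, lintegral_const, measure_univ, one_mul]
      refine lintegral_congr_ae ?_
      filter_upwards [ae_norm_eq_one_uniformSphere d] with e he
      simp [he]
    · intro r hr e he
      rw [norm_smul, he, mul_one, Real.norm_of_nonneg hr.le, inv_smul_smul₀ hr.ne']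
      simp
  have hγ : MeasurePreserving (fun x : Vec d => -x) (stdGaussian (Vec d)) (stdGaussian (Vec d)) :=
    ⟨measurable_neg, stdGaussian_map (LinearIsometryEquiv.neg ℝ (E := Vec d))⟩
  refine ⟨measurable_neg, Measure.ext fun s hs => ?_⟩
  have hi : Measurable (s.indicator (1 : Vec d → ℝ≥0∞)) := measurable_one.indicator hs
  rw [← lintegral_indicator_one hs, ← lintegral_indicator_one hs, lintegral_map hi measurable_neg,
    key _ hi, key (fun e => s.indicator 1 (-e)) (hi.comp measurable_neg), ← hγ.lintegral_comp (by fun_prop)]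
  simp

/-- A stochastic zeroth-order oracle with regularity on the whole space: joint measurability and
global Lipschitz continuity of the realizations, and a globally bounded noise. -/
structure RegularOracle {d : ℕ} {Ξ : Type*} [MeasurableSpace Ξ] (𝒟 : Measure Ξ) (X : Set (Vec d))
    (τ κ : ℝ) (f : Vec d → Ξ → ℝ) (noise : Vec d → ℝ) (M : Ξ → ℝ) (M₂ Δ : ℝ) : Prop where
  measurable : Measurable (fun z : Vec d × Ξ => f z.1 z.2)
  integrable : ∀ x, Integrable (f x) 𝒟
  lipschitz : ∀ s x y, |f x s - f y s| ≤ M s * ‖x - y‖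
  convex : ∀ s, ConvexOn ℝ (enlargement X τ) (fun x => f x s)
  lip_nonneg : ∀ s, 0 ≤ M s
  moment_integrable : Integrable (fun s => M s ^ (1 + κ)) 𝒟
  moment_le : ∫ s, M s ^ (1 + κ) ∂𝒟 ≤ M₂ ^ (1 + κ)
  measurable_noise : Measurable noise
  noise_le : ∀ x, |noise x| ≤ Δ

/-- The absolute constant in the moment bound for the gradient estimate. -/
noncomputable def momentConst : ℝ :=
  max 1 (max (√2 / 4 * (√(Real.pi ^ 4 * (2 * Real.exp 1) ^ 2 * 6 ^ 4) * √(8 * Real.exp 1 ^ 4)))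
    √(8 * Real.exp 1 ^ 4))

theorem one_le_momentConst : 1 ≤ momentConst := le_max_left _ _

/-- The Cauchy–Schwarz inequality for integrals of nonnegative functions. -/
theorem integral_mul_le_sqrt_mul_sqrt {α : Type*} [MeasurableSpace α] {μ : Measure α}
    {f g : α → ℝ} (hf0 : ∀ x, 0 ≤ f x) (hg0 : ∀ x, 0 ≤ g x) (hf : MemLp f 2 μ) (hg : MemLp g 2 μ) :
    ∫ x, f x * g x ∂μ ≤ √(∫ x, f x ^ 2 ∂μ) * √(∫ x, g x ^ 2 ∂μ) := by
  have h := integral_mul_le_Lp_mul_Lq_of_nonneg (μ := μ) Real.HolderConjugate.two_two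
    (.of_forall hf0) (.of_forall hg0) (by simpa using hf) (by simpa using hg)
  simpa [Real.sqrt_eq_rpow] using h

theorem integral_ellNorm_sq_uniformSphere_le {d : ℕ} (hd : 2 ≤ d) {q : ℝ≥0∞} (hq : 2 ≤ q) :
    ∫ e, ellNorm q e ^ 2 ∂uniformSphere d ≤ momentConst * aCoef d q ^ 2 := by
  have : Fact (1 ≤ q) := ⟨one_le_two.trans hq⟩
  have := isProbabilityMeasure_uniformSphere (by omega : 0 < d)
  have hc := continuous_ellNorm (d := d) q
  have hm : MemLp (fun e => ellNorm q e ^ 2) 2 (uniformSphere d) := by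
    refine MemLp.of_bound (by fun_prop) 1 ?_
    filter_upwards [ae_norm_eq_one_uniformSphere d] with e he
    rw [Real.norm_of_nonneg (by positivity)]
    exact pow_le_one₀ (ellNorm_nonneg q e) (by simpa [he] using ellNorm_le_norm hq e)
  have h := integral_mul_le_sqrt_mul_sqrt (μ := uniformSphere d) (f := fun e => ellNorm q e ^ 2)
    (g := fun _ => 1) (fun _ => by positivity) (fun _ => zero_le_one) hm (memLp_const 1)
  simp only [mul_one, one_pow, integral_const, probReal_univ, smul_eq_mul, Real.sqrt_one,
    ← pow_mul] at h
  calc _ ≤ √(8 * Real.exp 1 ^ 4 * aCoef d q ^ 4) :=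
        h.trans (Real.sqrt_le_sqrt (integral_ellNorm_pow_four_uniformSphere_le hd hq))
    _ = √(8 * Real.exp 1 ^ 4) * aCoef d q ^ 2 := by
        rw [Real.sqrt_mul (by positivity), show aCoef d q ^ 4 = (aCoef d q ^ 2) ^ 2 by ring,
          Real.sqrt_sq (by positivity)]
    _ ≤ momentConst * aCoef d q ^ 2 := by
        gcongr
        exact (le_max_right _ _).trans (le_max_right _ _)

theorem continuous_of_abs_sub_le {d : ℕ} {F : Vec d → ℝ} {K : ℝ} (hK : 0 ≤ K)
    (hF : ∀ x y, |F x - F y| ≤ K * ‖x - y‖) : Continuous F := by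
  refine LipschitzWith.continuous (K := K.toNNReal) (LipschitzWith.of_dist_le_mul fun x y => ?_)
  rw [Real.dist_eq, dist_eq_norm, Real.coe_toNNReal _ hK]
  exact hF x y

theorem abs_two_point_le {d : ℕ} {F : Vec d → ℝ} {K : ℝ}
    (hF : ∀ x y, |F x - F y| ≤ K * ‖x - y‖) (x : Vec d) {τ : ℝ} (hτ : 0 < τ) {e : Vec d}
    (he : ‖e‖ = 1) : |F (x + τ • e) - F (x - τ • e)| ≤ 2 * τ * K := by
  have := hF (x + τ • e) (x - τ • e)
  rw [show x + τ • e - (x - τ • e) = (2 * τ) • e by module, norm_smul, he, mul_one,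
    Real.norm_of_nonneg (by positivity)] at this
  linarith

/-- Cauchy–Schwarz separates the two fourth moments: (d/τ)² · (τK)²/d · a_q² = d a_q² K² up to a
constant. The factor 1/d from concentration is what turns d into √d in σ_q. -/
theorem integral_two_point_sq_mul_ellNorm_sq_le {d : ℕ} (hd : 2 ≤ d) {q : ℝ≥0∞} (hq : 2 ≤ q)
    {F : Vec d → ℝ} {K : ℝ} (hK : 0 ≤ K) (hF : ∀ x y, |F x - F y| ≤ K * ‖x - y‖) (x : Vec d)
    {τ : ℝ} (hτ : 0 < τ) :
    ∫ e, (d / (2 * τ) * (|F (x + τ • e) - F (x - τ • e)| * ellNorm q e)) ^ 2 ∂uniformSphere d ≤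
      momentConst * (√d / (2 : ℝ) ^ (1 / 4 : ℝ) * aCoef d q * K) ^ 2 := by
  have : Fact (1 ≤ q) := ⟨one_le_two.trans hq⟩
  have hd0 : 0 < d := by omega
  have := isProbabilityMeasure_uniformSphere hd0
  have hc := continuous_ellNorm (d := d) q
  have hFc := continuous_of_abs_sub_le hK hF
  have hd' : (0 : ℝ) < d := by exact_mod_cast hd0
  have hm1 : MemLp (fun e => ellNorm q e ^ 2) 2 (uniformSphere d) := by
    refine MemLp.of_bound (by fun_prop) 1 ?_
    filter_upwards [ae_norm_eq_one_uniformSphere d] with e he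
    rw [Real.norm_of_nonneg (by positivity)]
    exact pow_le_one₀ (ellNorm_nonneg q e) (by simpa [he] using ellNorm_le_norm hq e)
  have hm2 : MemLp (fun e => (F (x + τ • e) - F (x - τ • e)) ^ 2) 2 (uniformSphere d) := by
    refine MemLp.of_bound (by fun_prop) ((2 * τ * K) ^ 2) ?_
    filter_upwards [ae_norm_eq_one_uniformSphere d] with e he
    rw [norm_pow]
    gcongr
    exact abs_two_point_le hF x hτ he
  have h := integral_mul_le_sqrt_mul_sqrt (fun _ => by positivity) (fun _ => by positivity) hm2 hm1
  simp only [← pow_mul] at h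
  have h4 := integral_two_point_pow_four_le hd0 hF x hτ
  have hN := integral_ellNorm_pow_four_uniformSphere_le hd hq
  set A := Real.pi ^ 4 * (2 * Real.exp 1) ^ 2 * 6 ^ 4 with hA
  set B := 8 * Real.exp 1 ^ 4 with hB
  have h5 : √(∫ e, (F (x + τ • e) - F (x - τ • e)) ^ (2 * 2) ∂uniformSphere d) ≤
      √A * (τ * K) ^ 2 / d := by
    calc _ ≤ √(A * (((τ * K) ^ 2 / d) ^ 2)) := by
          refine Real.sqrt_le_sqrt (h4.trans (le_of_eq ?_))
          rw [hA, div_pow]; ring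
      _ = _ := by rw [Real.sqrt_mul (by positivity), Real.sqrt_sq (by positivity), mul_div_assoc]
  have h6 : √(∫ e, ellNorm q e ^ (2 * 2) ∂uniformSphere d) ≤ √B * aCoef d q ^ 2 := by
    calc _ ≤ √(B * (aCoef d q ^ 2) ^ 2) := by
          refine Real.sqrt_le_sqrt (hN.trans (le_of_eq ?_))
          ring
      _ = _ := by rw [Real.sqrt_mul (by positivity), Real.sqrt_sq (by positivity)]
  have hrw : ∀ e, (d / (2 * τ) * (|F (x + τ • e) - F (x - τ • e)| * ellNorm q e)) ^ 2 =
      (d / (2 * τ)) ^ 2 * ((F (x + τ • e) - F (x - τ • e)) ^ 2 * ellNorm q e ^ 2) := fun e => by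
    rw [mul_pow, mul_pow, sq_abs]
  simp_rw [hrw]
  rw [integral_const_mul]
  have h24 : ((2 : ℝ) ^ (1 / 4 : ℝ)) ^ 2 = √2 := by
    rw [← Real.rpow_natCast, ← Real.rpow_mul (by norm_num), Real.sqrt_eq_rpow]
    norm_num
  calc _ ≤ (d / (2 * τ)) ^ 2 * ((√A * (τ * K) ^ 2 / d) * (√B * aCoef d q ^ 2)) := by
        gcongr
        exact h.trans (mul_le_mul h5 h6 (Real.sqrt_nonneg _) (by positivity))
    _ = (√2 / 4 * (√A * √B)) * (√d / (2 : ℝ) ^ (1 / 4 : ℝ) * aCoef d q * K) ^ 2 := by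
        have hsq : (√d / (2 : ℝ) ^ (1 / 4 : ℝ) * aCoef d q * K) ^ 2 =
            d / √2 * aCoef d q ^ 2 * K ^ 2 := by
          rw [mul_pow, mul_pow, div_pow, Real.sq_sqrt hd'.le, h24]
        rw [hsq]
        have : (0 : ℝ) < √2 := by positivity
        field_simp
        ring
    _ ≤ _ := by
        gcongr
        exact (le_max_left _ _).trans (le_max_right _ _)

section Oracle

variable {d : ℕ} {Ξ : Type*} [MeasurableSpace Ξ] {𝒟 : Measure Ξ} {X : Set (Vec d)}
  {τ κ : ℝ} {f : Vec d → Ξ → ℝ} {noise : Vec d → ℝ} {M : Ξ → ℝ} {M₂ Δ : ℝ}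

theorem RegularOracle.measurable_gradEstimate (o : RegularOracle 𝒟 X τ κ f noise M M₂ Δ) :
    Measurable (fun z : Vec d × (Ξ × Vec d) => gradEstimate f noise τ z.1 z.2.1 z.2.2) := by
  have h1 : Measurable fun z : Vec d × (Ξ × Vec d) => f (z.1 + τ • z.2.2) z.2.1 :=
    o.measurable.comp (g := fun z : Vec d × Ξ => f z.1 z.2)
      (f := fun z : Vec d × (Ξ × Vec d) => (z.1 + τ • z.2.2, z.2.1)) (by fun_prop)
  have h2 : Measurable fun z : Vec d × (Ξ × Vec d) => f (z.1 - τ • z.2.2) z.2.1 :=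
    o.measurable.comp (g := fun z : Vec d × Ξ => f z.1 z.2)
      (f := fun z : Vec d × (Ξ × Vec d) => (z.1 - τ • z.2.2, z.2.1)) (by fun_prop)
  have h3 := o.measurable_noise
  have h4 : Measurable fun z : Vec d × (Ξ × Vec d) => noise (z.1 + τ • z.2.2) :=
    h3.comp (by fun_prop)
  have h5 : Measurable fun z : Vec d × (Ξ × Vec d) => noise (z.1 - τ • z.2.2) :=
    h3.comp (by fun_prop)
  exact (((h1.add h4).sub (h2.add h5)).const_mul (d / (2 * τ))).smul measurable_snd.snd

theorem RegularOracle.abs_oracle_sub_le (o : RegularOracle 𝒟 X τ κ f noise M M₂ Δ)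
    (x : Vec d) (s : Ξ) (e : Vec d) :
    |oracle f noise (x + τ • e) s - oracle f noise (x - τ • e) s| ≤
      |f (x + τ • e) s - f (x - τ • e) s| + 2 * Δ := by
  have h1 := abs_le.1 (o.noise_le (x + τ • e))
  have h2 := abs_le.1 (o.noise_le (x - τ • e))
  have h3 : |noise (x + τ • e) - noise (x - τ • e)| ≤ 2 * Δ := by
    rw [abs_le]; constructor <;> linarith
  calc _ = |(f (x + τ • e) s - f (x - τ • e) s) + (noise (x + τ • e) - noise (x - τ • e))| := by
        simp only [oracle]; congr 1; ring
    _ ≤ _ := (abs_add_le _ _).trans (by linarith)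

theorem RegularOracle.norm_gradEstimate_le (o : RegularOracle 𝒟 X τ κ f noise M M₂ Δ)
    (hτ : 0 < τ) (x : Vec d) (s : Ξ) {e : Vec d} (he : ‖e‖ = 1) :
    ‖gradEstimate f noise τ x s e‖ ≤ d * M s + d * Δ / τ := by
  have h1 := o.abs_oracle_sub_le x s e
  have h2 := abs_two_point_le (o.lipschitz s) x hτ he
  rw [gradEstimate, norm_smul, he, mul_one, norm_mul, Real.norm_of_nonneg (by positivity),
    Real.norm_eq_abs]
  calc _ ≤ d / (2 * τ) * (2 * τ * M s + 2 * Δ) := by gcongr; linarith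
    _ = _ := by field_simp

theorem RegularOracle.integrable_lip [IsProbabilityMeasure 𝒟]
    (o : RegularOracle 𝒟 X τ κ f noise M M₂ Δ) (hκ : 0 < κ) (hM₂ : 0 ≤ M₂) :
    Integrable M 𝒟 ∧ ∫ s, M s ∂𝒟 ≤ M₂ := by
  have hpow : ∀ s, (M s ^ (1 + κ)) ^ (1 / (1 + κ)) = M s := fun s => by
    rw [← Real.rpow_mul (o.lip_nonneg s), mul_one_div_cancel (by linarith), Real.rpow_one]
  have h0 : ∀ s, 0 ≤ M s ^ (1 + κ) := fun s => Real.rpow_nonneg (o.lip_nonneg s) _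
  have hs0 : 0 ≤ 1 / (1 + κ) := by positivity
  have hs1 : 1 / (1 + κ) ≤ 1 := (div_le_one (by linarith)).2 (by linarith)
  have hi := integrable_rpow_of_le_one o.moment_integrable h0 hs0 hs1
  have hj := integral_rpow_le_rpow_integral o.moment_integrable h0 hs0 hs1
  simp only [hpow] at hi hj
  refine ⟨hi, hj.trans ?_⟩
  calc _ ≤ (M₂ ^ (1 + κ)) ^ (1 / (1 + κ)) :=
        Real.rpow_le_rpow (integral_nonneg h0) o.moment_le hs0
    _ = M₂ := by
        rw [← Real.rpow_mul hM₂, mul_one_div_cancel (by linarith), Real.rpow_one]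

theorem RegularOracle.abs_objective_sub_le [IsProbabilityMeasure 𝒟]
    (o : RegularOracle 𝒟 X τ κ f noise M M₂ Δ) (hκ : 0 < κ) (hM₂ : 0 ≤ M₂) (x y : Vec d) :
    |objective 𝒟 f x - objective 𝒟 f y| ≤ M₂ * ‖x - y‖ := by
  obtain ⟨hi, hle⟩ := o.integrable_lip hκ hM₂
  rw [objective, objective, ← integral_sub (o.integrable x) (o.integrable y)]
  calc _ ≤ ∫ s, |f x s - f y s| ∂𝒟 := abs_integral_le_integral_abs
    _ ≤ ∫ s, M s * ‖x - y‖ ∂𝒟 :=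
        integral_mono ((o.integrable x).sub (o.integrable y)).abs (hi.mul_const _)
          fun s => o.lipschitz s x y
    _ = (∫ s, M s ∂𝒟) * ‖x - y‖ := integral_mul_const _ _
    _ ≤ M₂ * ‖x - y‖ := by gcongr

theorem RegularOracle.convexOn_objective [IsProbabilityMeasure 𝒟]
    (o : RegularOracle 𝒟 X τ κ f noise M M₂ Δ) (hX : Convex ℝ X) :
    ConvexOn ℝ (enlargement X τ) (objective 𝒟 f) := by
  refine ⟨hX.add ((convex_closedBall _ _).smul _), fun x hx y hy a b ha hb hab => ?_⟩
  simp only [objective, smul_eq_mul]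
  rw [← integral_const_mul, ← integral_const_mul,
    ← integral_add ((o.integrable x).const_mul _) ((o.integrable y).const_mul _)]
  exact integral_mono (o.integrable _) (((o.integrable x).const_mul _).add
    ((o.integrable y).const_mul _)) fun s => (o.convex s).2 hx hy ha hb hab

theorem ae_norm_snd_eq_one [IsProbabilityMeasure 𝒟] (hd : 0 < d) :
    ∀ᵐ z ∂𝒟.prod (uniformSphere d), ‖z.2‖ = 1 := by
  have := isProbabilityMeasure_uniformSphere hd
  exact Measure.quasiMeasurePreserving_snd.ae (ae_norm_eq_one_uniformSphere d)

theorem RegularOracle.integrable_gradEstimate [IsProbabilityMeasure 𝒟]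
    (o : RegularOracle 𝒟 X τ κ f noise M M₂ Δ) (hd : 0 < d) (hτ : 0 < τ) (hκ : 0 < κ)
    (hM₂ : 0 ≤ M₂) (x : Vec d) :
    Integrable (fun z => gradEstimate f noise τ x z.1 z.2) (𝒟.prod (uniformSphere d)) := by
  have := isProbabilityMeasure_uniformSphere hd
  have hi := (o.integrable_lip hκ hM₂).1
  have hm : Measurable fun z : Ξ × Vec d => gradEstimate f noise τ x z.1 z.2 :=
    o.measurable_gradEstimate.comp (f := fun z : Ξ × Vec d => (x, z)) (by fun_prop)
  refine Integrable.mono' (((hi.comp_fst (uniformSphere d)).const_mul (d : ℝ)).add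
    (integrable_const (d * Δ / τ))) hm.aestronglyMeasurable ?_
  filter_upwards [ae_norm_snd_eq_one (𝒟 := 𝒟) hd] with z hz
  exact o.norm_gradEstimate_le hτ x z.1 hz

/-- The mean of the gradient estimate is an approximate subgradient of the objective. -/
theorem RegularOracle.objective_sub_le_integral_inner [IsProbabilityMeasure 𝒟]
    (o : RegularOracle 𝒟 X τ κ f noise M M₂ Δ) (hd : 0 < d) (hX : Convex ℝ X) (hτ : 0 < τ)
    (hκ : 0 < κ) (hM₂ : 0 ≤ M₂) {x u : Vec d} (hx : x ∈ X) (hu : u ∈ X) :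
    objective 𝒟 f x - objective 𝒟 f u ≤
      ∫ z, inner ℝ (gradEstimate f noise τ x z.1 z.2) (x - u) ∂𝒟.prod (uniformSphere d) +
        2 * M₂ * τ + Δ * √d / τ * ‖x - u‖ := by
  have := isProbabilityMeasure_uniformSphere hd
  have hd' : (0 : ℝ) < d := by exact_mod_cast hd
  set r := x - u with hr
  have hL := o.abs_objective_sub_le hκ hM₂
  have hfc : Continuous (objective 𝒟 f) := continuous_of_abs_sub_le hM₂ hL
  have h1 := sub_le_integral_uniformSphere hd hτ (o.convexOn_objective hX) hM₂ hL hx hu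
  rw [← hr] at h1
  -- integrals over the sphere
  have hbdd : ∀ g : Vec d → ℝ, Measurable g → (∃ C, ∀ e, ‖e‖ = 1 → |g e| ≤ C) →
      Integrable g (uniformSphere d) := by
    rintro g hg ⟨C, hC⟩
    refine (integrable_const C).mono' hg.aestronglyMeasurable ?_
    filter_upwards [ae_norm_eq_one_uniformSphere d] with e he using hC e he
  have hinner : ∀ e : Vec d, ‖e‖ = 1 → |inner ℝ e r| ≤ ‖r‖ := fun e he => by
    simpa [he] using abs_real_inner_le_norm e r
  have hfi : ∀ ρ : ℝ, Integrable (fun e => objective 𝒟 f (x + ρ • e) * inner ℝ e r)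
      (uniformSphere d) := by
    intro ρ
    obtain ⟨C, hC⟩ := (isCompact_sphere (0 : Vec d) 1).exists_bound_of_continuousOn
      (f := fun e => objective 𝒟 f (x + ρ • e) * inner ℝ e r) (by fun_prop)
    exact hbdd _ (by fun_prop) ⟨C, fun e he => hC e (by simpa using he)⟩
  -- By antipodal symmetry both halves of the two-point difference contribute equally, which
  -- accounts for the 2 in d/(2τ).
  have hsymm : ∫ e, objective 𝒟 f (x + -τ • e) * inner ℝ e r ∂uniformSphere d =
      -∫ e, objective 𝒟 f (x + τ • e) * inner ℝ e r ∂uniformSphere d := by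
    rw [← (measurePreserving_neg_uniformSphere hd).integral_comp
      (MeasurableEquiv.neg (Vec d)).measurableEmbedding, ← integral_neg]
    simp
  have hnm := o.measurable_noise
  have hni : Integrable (fun e => (noise (x + τ • e) - noise (x - τ • e)) * inner ℝ e r)
      (uniformSphere d) := by
    refine hbdd _ (by fun_prop) ⟨2 * Δ * ‖r‖, fun e he => ?_⟩
    rw [abs_mul]
    have h1 := abs_le.1 (o.noise_le (x + τ • e))
    have h2 := abs_le.1 (o.noise_le (x - τ • e))
    have h3 : |noise (x + τ • e) - noise (x - τ • e)| ≤ 2 * Δ := by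
      rw [abs_le]; constructor <;> linarith
    exact mul_le_mul h3 (hinner e he) (abs_nonneg _) ((abs_nonneg _).trans h3)
  have hnoise : -(2 * Δ * (‖r‖ / √d)) ≤
      ∫ e, (noise (x + τ • e) - noise (x - τ • e)) * inner ℝ e r ∂uniformSphere d := by
    have hΔ : 0 ≤ Δ := (abs_nonneg _).trans (o.noise_le 0)
    have habs : |∫ e, (noise (x + τ • e) - noise (x - τ • e)) * inner ℝ e r ∂uniformSphere d| ≤
        2 * Δ * (‖r‖ / √d) := by
      calc _ ≤ ∫ e, |(noise (x + τ • e) - noise (x - τ • e)) * inner ℝ e r| ∂uniformSphere d :=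
            abs_integral_le_integral_abs
        _ ≤ ∫ e, 2 * Δ * |inner ℝ r e| ∂uniformSphere d := by
            refine integral_mono hni.abs ((hbdd (fun e => |inner ℝ r e|) (by fun_prop)
              ⟨‖r‖, fun e he => ?_⟩).const_mul _) fun e => ?_
            · rw [abs_abs, real_inner_comm]; exact hinner e he
            · rw [abs_mul, real_inner_comm]
              have h1 := abs_le.1 (o.noise_le (x + τ • e))
              have h2 := abs_le.1 (o.noise_le (x - τ • e))
              gcongr
              rw [abs_le]; constructor <;> linarith
        _ ≤ _ := by
            rw [integral_const_mul]
            gcongr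
            exact integral_abs_inner_uniformSphere_le hd r
    exact (abs_le.1 habs).1
  have hG : ∫ z, inner ℝ (gradEstimate f noise τ x z.1 z.2) r ∂𝒟.prod (uniformSphere d) =
      d / (2 * τ) * (2 * ∫ e, objective 𝒟 f (x + τ • e) * inner ℝ e r ∂uniformSphere d +
        ∫ e, (noise (x + τ • e) - noise (x - τ • e)) * inner ℝ e r ∂uniformSphere d) := by
    rw [integral_prod_symm _ ((o.integrable_gradEstimate hd hτ hκ hM₂ x).inner_const r)]
    have hin : ∀ e : Vec d, ∫ s, inner ℝ (gradEstimate f noise τ x s e) r ∂𝒟 =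
        d / (2 * τ) * (objective 𝒟 f (x + τ • e) * inner ℝ e r -
          objective 𝒟 f (x + -τ • e) * inner ℝ e r +
          (noise (x + τ • e) - noise (x - τ • e)) * inner ℝ e r) := by
      intro e
      have hpt : ∀ s, inner ℝ (gradEstimate f noise τ x s e) r =
          (d / (2 * τ) * inner ℝ e r) * (f (x + τ • e) s - f (x + -τ • e) s +
            (noise (x + τ • e) - noise (x - τ • e))) := by
        intro s
        rw [gradEstimate, real_inner_smul_left, neg_smul, ← sub_eq_add_neg]
        simp only [oracle]
        ring
      have hfd : Integrable (fun s => f (x + τ • e) s - f (x + -τ • e) s) 𝒟 :=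
        (o.integrable _).sub (o.integrable _)
      simp_rw [hpt]
      rw [integral_const_mul, integral_add hfd (integrable_const _), integral_sub (o.integrable _) (o.integrable _)]
      simp only [objective, integral_const, probReal_univ, smul_eq_mul, one_mul]
      ring
    have hfd : Integrable (fun e => objective 𝒟 f (x + τ • e) * inner ℝ e r -
        objective 𝒟 f (x + -τ • e) * inner ℝ e r) (uniformSphere d) := (hfi τ).sub (hfi (-τ))
    simp_rw [hin]
    rw [integral_const_mul, integral_add hfd hni,
      integral_sub (hfi τ) (hfi (-τ)), hsymm]
    ring
  rw [hG]
  have hfin : -(Δ * √d / τ * ‖r‖) ≤ d / (2 * τ) *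
      ∫ e, (noise (x + τ • e) - noise (x - τ • e)) * inner ℝ e r ∂uniformSphere d := by
    calc -(Δ * √d / τ * ‖r‖) = d / (2 * τ) * -(2 * Δ * (‖r‖ / √d)) := by
          have h0 : 0 < √(d : ℝ) := Real.sqrt_pos.2 hd'
          field_simp
          rw [Real.sq_sqrt hd'.le]
          ring
      _ ≤ _ := by gcongr
  have hmain : d / τ * ∫ e, objective 𝒟 f (x + τ • e) * inner ℝ e r ∂uniformSphere d =
      d / (2 * τ) * (2 * ∫ e, objective 𝒟 f (x + τ • e) * inner ℝ e r ∂uniformSphere d) := by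
    field_simp
  rw [mul_add]
  linarith

end Oracle

end ZOClipSMD

namespace ZOClipSMD

/-! ### Moments of the gradient estimate -/

theorem add_rpow_le_two_rpow_mul {a b κ : ℝ} (ha : 0 ≤ a) (hb : 0 ≤ b) (hκ : 0 ≤ κ) :
    (a + b) ^ (1 + κ) ≤ 2 ^ κ * (a ^ (1 + κ) + b ^ (1 + κ)) := by
  lift a to NNReal using ha
  lift b to NNReal using hb
  have h := NNReal.rpow_add_le_mul_rpow_add_rpow a b (p := 1 + κ) (by linarith)
  rw [add_sub_cancel_left] at h
  exact_mod_cast h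

/-- Jensen with the exponent (1+κ)/2 ≤ 1. Since K ≥ 1, the power of K is absorbed into K, which
keeps the constant independent of κ. -/
theorem integral_rpow_le_of_integral_sq_le {d : ℕ} (hd : 0 < d) {g : Vec d → ℝ} (hg : Measurable g)
    (h0 : ∀ e, 0 ≤ g e) {C : ℝ} (hC : ∀ e, ‖e‖ = 1 → g e ≤ C) {K b κ : ℝ} (hK : 1 ≤ K)
    (hb : 0 ≤ b) (hκ : 0 ≤ κ) (hκ1 : κ ≤ 1)
    (h2 : ∫ e, g e ^ 2 ∂uniformSphere d ≤ K * b ^ 2) :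
    ∫ e, g e ^ (1 + κ) ∂uniformSphere d ≤ K * b ^ (1 + κ) := by
  have := isProbabilityMeasure_uniformSphere hd
  have hpow : ∀ y : ℝ, 0 ≤ y → (y ^ 2) ^ ((1 + κ) / 2) = y ^ (1 + κ) := fun y hy => by
    rw [← Real.rpow_natCast, ← Real.rpow_mul hy]
    congr 1
    push_cast
    ring
  have hi : Integrable (fun e => g e ^ 2) (uniformSphere d) := by
    refine (integrable_const (C ^ 2)).mono' (by fun_prop) ?_
    filter_upwards [ae_norm_eq_one_uniformSphere d] with e he
    rw [Real.norm_of_nonneg (by positivity)]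
    exact pow_le_pow_left₀ (h0 e) (hC e he) 2
  have h := integral_rpow_le_rpow_integral hi (fun e => by positivity)
    (s := (1 + κ) / 2) (by linarith) (by linarith)
  simp only [hpow _ (h0 _)] at h
  calc _ ≤ (K * b ^ 2) ^ ((1 + κ) / 2) :=
        h.trans (Real.rpow_le_rpow (integral_nonneg fun e => by positivity) h2 (by linarith))
    _ = K ^ ((1 + κ) / 2) * b ^ (1 + κ) := by
        rw [Real.mul_rpow (by linarith) (by positivity), hpow b hb]
    _ ≤ K ^ (1 : ℝ) * b ^ (1 + κ) := by
        gcongr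
        linarith
    _ = _ := by rw [Real.rpow_one]

theorem sigma_rpow {d : ℕ} (hd : 2 ≤ d) {q : ℝ≥0∞} (hq : 2 ≤ q) {κ M₂ Δ τ : ℝ} (hκ : 0 < κ)
    (hM₂ : 0 ≤ M₂) (hΔ : 0 ≤ Δ) (hτ : 0 < τ) :
    sigma d q κ M₂ Δ τ ^ (1 + κ) =
      (2 : ℝ) ^ κ * (√d / (2 : ℝ) ^ (1 / 4 : ℝ) * aCoef d q * M₂) ^ (1 + κ) +
        (2 : ℝ) ^ κ * (d * aCoef d q * Δ / τ) ^ (1 + κ) := by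
  have ha := (aCoef_pos hd hq).le
  rw [sigma, ← Real.rpow_mul (by positivity), one_div_mul_cancel (by linarith), Real.rpow_one]

theorem sigma_nonneg {d : ℕ} (hd : 2 ≤ d) {q : ℝ≥0∞} (hq : 2 ≤ q) {κ M₂ Δ τ : ℝ}
    (hM₂ : 0 ≤ M₂) (hΔ : 0 ≤ Δ) (hτ : 0 < τ) : 0 ≤ sigma d q κ M₂ Δ τ := by
  have ha := (aCoef_pos hd hq).le
  unfold sigma
  positivity

theorem sigma_pos {d : ℕ} (hd : 2 ≤ d) {q : ℝ≥0∞} (hq : 2 ≤ q) {κ M₂ Δ τ : ℝ}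
    (hM₂ : 0 ≤ M₂) (hΔ : 0 ≤ Δ) (h : 0 < M₂ ∨ 0 < Δ) (hτ : 0 < τ) : 0 < sigma d q κ M₂ Δ τ := by
  have ha := aCoef_pos hd hq
  have hd' : (0 : ℝ) < d := by exact_mod_cast (by omega : 0 < d)
  unfold sigma
  rcases h with h | h <;> positivity

/-- The Lipschitz part and the noise part are separated by convexity of the power, which is the 2^κ
in σ_q. For the Lipschitz part the integral over e comes first, at fixed ξ, where second moments are
available and yield a multiple of M(ξ)^(1+κ). Only then is ξ averaged, since M may have no second
moment. -/
theorem RegularOracle.integral_ellNorm_gradEstimate_rpow_le {d : ℕ} {Ξ : Type*}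
    [MeasurableSpace Ξ] {𝒟 : Measure Ξ} [IsProbabilityMeasure 𝒟] {X : Set (Vec d)}
    {τ κ : ℝ} {f : Vec d → Ξ → ℝ} {noise : Vec d → ℝ} {M : Ξ → ℝ} {M₂ Δ : ℝ}
    (o : RegularOracle 𝒟 X τ κ f noise M M₂ Δ) (hd : 2 ≤ d) {q : ℝ≥0∞} (hq : 2 ≤ q)
    (hτ : 0 < τ) (hκ : 0 < κ) (hκ1 : κ ≤ 1) (hM₂ : 0 ≤ M₂) (x : Vec d) :
    Integrable (fun z => ellNorm q (gradEstimate f noise τ x z.1 z.2) ^ (1 + κ))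
        (𝒟.prod (uniformSphere d)) ∧
      ∫ z, ellNorm q (gradEstimate f noise τ x z.1 z.2) ^ (1 + κ) ∂𝒟.prod (uniformSphere d) ≤
        momentConst * sigma d q κ M₂ Δ τ ^ (1 + κ) := by
  have hq1 : Fact (1 ≤ q) := ⟨one_le_two.trans hq⟩
  have hd0 : 0 < d := by omega
  have := isProbabilityMeasure_uniformSphere hd0
  have hΔ : 0 ≤ Δ := (abs_nonneg _).trans (o.noise_le 0)
  have ha := (aCoef_pos hd hq).le
  have hN0 := ellNorm_nonneg (d := d) q
  have hNc := continuous_ellNorm (d := d) q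
  have hN1 : ∀ e : Vec d, ‖e‖ = 1 → ellNorm q e ≤ 1 := fun e he => by
    simpa [he] using ellNorm_le_norm hq e
  have hM0 := o.lip_nonneg
  let A : Ξ × Vec d → ℝ := fun z =>
    d / (2 * τ) * (|f (x + τ • z.2) z.1 - f (x - τ • z.2) z.1| * ellNorm q z.2)
  let B : Vec d → ℝ := fun e => d * Δ / τ * ellNorm q e
  have hA0 : ∀ z, 0 ≤ A z := fun z => by have := hN0 z.2; positivity
  have hB0 : ∀ e, 0 ≤ B e := fun e => by have := hN0 e; positivity
  have hAm : Measurable A := by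
    have h1 : Measurable fun z : Ξ × Vec d => f (x + τ • z.2) z.1 :=
      o.measurable.comp (f := fun z : Ξ × Vec d => (x + τ • z.2, z.1)) (by fun_prop)
    have h2 : Measurable fun z : Ξ × Vec d => f (x - τ • z.2) z.1 :=
      o.measurable.comp (f := fun z : Ξ × Vec d => (x - τ • z.2, z.1)) (by fun_prop)
    have h3 : Measurable fun z : Ξ × Vec d => ellNorm q z.2 := hNc.measurable.comp measurable_snd
    exact (((continuous_abs.measurable.comp (h1.sub h2))).mul h3).const_mul _
  have hBm : Measurable B := hNc.measurable.const_mul _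
  have hA1 : ∀ s e, ‖e‖ = 1 → A (s, e) ≤ d * M s := by
    intro s e he
    have h1 := abs_two_point_le (o.lipschitz s) x hτ he
    calc A (s, e) ≤ d / (2 * τ) * ((2 * τ * M s) * 1) := by
          simp only [A]
          gcongr
          · exact hN0 e
          · exact mul_nonneg (by positivity) (hM0 s)
          · exact hN1 e he
      _ = d * M s := by field_simp
  have hB1 : ∀ e, ‖e‖ = 1 → B e ≤ d * Δ / τ := by
    intro e he
    simp only [B]
    exact mul_le_of_le_one_right (by positivity) (hN1 e he)
  have hAi : Integrable (fun z => A z ^ (1 + κ)) (𝒟.prod (uniformSphere d)) := by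
    refine Integrable.mono' ((o.moment_integrable.comp_fst (uniformSphere d)).const_mul
      ((d : ℝ) ^ (1 + κ))) (hAm.pow_const _).aestronglyMeasurable ?_
    filter_upwards [ae_norm_snd_eq_one (𝒟 := 𝒟) hd0] with z hz
    rw [Real.norm_of_nonneg (Real.rpow_nonneg (hA0 z) _), ← Real.mul_rpow (by positivity) (hM0 _)]
    exact Real.rpow_le_rpow (hA0 z) (hA1 z.1 z.2 hz) (by linarith)
  have hBi : Integrable (fun e => B e ^ (1 + κ)) (uniformSphere d) := by
    refine (integrable_const ((d * Δ / τ) ^ (1 + κ))).mono'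
      (hBm.pow_const _).aestronglyMeasurable ?_
    filter_upwards [ae_norm_eq_one_uniformSphere d] with e he
    rw [Real.norm_of_nonneg (Real.rpow_nonneg (hB0 e) _)]
    exact Real.rpow_le_rpow (hB0 e) (hB1 e he) (by linarith)
  have hBi' : Integrable (fun z : Ξ × Vec d => B z.2 ^ (1 + κ)) (𝒟.prod (uniformSphere d)) :=
    hBi.comp_snd 𝒟
  have hpt : ∀ z : Ξ × Vec d, ellNorm q (gradEstimate f noise τ x z.1 z.2) ^ (1 + κ) ≤
      2 ^ κ * (A z ^ (1 + κ) + B z.2 ^ (1 + κ)) := by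
    intro z
    refine le_trans ?_ (add_rpow_le_two_rpow_mul (hA0 z) (hB0 z.2) hκ.le)
    refine Real.rpow_le_rpow (ellNorm_nonneg q _) ?_ (by linarith)
    rw [gradEstimate, ellNorm_smul, abs_mul, abs_of_nonneg (by positivity)]
    have h1 := o.abs_oracle_sub_le x z.1 z.2
    have h2 := hN0 z.2
    calc _ ≤ d / (2 * τ) * (|f (x + τ • z.2) z.1 - f (x - τ • z.2) z.1| + 2 * Δ) *
          ellNorm q z.2 := by gcongr
      _ = _ := by simp only [A, B]; field_simp
  have hdom := (hAi.add hBi').const_mul ((2 : ℝ) ^ κ)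
  have hGi : Integrable (fun z => ellNorm q (gradEstimate f noise τ x z.1 z.2) ^ (1 + κ))
      (𝒟.prod (uniformSphere d)) := by
    have hm : Measurable fun z : Ξ × Vec d => ellNorm q (gradEstimate f noise τ x z.1 z.2) :=
      hNc.measurable.comp (o.measurable_gradEstimate.comp
        (f := fun z : Ξ × Vec d => (x, z)) (by fun_prop))
    refine hdom.mono' (hm.pow_const _).aestronglyMeasurable (.of_forall fun z => ?_)
    rw [Real.norm_of_nonneg (Real.rpow_nonneg (ellNorm_nonneg q _) _)]
    exact hpt z
  refine ⟨hGi, ?_⟩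
  set c₁ := √d / (2 : ℝ) ^ (1 / 4 : ℝ) * aCoef d q with hc₁
  have hc₁0 : 0 ≤ c₁ := by positivity
  have hIA : ∫ z, A z ^ (1 + κ) ∂𝒟.prod (uniformSphere d) ≤
      momentConst * (c₁ * M₂) ^ (1 + κ) := by
    rw [integral_prod _ hAi]
    have hin : ∀ s, ∫ e, A (s, e) ^ (1 + κ) ∂uniformSphere d ≤
        momentConst * (c₁ * M s) ^ (1 + κ) := fun s =>
      integral_rpow_le_of_integral_sq_le hd0 (hAm.comp (by fun_prop)) (fun e => hA0 (s, e))
        (hA1 s) one_le_momentConst (mul_nonneg hc₁0 (hM0 s)) hκ.le hκ1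
        (integral_two_point_sq_mul_ellNorm_sq_le hd hq (hM0 s) (o.lipschitz s) x hτ)
    have hK0 : 0 ≤ momentConst := zero_le_one.trans one_le_momentConst
    calc _ ≤ ∫ s, momentConst * (c₁ * M s) ^ (1 + κ) ∂𝒟 := by
          refine integral_mono_of_nonneg (.of_forall fun s => integral_nonneg fun e =>
            Real.rpow_nonneg (hA0 (s, e)) _) ?_ (.of_forall hin)
          simp_rw [Real.mul_rpow hc₁0 (hM0 _)]
          exact (o.moment_integrable.const_mul _).const_mul _
      _ = momentConst * (c₁ ^ (1 + κ) * ∫ s, M s ^ (1 + κ) ∂𝒟) := by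
          simp_rw [Real.mul_rpow hc₁0 (hM0 _)]
          rw [integral_const_mul, integral_const_mul]
      _ ≤ momentConst * (c₁ ^ (1 + κ) * M₂ ^ (1 + κ)) := by
          gcongr
          exact o.moment_le
      _ = _ := by rw [Real.mul_rpow hc₁0 hM₂]
  have hIB : ∫ z : Ξ × Vec d, B z.2 ^ (1 + κ) ∂𝒟.prod (uniformSphere d) ≤
      momentConst * (d * aCoef d q * Δ / τ) ^ (1 + κ) := by
    rw [integral_fun_snd (fun e => B e ^ (1 + κ)), probReal_univ, one_smul]
    refine integral_rpow_le_of_integral_sq_le hd0 hBm hB0 hB1 one_le_momentConst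
      (by positivity) hκ.le hκ1 ?_
    simp only [B, mul_pow]
    rw [integral_const_mul]
    calc _ ≤ (d * Δ / τ) ^ 2 * (momentConst * aCoef d q ^ 2) := by
          gcongr
          exact integral_ellNorm_sq_uniformSphere_le hd hq
      _ = _ := by ring
  calc _ ≤ ∫ z : Ξ × Vec d, 2 ^ κ * (A z ^ (1 + κ) + B z.2 ^ (1 + κ)) ∂𝒟.prod (uniformSphere d) :=
        integral_mono hGi hdom hpt
    _ = 2 ^ κ * (∫ z, A z ^ (1 + κ) ∂𝒟.prod (uniformSphere d) +
          ∫ z : Ξ × Vec d, B z.2 ^ (1 + κ) ∂𝒟.prod (uniformSphere d)) := by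
        rw [integral_const_mul, integral_add hAi hBi']
    _ ≤ 2 ^ κ * (momentConst * (c₁ * M₂) ^ (1 + κ) +
          momentConst * (d * aCoef d q * Δ / τ) ^ (1 + κ)) := by gcongr
    _ = _ := by rw [sigma_rpow hd hq hκ hM₂ hΔ hτ]; ring

/-! ### Clipping -/

section Clip

variable {d : ℕ} {q : ℝ≥0∞} [Fact (1 ≤ q)]

theorem ellNorm_clip {c : ℝ} (hc : 0 < c) (g : Vec d) :
    ellNorm q (clip q c g) = min (ellNorm q g) c := by
  have h0 := ellNorm_nonneg q g
  rw [clip, ellNorm_smul, abs_of_nonneg (by positivity)]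
  rcases h0.eq_or_lt with h | h
  · simp [← h, hc.le]
  · field_simp

theorem ellNorm_sub_clip {c : ℝ} (hc : 0 < c) (g : Vec d) :
    ellNorm q (g - clip q c g) = ellNorm q g - min (ellNorm q g) c := by
  have h0 := ellNorm_nonneg q g
  have h1 : g - clip q c g = (1 - min (ellNorm q g) c / ellNorm q g) • g := by
    rw [clip, sub_smul, one_smul]
  rw [h1, ellNorm_smul, abs_of_nonneg]
  · rcases h0.eq_or_lt with h | h
    · simp [← h, hc.le]
    · field_simp
  · exact sub_nonneg.2 (div_le_one_of_le₀ (min_le_left _ _) h0)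

theorem measurable_clip (c : ℝ) : Measurable (clip (d := d) q c) := by
  have := (continuous_ellNorm (d := d) q).measurable
  unfold clip
  fun_prop

/-- Interpolation that turns a (1+κ)-th moment into a second moment after clipping. -/
theorem min_sq_le_rpow_mul {N c κ : ℝ} (hN : 0 ≤ N) (hc : 0 < c) (hκ : 0 ≤ κ) (hκ1 : κ ≤ 1) :
    min N c ^ 2 ≤ N ^ (1 + κ) * c ^ (1 - κ) := by
  have hm : 0 ≤ min N c := le_min hN hc.le
  calc min N c ^ 2 = min N c ^ (1 + κ) * min N c ^ (1 - κ) := by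
        rw [← Real.rpow_add_of_nonneg hm (by linarith) (by linarith), ← Real.rpow_natCast]
        congr 1
        push_cast
        ring
    _ ≤ N ^ (1 + κ) * c ^ (1 - κ) := by
        have h1 : 0 ≤ 1 - κ := by linarith
        gcongr
        · exact min_le_left _ _
        · exact min_le_right _ _

/-- Controls the bias of clipping: the discarded part lives where N ≥ c, and there N = N^(1+κ)
N^(-κ) ≤ N^(1+κ) c^(-κ). -/
theorem sub_min_le_rpow_mul {N c κ : ℝ} (hN : 0 ≤ N) (hc : 0 < c) (hκ : 0 ≤ κ) :
    N - min N c ≤ N ^ (1 + κ) * c ^ (-κ) := by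
  rcases le_total N c with h | h
  · rw [min_eq_left h, sub_self]
    positivity
  · have hN' : 0 < N := hc.trans_le h
    calc N - min N c ≤ N := by linarith [le_min hN hc.le]
      _ = N ^ (1 + κ) * N ^ (-κ) := by
          rw [← Real.rpow_add hN', add_neg_cancel_right, Real.rpow_one]
      _ ≤ N ^ (1 + κ) * c ^ (-κ) := by
          have := Real.rpow_le_rpow_of_nonpos hc h (by linarith : -κ ≤ 0)
          gcongr

end Clip

end ZOClipSMD

namespace ZOClipSMD

/-! ### Exponential moments of the clipped gradient estimate -/

theorem exp_le_one_add_add_sq {y : ℝ} (hy : |y| ≤ 1) : Real.exp y ≤ 1 + y + y ^ 2 := by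
  have := (abs_le.1 (Real.abs_exp_sub_one_sub_id_le hy)).2
  linarith

/-- One-step exponential estimate. Clipping bounds the random part of the exponent, so the
exponential is at most quadratic in it. Its mean is at most -A/(2cD) plus multiples of Kη coming
from the bias and the second moment, and the term in A cancels the deterministic part. The quadratic
term of the regret inequality is included from the start. -/
theorem integral_exp_clip_le {Z : Type*} [MeasurableSpace Z] {P : Measure Z}
    [IsProbabilityMeasure P] {d : ℕ} {p q : ℝ≥0∞} (hpq : p.HolderConjugate q) [Fact (1 ≤ q)]
    {G : Z → Vec d} (hG : Measurable G) {K η c κ D A : ℝ} (hc : 0 < c)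
    (hκ : 0 ≤ κ) (hκ1 : κ ≤ 1) (hD : 0 < D)
    (hi : Integrable (fun z => ellNorm q (G z) ^ (1 + κ)) P)
    (hm : ∫ z, ellNorm q (G z) ^ (1 + κ) ∂P ≤ K * η * c ^ (1 + κ))
    {r : Vec d} (hr : ellNorm p r ≤ D) (hGr : Integrable (fun z => inner ℝ (G z) r) P)
    (hA : A ≤ ∫ z, inner ℝ (G z) r ∂P) :
    ∫⁻ z, ENNReal.ofReal (Real.exp (1 / 2 * (A / (c * D) - inner ℝ (clip q c (G z)) r / (c * D) +
        ellNorm q (clip q c (G z)) ^ 2 / (2 * c ^ 2)))) ∂P ≤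
      ENNReal.ofReal (Real.exp (2 * (K * η))) := by
  have hN0 := fun z => ellNorm_nonneg q (G z)
  have hNm : Measurable fun z => ellNorm q (G z) := (continuous_ellNorm q).measurable.comp hG
  have hCm : Measurable fun z => clip q c (G z) := (measurable_clip c).comp hG
  have hCr : Measurable fun z => inner ℝ (clip q c (G z)) r := hCm.inner measurable_const
  have hin : ∀ g : Vec d, |inner ℝ g r| ≤ ellNorm q g * D := fun g => by
    rw [real_inner_comm]
    refine (abs_inner_le_ellNorm_mul hpq r g).trans ?_
    rw [mul_comm]
    exact mul_le_mul_of_nonneg_left hr (ellNorm_nonneg q g)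
  simp only [ellNorm_clip hc]
  set w : Z → ℝ := fun z => min (ellNorm q (G z)) c with hw
  have hw0 : ∀ z, 0 ≤ w z := fun z => le_min (hN0 z) hc.le
  have hwc : ∀ z, w z ≤ c := fun z => min_le_right _ _
  have hwm : Measurable w := hNm.min measurable_const
  have hCb : ∀ z, |inner ℝ (clip q c (G z)) r| ≤ w z * D := fun z => by
    simpa only [ellNorm_clip hc] using hin (clip q c (G z))
  have hwi : Integrable (fun z => w z ^ 2) P := by
    refine Integrable.of_bound (hwm.pow_const 2).aestronglyMeasurable (c ^ 2) (.of_forall fun z => ?_)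
    rw [Real.norm_of_nonneg (by positivity)]
    exact pow_le_pow_left₀ (hw0 z) (hwc z) 2
  have hCi : Integrable (fun z => inner ℝ (clip q c (G z)) r) P := by
    refine Integrable.of_bound hCr.aestronglyMeasurable (c * D) (.of_forall fun z => ?_)
    exact (hCb z).trans (mul_le_mul_of_nonneg_right (hwc z) hD.le)
  have hsq : ∫ z, w z ^ 2 ∂P ≤ K * η * c ^ 2 := by
    calc _ ≤ ∫ z, ellNorm q (G z) ^ (1 + κ) * c ^ (1 - κ) ∂P :=
          integral_mono hwi (hi.mul_const _) fun z => min_sq_le_rpow_mul (hN0 z) hc hκ hκ1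
      _ ≤ K * η * c ^ (1 + κ) * c ^ (1 - κ) := by
          rw [integral_mul_const]
          gcongr
      _ = K * η * c ^ 2 := by
          rw [mul_assoc, ← Real.rpow_add hc, ← Real.rpow_natCast]
          congr 2
          push_cast
          ring
  have hbias : A - K * η * c * D ≤ ∫ z, inner ℝ (clip q c (G z)) r ∂P := by
    have h1 : ∫ z, inner ℝ (G z) r - inner ℝ (clip q c (G z)) r ∂P ≤
        ∫ z, ellNorm q (G z) ^ (1 + κ) * (c ^ (-κ) * D) ∂P := by
      refine integral_mono (hGr.sub hCi) (hi.mul_const _) fun z => ?_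
      simp only
      rw [← inner_sub_left, ← mul_assoc]
      refine (le_abs_self _).trans ((hin _).trans ?_)
      rw [ellNorm_sub_clip hc]
      exact mul_le_mul_of_nonneg_right (sub_min_le_rpow_mul (hN0 z) hc hκ) hD.le
    have h2 : ∫ z, ellNorm q (G z) ^ (1 + κ) * (c ^ (-κ) * D) ∂P ≤ K * η * c * D := by
      rw [integral_mul_const]
      calc _ ≤ K * η * c ^ (1 + κ) * (c ^ (-κ) * D) := by gcongr
        _ = K * η * (c ^ (1 + κ) * c ^ (-κ)) * D := by ring
        _ = _ := by rw [← Real.rpow_add hc, add_neg_cancel_right, Real.rpow_one]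
    rw [integral_sub hGr hCi] at h1
    linarith
  set v : Z → ℝ := fun z => -(inner ℝ (clip q c (G z)) r / (c * D)) + w z ^ 2 / (2 * c ^ 2) with hv
  have hCi' : Integrable (fun z => -(inner ℝ (clip q c (G z)) r / (c * D))) P :=
    (hCi.div_const _).neg
  have hvi : Integrable v P := hCi'.add (hwi.div_const _)
  have hcD : 0 < c * D := by positivity
  have hvb : ∀ z, |v z| ≤ 3 / 2 * (w z / c) := fun z => by
    have h1 : |inner ℝ (clip q c (G z)) r / (c * D)| ≤ w z / c := by
      rw [abs_div, abs_of_pos hcD, div_le_div_iff₀ hcD hc]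
      nlinarith [hCb z]
    have h2 : w z ^ 2 / (2 * c ^ 2) ≤ 1 / 2 * (w z / c) := by
      have h3 : w z / c ≤ 1 := (div_le_one hc).2 (hwc z)
      have h4 : 0 ≤ w z / c := div_nonneg (hw0 z) hc.le
      have h5 : w z ^ 2 / (2 * c ^ 2) = 1 / 2 * (w z / c) ^ 2 := by field_simp
      rw [h5]
      nlinarith
    calc |v z| ≤ |-(inner ℝ (clip q c (G z)) r / (c * D))| + |w z ^ 2 / (2 * c ^ 2)| :=
          abs_add_le _ _
      _ ≤ w z / c + 1 / 2 * (w z / c) := by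
          rw [abs_neg, abs_of_nonneg (by positivity : 0 ≤ w z ^ 2 / (2 * c ^ 2))]
          exact add_le_add h1 h2
      _ = _ := by ring
  -- Halving the exponent brings it to |v/2| ≤ 3/4 ≤ 1, where exp y ≤ 1 + y + y² holds. The total
  -- coefficient of Kη is then 1/2 + 1/4 + 9/16 ≤ 2.
  have hexp : ∀ z, Real.exp (v z / 2) ≤ 1 + v z / 2 + 9 / 16 * (w z ^ 2 / c ^ 2) := fun z => by
    have h3 : w z / c ≤ 1 := (div_le_one hc).2 (hwc z)
    have h4 : |v z / 2| ≤ 3 / 4 * (w z / c) := by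
      rw [abs_div, abs_two]
      linarith [hvb z]
    have h5 : (v z / 2) ^ 2 ≤ (3 / 4 * (w z / c)) ^ 2 := by
      rw [← sq_abs]
      gcongr
    have h6 := exp_le_one_add_add_sq (y := v z / 2) (by linarith)
    rw [mul_pow, div_pow (w z)] at h5
    linarith
  have hvi' : Integrable (fun z => 1 + v z / 2) P := (integrable_const 1).add (hvi.div_const 2)
  have hdi : Integrable (fun z => 1 + v z / 2 + 9 / 16 * (w z ^ 2 / c ^ 2)) P :=
    hvi'.add ((hwi.div_const _).const_mul _)
  have hw2 : (∫ z, w z ^ 2 ∂P) / c ^ 2 ≤ K * η := by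
    rw [div_le_iff₀ (by positivity)]
    exact hsq
  have hKη : 0 ≤ K * η := le_trans (by positivity) hw2
  have hint : ∫ z, 1 + v z / 2 + 9 / 16 * (w z ^ 2 / c ^ 2) ∂P ≤
      1 + (2 * (K * η) - 1 / 2 * (A / (c * D))) := by
    have h1 : ∫ z, v z ∂P = -((∫ z, inner ℝ (clip q c (G z)) r ∂P) / (c * D)) +
        (∫ z, w z ^ 2 ∂P) / (2 * c ^ 2) := by
      rw [hv, integral_add hCi' (hwi.div_const _), integral_neg, integral_div,
        integral_div]
    have h2 : A / (c * D) - K * η ≤ (∫ z, inner ℝ (clip q c (G z)) r ∂P) / (c * D) := by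
      rw [le_div_iff₀ hcD, sub_mul, div_mul_cancel₀ _ hcD.ne']
      linarith
    have h3 : (∫ z, w z ^ 2 ∂P) / (2 * c ^ 2) = 1 / 2 * ((∫ z, w z ^ 2 ∂P) / c ^ 2) := by
      field_simp
    rw [integral_add hvi' ((hwi.div_const _).const_mul _),
      integral_add (integrable_const 1) (hvi.div_const 2), integral_const_mul, integral_div,
      integral_div, h1, h3]
    simp only [integral_const, probReal_univ, smul_eq_mul]
    linarith
  have hpos : ∀ z, 0 ≤ 1 + v z / 2 + 9 / 16 * (w z ^ 2 / c ^ 2) := fun z =>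
    (Real.exp_pos _).le.trans (hexp z)
  have hsplit : ∀ z, ENNReal.ofReal (Real.exp (1 / 2 * (A / (c * D) -
        inner ℝ (clip q c (G z)) r / (c * D) + w z ^ 2 / (2 * c ^ 2)))) =
      ENNReal.ofReal (Real.exp (1 / 2 * (A / (c * D)))) * ENNReal.ofReal (Real.exp (v z / 2)) :=
    fun z => by
      rw [← ENNReal.ofReal_mul (Real.exp_pos _).le, ← Real.exp_add]
      congr 2
      simp only [hv]
      ring
  change ∫⁻ z, ENNReal.ofReal (Real.exp (1 / 2 * (A / (c * D) -
        inner ℝ (clip q c (G z)) r / (c * D) + w z ^ 2 / (2 * c ^ 2)))) ∂P ≤ _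
  simp only [hsplit]
  rw [lintegral_const_mul' _ _ ENNReal.ofReal_ne_top]
  calc _ ≤ ENNReal.ofReal (Real.exp (1 / 2 * (A / (c * D)))) *
        ∫⁻ z, ENNReal.ofReal (1 + v z / 2 + 9 / 16 * (w z ^ 2 / c ^ 2)) ∂P := by
        gcongr with z
        exact hexp z
    _ = ENNReal.ofReal (Real.exp (1 / 2 * (A / (c * D)))) *
        ENNReal.ofReal (∫ z, 1 + v z / 2 + 9 / 16 * (w z ^ 2 / c ^ 2) ∂P) := by
        rw [ofReal_integral_eq_lintegral_ofReal hdi (.of_forall hpos)]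
    _ ≤ ENNReal.ofReal (Real.exp (1 / 2 * (A / (c * D)))) *
        ENNReal.ofReal (Real.exp (2 * (K * η) - 1 / 2 * (A / (c * D)))) := by
        gcongr
        refine hint.trans ?_
        linarith [Real.add_one_le_exp (2 * (K * η) - 1 / 2 * (A / (c * D)))]
    _ = _ := by
        rw [← ENNReal.ofReal_mul (Real.exp_pos _).le, ← Real.exp_add]
        congr 2
        ring

/-! ### Exponential tail bound for sums along a driven chain -/

/-- The sum of `W (x k) (z k)` over the first `n` steps of the chain `x (k + 1) = step (x k) (z k)`
started at `x 0 = x`. -/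
noncomputable def chainSum {S Z : Type*} (step : S → Z → S) (W : S → Z → ℝ) :
    (n : ℕ) → S → (Fin n → Z) → ℝ
  | 0, _, _ => 0
  | n + 1, x, z => W x (z 0) + chainSum step W n (step x (z 0)) (fun i => z i.succ)

theorem chainSum_eq_sum {S Z : Type*} (step : S → Z → S) (W : S → Z → ℝ) (n : ℕ) (x : ℕ → S)
    (z : ℕ → Z) (h : ∀ k < n, x (k + 1) = step (x k) (z k)) :
    chainSum step W n (x 0) (fun i => z i) = ∑ k ∈ Finset.range n, W (x k) (z k) := by
  induction n generalizing x z with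
  | zero => simp [chainSum]
  | succ n ih =>
    rw [chainSum, Finset.sum_range_succ', add_comm]
    have := ih (fun k => x (k + 1)) (fun k => z (k + 1)) (fun k hk => h (k + 1) (by omega))
    simp only [Fin.val_zero, Fin.val_succ]
    rw [← h 0 (by omega)]
    simpa using this

theorem measurable_chainSum {S Z : Type*} [MeasurableSpace S] [MeasurableSpace Z]
    {step : S → Z → S} {W : S → Z → ℝ} (hstep : Measurable (Function.uncurry step))
    (hW : Measurable (Function.uncurry W)) (n : ℕ) :
    Measurable (fun u : S × (Fin n → Z) => chainSum step W n u.1 u.2) := by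
  induction n with
  | zero => exact measurable_const
  | succ n ih =>
    have h0 : Measurable fun u : S × (Fin (n + 1) → Z) => (u.1, u.2 0) := by fun_prop
    exact (hW.comp h0).add (ih.comp
      (f := fun u : S × (Fin (n + 1) → Z) => (step u.1 (u.2 0), fun i : Fin n => u.2 i.succ))
      ((hstep.comp h0).prodMk (by fun_prop)))

/-- Peeling off the first sample leaves a shorter chain started at another point of X, so the inner
integral is at most a^n uniformly. This is the supermartingale argument carried out by Fubini. -/
theorem lintegral_exp_chainSum_le {S Z : Type*} [MeasurableSpace S] [MeasurableSpace Z]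
    {P : Measure Z} [IsProbabilityMeasure P] {step : S → Z → S} {W : S → Z → ℝ}
    (hstep : Measurable (Function.uncurry step)) (hW : Measurable (Function.uncurry W))
    {X : Set S} (hX : ∀ x ∈ X, ∀ z, step x z ∈ X) {a : ℝ≥0∞}
    (ha : ∀ x ∈ X, ∫⁻ z, ENNReal.ofReal (Real.exp (W x z)) ∂P ≤ a) (n : ℕ) {x : S} (hx : x ∈ X) :
    ∫⁻ z, ENNReal.ofReal (Real.exp (chainSum step W n x z)) ∂Measure.pi (fun _ : Fin n => P) ≤
      a ^ n := by
  induction n generalizing x with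
  | zero => simp [chainSum]
  | succ n ih =>
    have hmp := (measurePreserving_piFinSuccAbove (fun _ : Fin (n + 1) => P) 0).symm
    have hm : ∀ y, Measurable fun z : Fin (n + 1) → Z =>
        ENNReal.ofReal (Real.exp (chainSum step W (n + 1) y z)) := fun y =>
      ENNReal.measurable_ofReal.comp (Real.measurable_exp.comp
        ((measurable_chainSum hstep hW (n + 1)).comp (by fun_prop : Measurable fun z => (y, z))))
    have hWm : ∀ y, Measurable fun z => ENNReal.ofReal (Real.exp (W y z)) := fun y =>
      ENNReal.measurable_ofReal.comp (Real.measurable_exp.comp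
        (hW.comp (by fun_prop : Measurable fun z => (y, z))))
    rw [← hmp.lintegral_comp (hm x),
      lintegral_prod (fun u => ENNReal.ofReal (Real.exp (chainSum step W (n + 1) x
        ((MeasurableEquiv.piFinSuccAbove (fun _ => Z) 0).symm u))))
        ((hm x).comp hmp.measurable).aemeasurable]
    calc _ = ∫⁻ z, ENNReal.ofReal (Real.exp (W x z)) *
          ∫⁻ t, ENNReal.ofReal (Real.exp (chainSum step W n (step x z) t))
            ∂Measure.pi (fun _ : Fin n => P) ∂P := by
          refine lintegral_congr fun z => ?_
          rw [← lintegral_const_mul' _ _ ENNReal.ofReal_ne_top]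
          refine lintegral_congr fun t => ?_
          rw [← ENNReal.ofReal_mul (Real.exp_pos _).le, ← Real.exp_add]
          simp [chainSum, MeasurableEquiv.piFinSuccAbove, Fin.insertNthEquiv]
      _ ≤ ∫⁻ z, ENNReal.ofReal (Real.exp (W x z)) * a ^ n ∂P := by
          gcongr with z
          exact ih (hX x hx z)
      _ ≤ a * a ^ n := by
          rw [lintegral_mul_const _ (hWm x)]
          gcongr
          exact ha x hx
      _ = a ^ (n + 1) := by ring

theorem measure_chainSum_ge_le {S Z : Type*} [MeasurableSpace S] [MeasurableSpace Z]
    {P : Measure Z} [IsProbabilityMeasure P] {step : S → Z → S} {W : S → Z → ℝ}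
    (hstep : Measurable (Function.uncurry step)) (hW : Measurable (Function.uncurry W))
    {X : Set S} (hX : ∀ x ∈ X, ∀ z, step x z ∈ X) {b : ℝ}
    (hb : ∀ x ∈ X, ∫⁻ z, ENNReal.ofReal (Real.exp (W x z)) ∂P ≤ ENNReal.ofReal (Real.exp b))
    (n : ℕ) {x : S} (hx : x ∈ X) {δ : ℝ} (hδ : 0 < δ) :
    Measure.pi (fun _ : Fin n => P) {z | n * b + Real.log (1 / δ) ≤ chainSum step W n x z} ≤
      ENNReal.ofReal δ := by
  have hm : Measurable fun z : Fin n → Z => ENNReal.ofReal (Real.exp (chainSum step W n x z)) :=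
    ENNReal.measurable_ofReal.comp (Real.measurable_exp.comp
      ((measurable_chainSum hstep hW n).comp (by fun_prop : Measurable fun z => (x, z))))
  have h1 := lintegral_exp_chainSum_le hstep hW hX hb n hx
  have hE : Real.exp (n * b + Real.log (1 / δ)) = Real.exp (n * b) / δ := by
    rw [Real.exp_add, Real.exp_log (by positivity)]
    ring
  have h2 := meas_ge_le_lintegral_div hm.aemeasurable
    (μ := Measure.pi (fun _ : Fin n => P)) (ε := ENNReal.ofReal (Real.exp (n * b) / δ))
    (by simp only [ne_eq, ENNReal.ofReal_eq_zero, not_le]; positivity) ENNReal.ofReal_ne_top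
  calc _ ≤ _ := measure_mono fun z hz => by
        simp only [Set.mem_ofPred_eq] at hz ⊢
        rw [← hE]
        exact ENNReal.ofReal_le_ofReal (Real.exp_le_exp.2 hz)
    _ ≤ _ := h2
    _ ≤ ENNReal.ofReal (Real.exp (n * b)) / ENNReal.ofReal (Real.exp (n * b) / δ) := by
        gcongr
        refine h1.trans (le_of_eq ?_)
        rw [← ENNReal.ofReal_pow (Real.exp_pos _).le, ← Real.exp_nat_mul]
    _ = ENNReal.ofReal δ := by
        rw [← ENNReal.ofReal_div_of_pos (by positivity)]
        congr 1
        field_simp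

end ZOClipSMD

namespace ZOClipSMD

/-! ### The high-probability bound for a regular oracle -/

section HighProbability

variable {d : ℕ} {Ξ : Type*} [MeasurableSpace Ξ] {𝒟 : Measure Ξ} {X : Set (Vec d)}
  {τ κ : ℝ} {f : Vec d → Ξ → ℝ} {noise : Vec d → ℝ} {M : Ξ → ℝ} {M₂ Δ : ℝ}

theorem average_mem (hX : Convex ℝ X) {T : ℕ} (hT : 1 ≤ T) {x : ℕ → Vec d}
    (hx : ∀ k < T, x k ∈ X) : average T x ∈ X := by
  have hT' : (T : ℝ) ≠ 0 := by positivity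
  rw [average, Finset.smul_sum]
  exact hX.sum_mem (fun _ _ => by positivity) (by simp [hT'])
    fun k hk => hx k (Finset.mem_range.1 hk)

theorem apply_average_le {F : Vec d → ℝ} (hF : ConvexOn ℝ X F) {T : ℕ} (hT : 1 ≤ T)
    {x : ℕ → Vec d} (hx : ∀ k < T, x k ∈ X) :
    T * F (average T x) ≤ ∑ k ∈ Finset.range T, F (x k) := by
  have hT' : (0 : ℝ) < T := by positivity
  have h := hF.map_sum_le (t := Finset.range T) (w := fun _ => 1 / (T : ℝ)) (p := x)
    (fun _ _ => by positivity) (by simp [hT'.ne']) fun k hk => hx k (Finset.mem_range.1 hk)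
  rw [← Finset.smul_sum, ← Finset.smul_sum, smul_eq_mul] at h
  calc T * F (average T x) ≤ T * (1 / T * ∑ k ∈ Finset.range T, F (x k)) := by
        unfold average
        gcongr
    _ = _ := by field_simp

theorem subset_enlargement {τ : ℝ} : X ⊆ enlargement X τ := fun x hx => by
  simpa using add_smul_mem_enlargement hx τ (z := 0) (by simp)

/-- The logarithm of the exponential supermartingale attached to one step of the method. -/
noncomputable def stepPotential (𝒟 : Measure Ξ) (f : Vec d → Ξ → ℝ) (noise : Vec d → ℝ)
    (q : ℝ≥0∞) (τ c D b : ℝ) (u x : Vec d) (z : Ξ × Vec d) : ℝ :=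
  1 / 2 * ((objective 𝒟 f x - objective 𝒟 f u - b) / (c * D) -
    inner ℝ (clip q c (gradEstimate f noise τ x z.1 z.2)) (x - u) / (c * D) +
    ellNorm q (clip q c (gradEstimate f noise τ x z.1 z.2)) ^ 2 / (2 * c ^ 2))

theorem RegularOracle.measurable_stepPotential [IsProbabilityMeasure 𝒟]
    (o : RegularOracle 𝒟 X τ κ f noise M M₂ Δ) (hκ : 0 < κ) (hM₂ : 0 ≤ M₂) {q : ℝ≥0∞}
    [Fact (1 ≤ q)] (c D b : ℝ) (u : Vec d) :
    Measurable (Function.uncurry (stepPotential 𝒟 f noise q τ c D b u)) := by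
  have h1 : Measurable (objective 𝒟 f) :=
    (continuous_of_abs_sub_le hM₂ (o.abs_objective_sub_le hκ hM₂)).measurable
  have h2 := (measurable_clip (q := q) c).comp o.measurable_gradEstimate
  have h3 := (continuous_ellNorm (d := d) q).measurable.comp h2
  have h4 := h2.inner (𝕜 := ℝ) (measurable_fst.sub (measurable_const (a := u)))
  have h5 : Measurable fun w : Vec d × (Ξ × Vec d) => objective 𝒟 f w.1 := h1.comp measurable_fst
  exact ((((h5.sub_const _).sub_const b).div_const (c * D)).sub (h4.div_const (c * D))
    |>.add ((h3.pow_const 2).div_const (2 * c ^ 2))).const_mul (1 / 2)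

theorem RegularOracle.lintegral_exp_stepPotential_le [IsProbabilityMeasure 𝒟]
    (o : RegularOracle 𝒟 X τ κ f noise M M₂ Δ) (hd : 2 ≤ d) (hX : Convex ℝ X) (hXc : IsCompact X)
    (hτ : 0 < τ) (hκ : 0 < κ) (hκ1 : κ ≤ 1) (hM₂ : 0 ≤ M₂) {p q : ℝ≥0∞}
    (hpq : p.HolderConjugate q) (hq : 2 ≤ q) {Ψ : Vec d → ℝ} (hΨ : IsProxFunction p Ψ)
    (hD : 0 < bregmanDiam X Ψ) {η c : ℝ} (hc : 0 < c)
    (hcσ : sigma d q κ M₂ Δ τ ^ (1 + κ) = η * c ^ (1 + κ)) {u : Vec d} (hu : u ∈ X) {x : Vec d}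
    (hx : x ∈ X) :
    ∫⁻ z, ENNReal.ofReal (Real.exp (stepPotential 𝒟 f noise q τ c (bregmanDiam X Ψ)
        (2 * M₂ * τ + Δ * √d / τ * bregmanDiam X Ψ) u x z)) ∂𝒟.prod (uniformSphere d) ≤
      ENNReal.ofReal (Real.exp (2 * (momentConst * η))) := by
  have hd0 : 0 < d := by omega
  have := isProbabilityMeasure_uniformSphere hd0
  have : Fact (1 ≤ q) := ⟨one_le_two.trans hq⟩
  have : Fact (1 ≤ p) := ⟨one_le_of_holderConjugate hpq⟩
  have hΔ : 0 ≤ Δ := (abs_nonneg _).trans (o.noise_le 0)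
  have hr := hΨ.ellNorm_sub_le_bregmanDiam hXc hx hu
  obtain ⟨hi, hm⟩ := o.integral_ellNorm_gradEstimate_rpow_le hd hq hτ hκ hκ1 hM₂ x
  have hG : Measurable fun z : Ξ × Vec d => gradEstimate f noise τ x z.1 z.2 :=
    o.measurable_gradEstimate.comp (f := fun z : Ξ × Vec d => (x, z)) (by fun_prop)
  refine integral_exp_clip_le hpq hG hc hκ.le hκ1 hD hi ?_ hr
    ((o.integrable_gradEstimate hd0 hτ hκ hM₂ x).inner_const _) ?_
  · rwa [mul_assoc, ← hcσ]
  · have h1 := o.objective_sub_le_integral_inner hd0 hX hτ hκ hM₂ hx hu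
    have h2 : Δ * √d / τ * ‖x - u‖ ≤ Δ * √d / τ * bregmanDiam X Ψ := by
      gcongr
      exact (norm_le_ellNorm hpq hq _).trans hr
    linarith

/-- Outside an event of probability at most `δ` for the law of the samples, every trajectory of
clipped mirror descent with a regular oracle satisfies the claimed bound. -/
theorem RegularOracle.exists_exceptional_set [IsProbabilityMeasure 𝒟]
    (o : RegularOracle 𝒟 X τ κ f noise M M₂ Δ) (hd : 2 ≤ d) (hX : Convex ℝ X) (hXc : IsCompact X)
    (hne : X.Nonempty) (hτ : 0 < τ) (hκ : 0 < κ) (hκ1 : κ ≤ 1) (hM₂ : 0 ≤ M₂)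
    {p q : ℝ≥0∞} (hpq : p.HolderConjugate q) (hq : 2 ≤ q)
    {Ψ : Vec d → ℝ} (hΨ : IsProxFunction p Ψ) (hD : 0 < bregmanDiam X Ψ) {T : ℕ} (hT : 1 ≤ T)
    {c : ℝ} (hc : 0 < c) (hcσ : sigma d q κ M₂ Δ τ ^ (1 + κ) = 1 / T * c ^ (1 + κ)) {u : Vec d}
    (hu : u ∈ X) {δ : ℝ} (hδ : 0 < δ) :
    ∃ bad : Set (Fin T → Ξ × Vec d), MeasurableSet bad ∧
      Measure.pi (fun _ : Fin T => 𝒟.prod (uniformSphere d)) bad ≤ ENNReal.ofReal δ ∧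
      ∀ (z : ℕ → Ξ × Vec d) (x : ℕ → Vec d), IsProxPoint X Ψ 0 (x 0) →
        (∀ k < T, IsProxPoint X Ψ (gradient Ψ (x k) - (bregmanDiam X Ψ / c) •
          clip q c (gradEstimate f noise τ (x k) (z k).1 (z k).2)) (x (k + 1))) →
        (fun i : Fin T => z i) ∉ bad →
        objective 𝒟 f (average T x) - objective 𝒟 f u ≤
          2 * M₂ * τ + Δ * √d / τ * bregmanDiam X Ψ +
            c * bregmanDiam X Ψ / T * (1 / 2 + 4 * momentConst + 2 * Real.log (1 / δ)) := by
  have hd0 : 0 < d := by omega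
  have := isProbabilityMeasure_uniformSphere hd0
  have : Fact (1 ≤ q) := ⟨one_le_two.trans hq⟩
  have hT' : (0 : ℝ) < T := by positivity
  set D := bregmanDiam X Ψ with hDdef
  set b := 2 * M₂ * τ + Δ * √d / τ * D with hb
  obtain ⟨P, hPc, hP⟩ := hΨ.exists_proxMap hpq hq hXc hX hne
  let G : Vec d → Ξ × Vec d → Vec d := fun x z =>
    clip q c (gradEstimate f noise τ x z.1 z.2)
  let step : Vec d → Ξ × Vec d → Vec d := fun x z => P (gradient Ψ x - (D / c) • G x z)
  have hGm : Measurable (Function.uncurry G) := (measurable_clip c).comp o.measurable_gradEstimate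
  have hGν : Measurable fun w : Vec d × (Ξ × Vec d) => (D / c) • G w.1 w.2 :=
    Measurable.const_smul hGm (D / c)
  have hstep : Measurable (Function.uncurry step) :=
    hPc.measurable.comp (((measurable_gradient Ψ).comp measurable_fst).sub hGν)
  have hW := o.measurable_stepPotential hκ hM₂ (q := q) c D b u
  have hstepX : ∀ x ∈ X, ∀ z, step x z ∈ X := fun x _ z => (hP _).1
  have hexp := fun x (hx : x ∈ X) => o.lintegral_exp_stepPotential_le hd hX hXc hτ hκ hκ1 hM₂ hpq hq
    hΨ hD hc hcσ hu hx
  -- With η = 1/T each step contributes 2K/T to the exponent, in total 2K. The chain starts at the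
  -- prox-point of 0 and is a function of the samples only, so the event is measurable.
  refine ⟨{z | T * (2 * (momentConst * (1 / T))) + Real.log (1 / δ) ≤
    chainSum step (stepPotential 𝒟 f noise q τ c D b u) T (P 0) z}, ?_,
    measure_chainSum_ge_le hstep hW hstepX hexp T (hP 0).1 hδ, ?_⟩
  · exact measurableSet_le measurable_const
      ((measurable_chainSum hstep hW T).comp (by fun_prop : Measurable fun z => (P 0, z)))
  intro z x h0 hx hz
  have hx0 : x 0 = P 0 := hΨ.isProxPoint_unique hpq hq h0 (hP 0)
  have hxs : ∀ k < T, x (k + 1) = step (x k) (z k) := fun k hk =>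
    hΨ.isProxPoint_unique hpq hq (hx k hk) (hP _)
  have hxX : ∀ k < T, x k ∈ X := fun k hk => by
    cases k with
    | zero => exact h0.1
    | succ k => exact (hx k (by omega)).1
  simp only [Set.mem_ofPred_eq, not_le] at hz
  rw [← hx0, chainSum_eq_sum step _ T x z hxs,
    show (T : ℝ) * (2 * (momentConst * (1 / T))) = 2 * momentConst by field_simp] at hz
  have hmd := hΨ.sum_inner_le hpq hXc T (g := fun k => (D / c) • G (x k) (z k)) h0.1 hx hu
  simp only [real_inner_smul_left, ellNorm_smul, abs_of_pos (div_pos hD hc), mul_pow,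
    ← Finset.mul_sum] at hmd
  rw [← hDdef] at hmd
  set I := ∑ k ∈ Finset.range T, inner ℝ (G (x k) (z k)) (x k - u) with hI
  set Q := ∑ k ∈ Finset.range T, ellNorm q (G (x k) (z k)) ^ 2 with hQ
  set A := ∑ k ∈ Finset.range T, objective 𝒟 f (x k) with hA
  have hsum : ∑ k ∈ Finset.range T, stepPotential 𝒟 f noise q τ c D b u (x k) (z k) =
      1 / 2 * ((A - T * (objective 𝒟 f u + b)) / (c * D) - I / (c * D) + Q / (2 * c ^ 2)) := by
    simp only [stepPotential]
    rw [← Finset.mul_sum, Finset.sum_add_distrib, Finset.sum_sub_distrib, ← Finset.sum_div,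
      ← Finset.sum_div, ← Finset.sum_div]
    congr 4
    simp only [sub_sub]
    rw [Finset.sum_sub_distrib]
    simp [hA, mul_add]
  rw [hsum] at hz
  -- The regret inequality for the stepsize D/c, renormalized. Its term Q/(2c²) is the one already
  -- present in the potential, so Q disappears from the final bound.
  have hI' : I / (c * D) ≤ 1 / 2 + Q / (2 * c ^ 2) := by
    rw [div_le_iff₀ (by positivity)]
    have h1 : c / D * (D / c * I) ≤ c / D * (1 / 2 * D ^ 2 + 1 / 2 * ((D / c) ^ 2 * Q)) := by gcongr
    have h2 : c / D * (D / c * I) = I := by field_simp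
    have h3 : c / D * (1 / 2 * D ^ 2 + 1 / 2 * ((D / c) ^ 2 * Q)) =
        (1 / 2 + Q / (2 * c ^ 2)) * (c * D) := by field_simp
    linarith
  have hA' : A - T * (objective 𝒟 f u + b) ≤
      (1 / 2 + 4 * momentConst + 2 * Real.log (1 / δ)) * (c * D) := by
    rw [← div_le_iff₀ (by positivity)]
    linarith
  have havg := apply_average_le ((o.convexOn_objective hX).subset subset_enlargement hX) hT hxX
  have hfin : T * (objective 𝒟 f (average T x) - objective 𝒟 f u) ≤
      T * (b + c * D / T * (1 / 2 + 4 * momentConst + 2 * Real.log (1 / δ))) := by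
    have h1 : T * (b + c * D / T * (1 / 2 + 4 * momentConst + 2 * Real.log (1 / δ))) =
        T * b + (1 / 2 + 4 * momentConst + 2 * Real.log (1 / δ)) * (c * D) := by field_simp
    rw [h1]
    linarith
  exact le_of_mul_le_mul_left hfin hT'

end HighProbability

end ZOClipSMD

namespace ZOClipSMD

/-! ### Regularization of an oracle -/

/-- The McShane extension of the restriction of `F` to a dense sequence of a set on which `F` is
Lipschitz agrees with `F` on this set and is Lipschitz on the whole space. -/
theorem iInf_add_mul_norm_sub {d : ℕ} {E : Set (Vec d)} {F : Vec d → ℝ} {K : ℝ} (hK : 0 ≤ K)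
    (hF : ∀ x ∈ E, ∀ y ∈ E, |F x - F y| ≤ K * ‖x - y‖) {D : ℕ → Vec d} (hD : ∀ n, D n ∈ E)
    (hdense : ∀ x ∈ E, ∀ ε > 0, ∃ n, ‖x - D n‖ < ε) :
    (∀ x ∈ E, ⨅ n, (F (D n) + K * ‖x - D n‖) = F x) ∧
      ∀ x y, |(⨅ n, (F (D n) + K * ‖x - D n‖)) - ⨅ n, (F (D n) + K * ‖y - D n‖)| ≤
        K * ‖x - y‖ := by
  have hbdd : ∀ x, BddBelow (Set.range fun n => F (D n) + K * ‖x - D n‖) := by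
    refine fun x => ⟨F (D 0) - K * ‖x - D 0‖, ?_⟩
    rintro _ ⟨n, rfl⟩
    have h1 := (abs_le.1 (hF (D 0) (hD 0) (D n) (hD n))).2
    have h2 : ‖D 0 - D n‖ ≤ ‖x - D 0‖ + ‖x - D n‖ := by
      rw [← norm_neg (x - D 0)]
      exact (norm_add_le (-(x - D 0)) (x - D n)).trans' (le_of_eq (by congr 1; abel))
    have h3 := mul_le_mul_of_nonneg_left h2 hK
    simp only
    linarith
  refine ⟨fun x hx => le_antisymm ?_ ?_, ?_⟩
  · refine le_of_forall_pos_le_add fun ε hε => ?_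
    obtain ⟨n, hn⟩ := hdense x hx (ε / (2 * K + 1)) (by positivity)
    have h1 := (abs_le.1 (hF x hx (D n) (hD n))).1
    have h2 := ciInf_le (hbdd x) n
    rw [lt_div_iff₀ (by positivity)] at hn
    nlinarith [norm_nonneg (x - D n)]
  · refine le_ciInf fun n => ?_
    linarith [(abs_le.1 (hF x hx (D n) (hD n))).2]
  · have key : ∀ x y, ⨅ n, (F (D n) + K * ‖x - D n‖) ≤
        (⨅ n, (F (D n) + K * ‖y - D n‖)) + K * ‖x - y‖ := by
      intro x y
      rw [← sub_le_iff_le_add]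
      refine le_ciInf fun n => ?_
      have h1 := ciInf_le (hbdd x) n
      have h2 : ‖x - D n‖ ≤ ‖y - D n‖ + ‖x - y‖ := by
        refine (norm_add_le (y - D n) (x - y)).trans' (le_of_eq ?_)
        congr 1
        abel
      have h3 := mul_le_mul_of_nonneg_left h2 hK
      linarith
    intro x y
    rw [abs_le]
    constructor
    · have := key y x
      rw [norm_sub_rev] at this
      linarith
    · linarith [key x y]

/-- An oracle satisfying the hypotheses on the enlarged set agrees there, for almost every
realization, with a regular oracle. -/
theorem exists_regularOracle {d : ℕ} (hd : 0 < d) {X : Set (Vec d)} (hXc : IsCompact X)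
    (hne : X.Nonempty) {Ξ : Type*} [MeasurableSpace Ξ] {𝒟 : Measure Ξ} [IsProbabilityMeasure 𝒟]
    {f : Vec d → Ξ → ℝ} {noise : Vec d → ℝ} {M : Ξ → ℝ} {κ M₂ Δ τ : ℝ} (hκ : 0 < κ)
    (hΔ : 0 ≤ Δ) (hτ : 0 < τ) (hint : ∀ x ∈ enlargement X τ, Integrable (f x) 𝒟)
    (hconv : ConvexRealizations X τ f) (hlip : LipschitzRealizations 𝒟 X τ κ f M M₂)
    (hnoise : BoundedNoise X τ noise Δ) :
    ∃ (F : Vec d → Ξ → ℝ) (noise' : Vec d → ℝ) (m : Ξ → ℝ),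
      RegularOracle 𝒟 X τ κ F noise' m M₂ Δ ∧
      (∀ᵐ s ∂𝒟, ∀ x ∈ enlargement X τ, F x s = f x s) ∧
      ∀ x ∈ enlargement X τ, noise' x = noise x := by
  classical
  set E := enlargement X τ with hE
  have hEc : IsCompact E := hXc.add ((isCompact_closedBall _ _).smul τ)
  have hEm : MeasurableSet E := hEc.isClosed.measurableSet
  have hEne : Nonempty E := (hne.mono subset_enlargement).to_subtype
  have hM0 : ∀ s, 0 ≤ M s := by
    obtain ⟨x, hx⟩ := hne
    intro s
    let e : Vec d := EuclideanSpace.single ⟨0, hd⟩ 1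
    have he : ‖e‖ = 1 := by simp [e]
    have h := (abs_nonneg _).trans (hlip.lipschitz s (x + τ • e) (add_smul_mem_enlargement hx τ he.le)
      x (subset_enlargement hx))
    rw [add_sub_cancel_left, norm_smul, he, mul_one, Real.norm_of_nonneg hτ.le] at h
    exact nonneg_of_mul_nonneg_left h hτ
  obtain ⟨D', hD'⟩ := TopologicalSpace.exists_dense_seq E
  let D : ℕ → Vec d := fun n => D' n
  have hDE : ∀ n, D n ∈ E := fun n => (D' n).2
  have hdense : ∀ x ∈ E, ∀ ε > 0, ∃ n, ‖x - D n‖ < ε := by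
    intro x hx ε hε
    obtain ⟨n, hn⟩ := hD'.exists_dist_lt ⟨x, hx⟩ hε
    exact ⟨n, by simpa [Subtype.dist_eq, dist_eq_norm, D] using hn⟩
  -- measurable versions
  let g : ℕ → Ξ → ℝ := fun n => (hint (D n) (hDE n)).1.mk
  have hgm : ∀ n, Measurable (g n) := fun n =>
    (hint (D n) (hDE n)).1.stronglyMeasurable_mk.measurable
  have hga : ∀ n, f (D n) =ᵐ[𝒟] g n := fun n => (hint (D n) (hDE n)).1.ae_eq_mk
  -- Only M^(1+κ) is known to be almost everywhere measurable, so a measurable version of M is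
  -- obtained by taking a root.
  let m₀ : Ξ → ℝ := fun s => hlip.moment_integrable.1.mk _ s ^ (1 / (1 + κ))
  have hm₀m : Measurable m₀ :=
    hlip.moment_integrable.1.stronglyMeasurable_mk.measurable.pow_const _
  have hm₀a : M =ᵐ[𝒟] m₀ := by
    filter_upwards [hlip.moment_integrable.1.ae_eq_mk] with s hs
    simp only [m₀]
    rw [← hs, ← Real.rpow_mul (hM0 s), mul_one_div_cancel (by linarith), Real.rpow_one]
  -- A measurable null set outside which the countably many values used by the extension are the
  -- true ones. On it the oracle is set to 0, so that convexity and the Lipschitz bound hold for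
  -- every realization.
  let N : Set Ξ := toMeasurable 𝒟 {s | ¬(M s = m₀ s ∧ ∀ n, f (D n) s = g n s)}
  have hNm : MeasurableSet N := measurableSet_toMeasurable _ _
  have hN0 : ∀ᵐ s ∂𝒟, s ∉ N := by
    rw [ae_iff]
    simp only [not_not, Set.ofPred_mem_eq, N, measure_toMeasurable]
    rw [← ae_iff]
    filter_upwards [hm₀a, ae_all_iff.2 hga] with s h1 h2 using ⟨h1, h2⟩
  have hNs : ∀ s ∉ N, M s = m₀ s ∧ ∀ n, f (D n) s = g n s := fun s hs => by
    by_contra h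
    exact hs (subset_toMeasurable _ _ h)
  let m : Ξ → ℝ := fun s => if s ∈ N then 0 else m₀ s
  let F : Vec d → Ξ → ℝ := fun x s => if s ∈ N then 0 else ⨅ n, (g n s + m₀ s * ‖x - D n‖)
  have hF : ∀ s ∉ N, (∀ x ∈ E, F x s = f x s) ∧ ∀ x y, |F x s - F y s| ≤ M s * ‖x - y‖ := by
    intro s hs
    obtain ⟨h1, h2⟩ := hNs s hs
    simp only [F, hs, if_false, ← h1, ← h2]
    exact iInf_add_mul_norm_sub (hM0 s) (hlip.lipschitz s) hDE hdense
  have hFa : ∀ᵐ s ∂𝒟, ∀ x ∈ E, F x s = f x s := by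
    filter_upwards [hN0] with s hs using (hF s hs).1
  have hma : m =ᵐ[𝒟] M := by
    filter_upwards [hN0] with s hs
    simp [m, hs, (hNs s hs).1]
  have hm0 : ∀ s, 0 ≤ m s := fun s => by
    by_cases hs : s ∈ N
    · simp [m, hs]
    · simpa [m, hs, ← (hNs s hs).1] using hM0 s
  have hFm : Measurable fun z : Vec d × Ξ => F z.1 z.2 := by
    refine Measurable.ite (measurable_snd hNm) measurable_const (Measurable.iInf fun n => ?_)
    have h1 : Measurable fun z : Vec d × Ξ => g n z.2 := (hgm n).comp measurable_snd
    have h2 : Measurable fun z : Vec d × Ξ => m₀ z.2 := hm₀m.comp measurable_snd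
    exact h1.add (h2.mul (measurable_fst.sub_const _).norm)
  have hFL : ∀ s x y, |F x s - F y s| ≤ m s * ‖x - y‖ := fun s x y => by
    by_cases hs : s ∈ N
    · simp [F, m, hs]
    · simpa only [m, hs, if_false, ← (hNs s hs).1] using (hF s hs).2 x y
  have hmpow : (fun s => m s ^ (1 + κ)) =ᵐ[𝒟] fun s => M s ^ (1 + κ) := by
    filter_upwards [hma] with s hs
    rw [hs]
  have hmi : Integrable (fun s => m s ^ (1 + κ)) 𝒟 := hlip.moment_integrable.congr hmpow.symm
  have hmi1 : Integrable m 𝒟 := by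
    have h := integrable_rpow_of_le_one hmi (fun s => Real.rpow_nonneg (hm0 s) _)
      (s := 1 / (1 + κ)) (by positivity) ((div_le_one (by linarith)).2 (by linarith))
    refine h.congr (.of_forall fun s => ?_)
    simp only
    rw [← Real.rpow_mul (hm0 s), mul_one_div_cancel (by linarith), Real.rpow_one]
  refine ⟨F, E.indicator noise, m, ⟨hFm, fun x => ?_, hFL, fun s => ?_, hm0, hmi, ?_, ?_,
    fun x => ?_⟩, hFa, fun x hx => Set.indicator_of_mem hx _⟩
  · have h0 : Integrable (F (D 0)) 𝒟 := (hint (D 0) (hDE 0)).congr <| by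
      filter_upwards [hFa] with s hs using (hs _ (hDE 0)).symm
    refine (h0.abs.add (hmi1.mul_const ‖x - D 0‖)).mono'
      (hFm.comp (by fun_prop : Measurable fun s => (x, s))).aestronglyMeasurable
      (.of_forall fun s => ?_)
    have h1 := hFL s x (D 0)
    have h2 := abs_sub_abs_le_abs_sub (F x s) (F (D 0) s)
    simp only [Real.norm_eq_abs, Pi.add_apply]
    linarith
  · by_cases hs : s ∈ N
    · refine (convexOn_const (0 : ℝ) (hconv s).1).congr fun x _ => ?_
      simp [F, hs]
    · exact (hconv s).congr fun x hx => ((hF s hs).1 x hx).symm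
  · rw [integral_congr_ae hmpow]
    exact hlip.moment_le
  · refine measurable_of_restrict_of_restrict_compl hEm ?_ ?_
    · convert hnoise.measurable using 1
      ext x
      simp [Set.domRestrict]
    · convert (measurable_const : Measurable fun _ : (Eᶜ : Set (Vec d)) => (0 : ℝ)) using 1
      ext x
      exact Set.indicator_of_notMem x.2 _
  · by_cases hx : x ∈ E
    · rw [Set.indicator_of_mem hx]
      exact hnoise.bound x hx
    · rwa [Set.indicator_of_notMem hx, abs_zero]

end ZOClipSMD

namespace ZOClipSMD

/-! ### The high-probability bound -/

theorem gradEstimate_congr {d : ℕ} {Ξ : Type*} {X : Set (Vec d)} {τ : ℝ} {f F : Vec d → Ξ → ℝ}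
    {noise noise' : Vec d → ℝ} {s : Ξ} (hf : ∀ x ∈ enlargement X τ, F x s = f x s)
    (hn : ∀ x ∈ enlargement X τ, noise' x = noise x) {x : Vec d} (hx : x ∈ X) {e : Vec d}
    (he : ‖e‖ ≤ 1) : gradEstimate f noise τ x s e = gradEstimate F noise' τ x s e := by
  have h1 := add_smul_mem_enlargement hx τ he
  have h2 := add_smul_mem_enlargement hx τ (z := -e) (by rwa [norm_neg])
  rw [smul_neg, ← sub_eq_add_neg] at h2
  simp only [gradEstimate, oracle, hf _ h1, hf _ h2, hn _ h1, hn _ h2]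

/-- S need not be measurable: its complement is bounded as an outer measure and subadditivity does
the rest. The success event involves iterates that are arbitrary functions of ω. -/
theorem one_sub_le_measureReal_of_ae {Ω Z : Type*} [MeasurableSpace Ω] [MeasurableSpace Z]
    {μ : Measure Ω} [IsProbabilityMeasure μ] {P : Measure Z} {Y : Ω → Z} (hY : HasLaw Y P μ)
    {bad : Set Z} (hbad : MeasurableSet bad) {δ : ℝ} (hδ : 0 ≤ δ) (hP : P bad ≤ ENNReal.ofReal δ)
    {S : Set Ω} (hS : ∀ᵐ ω ∂μ, Y ω ∉ bad → ω ∈ S) : 1 - δ ≤ μ.real S := by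
  have h1 : μ Sᶜ ≤ ENNReal.ofReal δ := by
    calc μ Sᶜ ≤ μ (Y ⁻¹' bad) := by
          refine measure_mono_ae ?_
          filter_upwards [hS] with ω hω hωS
          by_contra h
          exact hωS (hω h)
      _ = P bad := by rw [← hY.map_eq, Measure.map_apply_of_aemeasurable hY.aemeasurable hbad]
      _ ≤ _ := hP
  have h2 : μ.real Sᶜ ≤ δ := ENNReal.toReal_le_of_le_ofReal hδ h1
  have h3 : μ.real (S ∪ Sᶜ) ≤ μ.real S + μ.real Sᶜ := measureReal_union_le _ _
  rw [Set.union_compl_self, probReal_univ] at h3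
  linarith

theorem hasLaw_pi {Ω Z : Type*} [MeasurableSpace Ω] [MeasurableSpace Z] {μ : Measure Ω}
    [IsProbabilityMeasure μ] {P : Measure Z} {T : ℕ} {Y : Fin T → Ω → Z}
    (hY : ∀ k, HasLaw (Y k) P μ) (hind : iIndepFun Y μ) :
    HasLaw (fun ω k => Y k ω) (Measure.pi fun _ : Fin T => P) μ := by
  refine ⟨aemeasurable_pi_lambda _ fun k => (hY k).aemeasurable, ?_⟩
  rw [(iIndepFun_iff_map_fun_eq_pi_map fun k => (hY k).aemeasurable).1 hind]
  simp only [(hY _).map_eq]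

theorem one_sub_le_measureReal_objective_average_sub_le {d : ℕ} (hd : 2 ≤ d) {X : Set (Vec d)}
    (hXc : IsCompact X) (hX : Convex ℝ X) (hne : X.Nonempty) {Ξ : Type*} [MeasurableSpace Ξ]
    {𝒟 : Measure Ξ} [IsProbabilityMeasure 𝒟] {f : Vec d → Ξ → ℝ} {noise : Vec d → ℝ} {M : Ξ → ℝ}
    {κ M₂ Δ τ : ℝ} (hκ : 0 < κ) (hκ1 : κ ≤ 1) (hM₂ : 0 ≤ M₂) (hΔ : 0 ≤ Δ) (hτ : 0 < τ)
    (hint : ∀ x ∈ enlargement X τ, Integrable (f x) 𝒟) (hconv : ConvexRealizations X τ f)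
    (hlip : LipschitzRealizations 𝒟 X τ κ f M M₂) (hnoise : BoundedNoise X τ noise Δ)
    {p q : ℝ≥0∞} (hpq : p.HolderConjugate q) (hq : 2 ≤ q) {Ψ : Vec d → ℝ}
    (hΨ : IsProxFunction p Ψ) {T : ℕ} (hT : 1 ≤ T) {c : ℝ} (hc : 0 < c)
    (hcσ : sigma d q κ M₂ Δ τ ^ (1 + κ) = 1 / T * c ^ (1 + κ))
    {Ω : Type*} [MeasurableSpace Ω] {μ : Measure Ω} [IsProbabilityMeasure μ]
    {ξ : ℕ → Ω → Ξ} {e : ℕ → Ω → Vec d}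
    (hlaw : ∀ k < T, HasLaw (fun ω => (ξ k ω, e k ω)) (𝒟.prod (uniformSphere d)) μ)
    (hind : iIndepFun (fun (k : Fin T) ω => (ξ k ω, e k ω)) μ) {x : ℕ → Ω → Vec d}
    (hx : ∀ ω, IsTrajectory X f noise q T (bregmanDiam X Ψ / c) c Ψ τ
      (fun k => ξ k ω) (fun k => e k ω) (fun k => x k ω))
    {u : Vec d} (hu : u ∈ X) {δ : ℝ} (hδ : 0 < δ) :
    1 - δ ≤ μ.real {ω |
      objective 𝒟 f (average T (fun k => x k ω)) - objective 𝒟 f u ≤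
        2 * M₂ * τ + Δ * √d / τ * bregmanDiam X Ψ +
          c * bregmanDiam X Ψ / T * (1 / 2 + 4 * momentConst + 2 * Real.log (1 / δ))} := by
  have hd0 : 0 < d := by omega
  have := isProbabilityMeasure_uniformSphere hd0
  have : Fact (1 ≤ p) := ⟨one_le_of_holderConjugate hpq⟩
  have hxX : ∀ ω, ∀ k < T, x k ω ∈ X := fun ω k hk => by
    cases k with
    | zero => exact (hx ω).init_mem
    | succ k => exact (hx ω).step_mem k (by omega)
  have hD0 : 0 ≤ bregmanDiam X Ψ := Real.sqrt_nonneg _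
  -- Diameter 0 means that X is a single point and the gap vanishes. This case is separate because
  -- the exponential estimate divides by D.
  rcases hD0.eq_or_lt with hD | hD
  · have havg : ∀ ω, average T (fun k => x k ω) = u := fun ω => by
      have h1 := hΨ.ellNorm_sub_le_bregmanDiam hXc (average_mem hX hT (hxX ω)) hu
      rw [← hD] at h1
      exact sub_eq_zero.1 ((ellNorm_eq_zero p).1 (h1.antisymm (ellNorm_nonneg p _)))
    have h0 : 0 ≤ 2 * M₂ * τ := by positivity
    simp only [havg, ← hD, sub_self, mul_zero, zero_div, zero_mul, add_zero, h0,
      Set.ofPred_true, probReal_univ]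
    linarith
  obtain ⟨F, noise', m, o, hF, hn⟩ :=
    exists_regularOracle hd0 hXc hne hκ hΔ hτ hint hconv hlip hnoise
  have hobj : ∀ y ∈ X, objective 𝒟 F y = objective 𝒟 f y := fun y hy =>
    integral_congr_ae (hF.mono fun s hs => hs y (subset_enlargement hy))
  obtain ⟨bad, hbad, hP, hgood⟩ := o.exists_exceptional_set hd hX hXc hne hτ hκ hκ1 hM₂ hpq hq hΨ
    hD hT hc hcσ hu hδ
  have hjoint := hasLaw_pi (Y := fun (k : Fin T) ω => (ξ k ω, e k ω))
    (fun k => hlaw k k.2) hind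
  refine one_sub_le_measureReal_of_ae hjoint hbad hδ.le hP ?_
  have hae : ∀ᵐ ω ∂μ, ∀ k < T, (∀ y ∈ enlargement X τ, F y (ξ k ω) = f y (ξ k ω)) ∧
      ‖e k ω‖ = 1 := by
    simp only [ae_all_iff]
    intro k hk
    have h1 : ∀ᵐ z ∂𝒟.prod (uniformSphere d),
        (∀ y ∈ enlargement X τ, F y z.1 = f y z.1) ∧ ‖z.2‖ = 1 :=
      (Measure.quasiMeasurePreserving_fst.ae hF).and (ae_norm_snd_eq_one hd0)
    rw [← (hlaw k hk).map_eq] at h1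
    exact ae_of_ae_map (hlaw k hk).aemeasurable h1
  filter_upwards [hae] with ω hω hωbad
  have h1 := hgood (fun k => (ξ k ω, e k ω)) (fun k => x k ω)
    (hΨ.isProxPoint_init hX (hx ω).init_mem (hx ω).init_min) (fun k hk => ?_) hωbad
  · rwa [hobj _ (average_mem hX hT (hxX ω)), hobj _ hu] at h1
  · simp only
    rw [← gradEstimate_congr (hω k hk).1 hn (hxX ω k hk) (hω k hk).2.le]
    exact hΨ.isProxPoint_step hpq hq hX ((hx ω).step_mem k hk) ((hx ω).step_min k hk)

/-! ### Explicit forms of the bound -/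

theorem clipLevel_rpow {T : ℕ} (hT : 1 ≤ T) {σ κ : ℝ} (hσ : 0 ≤ σ) (hκ : 0 < κ) :
    σ ^ (1 + κ) = 1 / T * ((T : ℝ) ^ (1 / (1 + κ)) * σ) ^ (1 + κ) := by
  have hT' : (0 : ℝ) < T := by positivity
  rw [Real.mul_rpow (by positivity) hσ, ← Real.rpow_mul hT'.le, one_div_mul_cancel (by linarith),
    Real.rpow_one]
  field_simp

theorem clipLevel_div {T : ℕ} (hT : 1 ≤ T) {κ : ℝ} (hκ : 0 < κ) (σ D : ℝ) :
    (T : ℝ) ^ (1 / (1 + κ)) * σ * D / T = D * σ / (T : ℝ) ^ (κ / (1 + κ)) := by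
  have hT' : (0 : ℝ) < T := by positivity
  have h : (T : ℝ) ^ (1 / (1 + κ)) * (T : ℝ) ^ (κ / (1 + κ)) = T := by
    rw [← Real.rpow_add hT', ← add_div, div_self (by linarith), Real.rpow_one]
  rw [div_eq_div_iff (by positivity) (by positivity)]
  linear_combination σ * D * h

/-- Superadditivity of the power 1+κ together with 2^κ ≤ 2^(1+κ). The factor 2^(-1/4) is dropped. -/
theorem sigma_le {d : ℕ} (hd : 2 ≤ d) {q : ℝ≥0∞} (hq : 2 ≤ q) {κ M₂ Δ τ : ℝ} (hκ : 0 < κ)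
    (hM₂ : 0 ≤ M₂) (hΔ : 0 ≤ Δ) (hτ : 0 < τ) :
    sigma d q κ M₂ Δ τ ≤ 2 * (√d * aCoef d q * M₂ + d * aCoef d q * Δ / τ) := by
  have ha := (aCoef_pos hd hq).le
  have h1 : 0 ≤ √d / (2 : ℝ) ^ (1 / 4 : ℝ) * aCoef d q * M₂ := by positivity
  have h2 : 0 ≤ d * aCoef d q * Δ / τ := by positivity
  have h3 : √d / (2 : ℝ) ^ (1 / 4 : ℝ) ≤ √d :=
    div_le_self (by positivity) (Real.one_le_rpow one_le_two (by norm_num))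
  have h4 : sigma d q κ M₂ Δ τ ^ (1 + κ) ≤ (2 * (√d / (2 : ℝ) ^ (1 / 4 : ℝ) * aCoef d q * M₂ +
      d * aCoef d q * Δ / τ)) ^ (1 + κ) := by
    rw [sigma_rpow hd hq hκ hM₂ hΔ hτ, ← mul_add, Real.mul_rpow zero_le_two (by positivity)]
    gcongr
    · exact one_le_two
    · linarith
    · exact Real.add_rpow_le_rpow_add h1 h2 (by linarith)
  rw [Real.rpow_le_rpow_iff (sigma_nonneg hd hq hM₂ hΔ hτ) (by positivity) (by linarith)] at h4
  refine h4.trans ?_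
  gcongr

theorem bound_le {B D σ t K L : ℝ} (hD : 0 ≤ D) (hσ : 0 ≤ σ) (ht : 0 < t) (hK : 1 ≤ K)
    (hL : 0 ≤ L) : B + D * σ / t * (1 / 2 + 4 * K + 2 * L) ≤
      B + 6 * K * (1 + L) * (D * σ / t) := by
  have h : 1 / 2 + 4 * K + 2 * L ≤ 6 * K * (1 + L) := by nlinarith
  have h0 : 0 ≤ D * σ / t := by positivity
  nlinarith

/-- Here r = √d, n = d and t = T^(κ/(1+κ)). The prescribed τ balances τ · 2M₂τ against the sum of
the coefficients of 1/τ, so each term in 1/τ is at most 2M₂τ. Moreover (2M₂τ)² is a quarter of the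
sum of the two radicands. -/
theorem optimized_bound_le {r a M₂ Δ D n t τ σ K L : ℝ} (hr : 0 ≤ r) (ha : 0 ≤ a) (hM₂ : 0 ≤ M₂)
    (hΔ : 0 ≤ Δ) (hD : 0 ≤ D) (hn : 0 ≤ n) (ht : 0 < t) (hτ : 0 < τ) (hK : 1 ≤ K) (hL : 0 ≤ L)
    (hσ : σ ≤ 2 * (r * a * M₂ + n * a * Δ / τ))
    (hτe : τ = √((r * Δ * D + 4 * D * n * a * Δ * t⁻¹) / (2 * M₂))) :
    2 * M₂ * τ + Δ * r / τ * D + D * σ / t * (1 / 2 + 4 * K + 2 * L) ≤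
      6 * K * (1 + L) * (√(8 * M₂ * r * Δ * D) + √(32 * M₂ * D * n * a * Δ / t) +
        2 * r * a * M₂ * D / t) := by
  set A := r * Δ * D + 4 * D * n * a * Δ * t⁻¹ with hA
  have hA' : 0 < A / (2 * M₂) := Real.sqrt_pos.1 (hτe ▸ hτ)
  -- If M₂ were 0, division by zero would make the prescribed τ equal to 0. Positivity of M₂ is
  -- therefore implied by τ > 0.
  have hM : 0 < M₂ := hM₂.lt_of_ne fun h => by simp [← h] at hA'
  have hτ2 : τ * (2 * M₂ * τ) = A := by
    have : τ ^ 2 = A / (2 * M₂) := by rw [hτe, Real.sq_sqrt hA'.le]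
    rw [eq_div_iff (by positivity)] at this
    linarith
  set R₁ := √(8 * M₂ * r * Δ * D) with hR₁
  set R₂ := √(32 * M₂ * D * n * a * Δ / t) with hR₂
  have hR₁0 : 0 ≤ R₁ := Real.sqrt_nonneg _
  have hR₂0 : 0 ≤ R₂ := Real.sqrt_nonneg _
  have h1 : 2 * M₂ * τ ≤ (R₁ + R₂) / 2 := by
    refine abs_le_of_sq_le_sq' ?_ (by positivity) |>.2
    have e1 : R₁ ^ 2 = 8 * M₂ * r * Δ * D := Real.sq_sqrt (by positivity)
    have e2 : R₂ ^ 2 = 32 * M₂ * D * n * a * Δ / t := Real.sq_sqrt (by positivity)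
    have e3 : (2 * M₂ * τ) ^ 2 = R₁ ^ 2 / 4 + R₂ ^ 2 / 4 := by
      rw [e1, e2]
      calc (2 * M₂ * τ) ^ 2 = 2 * M₂ * (τ * (2 * M₂ * τ)) := by ring
        _ = _ := by rw [hτ2, hA]; ring
    nlinarith
  have h2 : Δ * r / τ * D ≤ 2 * M₂ * τ := by
    rw [div_mul_eq_mul_div, div_le_iff₀ hτ, mul_comm _ τ, hτ2, hA]
    have : 0 ≤ 4 * D * n * a * Δ * t⁻¹ := by positivity
    linarith
  have h3 : 4 * (D * (n * a * Δ / τ) / t) ≤ 2 * M₂ * τ := by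
    have e : 4 * (D * (n * a * Δ / τ) / t) = 4 * D * n * a * Δ * t⁻¹ / τ := by
      field_simp
    rw [e, div_le_iff₀ hτ, mul_comm _ τ, hτ2, hA]
    have : 0 ≤ r * Δ * D := by positivity
    linarith
  have h4 : D * σ / t ≤ 2 * r * a * M₂ * D / t + 2 * (D * (n * a * Δ / τ) / t) := by
    calc D * σ / t ≤ D * (2 * (r * a * M₂ + n * a * Δ / τ)) / t := by gcongr
      _ = _ := by ring
  set R₃ := 2 * r * a * M₂ * D / t with hR₃
  have hR₃0 : 0 ≤ R₃ := by positivity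
  have h5 : 0 ≤ 1 / 2 + 4 * K + 2 * L := by linarith
  have h6 : 1 / 2 + 4 * K + 2 * L ≤ 5 * (K * (1 + L)) := by nlinarith
  have h7 : 1 ≤ K * (1 + L) := by nlinarith
  calc _ ≤ (R₁ + R₂ + R₃) + (R₁ + R₂ + R₃) * (1 / 2 + 4 * K + 2 * L) := by
        refine add_le_add ?_ (mul_le_mul_of_nonneg_right ?_ h5) <;> linarith
    _ ≤ K * (1 + L) * (R₁ + R₂ + R₃) + (R₁ + R₂ + R₃) * (5 * (K * (1 + L))) := by
        gcongr
        exact le_mul_of_one_le_left (by positivity) h7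
    _ = _ := by ring

end ZOClipSMD
-- The two bounds for ZO-Clip-SMD
theorem mainTheorem3 :
    ∃ C : ℝ, 0 < C ∧
      ∀ (d : ℕ) (_ : 2 ≤ d)
        -- the stochastic problem on a compact convex set
        (X : Set (ZOClipSMD.Vec d)) (_ : IsCompact X) (_ : Convex ℝ X) (_ : X.Nonempty)
        (Ξ : Type*) [MeasurableSpace Ξ] (𝒟 : Measure Ξ) [IsProbabilityMeasure 𝒟]
        (f : ZOClipSMD.Vec d → Ξ → ℝ) (noise : ZOClipSMD.Vec d → ℝ) (M : Ξ → ℝ)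
        (κ M₂ Δ τ : ℝ) (_ : 0 < κ) (_ : κ ≤ 1) (_ : 0 ≤ M₂) (_ : 0 ≤ Δ)
        (_ : 0 < M₂ ∨ 0 < Δ) (_ : 0 < τ)
        (_ : ∀ x ∈ ZOClipSMD.enlargement X τ, Integrable (f x) 𝒟)
        (_ : ZOClipSMD.ConvexRealizations X τ f)
        (_ : ZOClipSMD.LipschitzRealizations 𝒟 X τ κ f M M₂)
        (_ : ZOClipSMD.BoundedNoise X τ noise Δ)
        -- norms and prox-function
        (p q : ℝ≥0∞) (_ : p.HolderConjugate q) (_ : 2 ≤ q)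
        (Ψ : ZOClipSMD.Vec d → ℝ) (_ : ZOClipSMD.IsProxFunction p Ψ)
        -- parameters of the algorithm
        (T : ℕ) (_ : 1 ≤ T) (c ν : ℝ)
        (_ : c = (T : ℝ) ^ (1 / (1 + κ)) * ZOClipSMD.sigma d q κ M₂ Δ τ)
        (_ : ν = ZOClipSMD.bregmanDiam X Ψ / c)
        -- independent samples and the iterates they generate
        (Ω : Type*) [MeasurableSpace Ω] (μ : Measure Ω) [IsProbabilityMeasure μ]
        (ξ : ℕ → Ω → Ξ) (e : ℕ → Ω → ZOClipSMD.Vec d)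
        (_ : ∀ k < T, HasLaw (fun ω => (ξ k ω, e k ω))
          (𝒟.prod (ZOClipSMD.uniformSphere d)) μ)
        (_ : iIndepFun (fun (k : Fin T) ω => (ξ k ω, e k ω)) μ)
        (x : ℕ → Ω → ZOClipSMD.Vec d)
        (_ : ∀ ω, ZOClipSMD.IsTrajectory X f noise q T ν c Ψ τ
          (fun k => ξ k ω) (fun k => e k ω) (fun k => x k ω))
        -- a solution of the problem and a confidence level
        (xs : ZOClipSMD.Vec d) (_ : xs ∈ X) (_ : IsMinOn (ZOClipSMD.objective 𝒟 f) X xs)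
        (δ : ℝ) (_ : 0 < δ) (_ : δ < 1),
        1 - δ ≤ μ.real {ω |
          ZOClipSMD.objective 𝒟 f (ZOClipSMD.average T (fun k => x k ω)) -
              ZOClipSMD.objective 𝒟 f xs ≤
            2 * M₂ * τ + Δ * √d / τ * ZOClipSMD.bregmanDiam X Ψ +
              C * (1 + Real.log (1 / δ)) *
                (ZOClipSMD.bregmanDiam X Ψ * ZOClipSMD.sigma d q κ M₂ Δ τ /
                  (T : ℝ) ^ (κ / (1 + κ)))} ∧
        (τ = √((√d * Δ * ZOClipSMD.bregmanDiam X Ψ +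
              4 * ZOClipSMD.bregmanDiam X Ψ * d * ZOClipSMD.aCoef d q * Δ *
                (T : ℝ) ^ (-(κ / (1 + κ)))) / (2 * M₂)) →
          1 - δ ≤ μ.real {ω |
            ZOClipSMD.objective 𝒟 f (ZOClipSMD.average T (fun k => x k ω)) -
                ZOClipSMD.objective 𝒟 f xs ≤
              C * (1 + Real.log (1 / δ)) *
                (√(8 * M₂ * √d * Δ * ZOClipSMD.bregmanDiam X Ψ) +
                  √(32 * M₂ * ZOClipSMD.bregmanDiam X Ψ * d * ZOClipSMD.aCoef d q * Δ /
                    (T : ℝ) ^ (κ / (1 + κ))) +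
                  2 * √d * ZOClipSMD.aCoef d q * M₂ * ZOClipSMD.bregmanDiam X Ψ /
                    (T : ℝ) ^ (κ / (1 + κ)))}) := by
  have hK := ZOClipSMD.one_le_momentConst
  refine ⟨6 * ZOClipSMD.momentConst, by linarith, ?_⟩
  intro d hd X hXc hX hne Ξ _ 𝒟 _ f noise M κ M₂ Δ τ hκ hκ1 hM₂ hΔ hpos hτ hint hconv hlip hnoise
    p q hpq hq Ψ hΨ T hT c ν hc hν Ω _ μ _ ξ e hlaw hind x hx xs hxs _ δ hδ hδ1
  have hσ := ZOClipSMD.sigma_pos (κ := κ) hd hq hM₂ hΔ hpos hτ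
  have hT' : (0 : ℝ) < T := by positivity
  have hc0 : 0 < c := by rw [hc]; positivity
  have hL : 0 ≤ Real.log (1 / δ) := Real.log_nonneg ((one_le_div hδ).2 hδ1.le)
  have hD : 0 ≤ ZOClipSMD.bregmanDiam X Ψ := Real.sqrt_nonneg _
  have hb := ZOClipSMD.one_sub_le_measureReal_objective_average_sub_le hd hXc hX hne hκ hκ1 hM₂ hΔ
    hτ hint hconv hlip hnoise hpq hq hΨ hT hc0
    (by rw [hc]; exact ZOClipSMD.clipLevel_rpow hT hσ.le hκ) hlaw hind (hν ▸ hx) hxs hδ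
  rw [hc, ZOClipSMD.clipLevel_div hT hκ] at hb
  refine ⟨hb.trans (MeasureTheory.measureReal_mono fun ω hω => ?_), fun hτe =>
    hb.trans (MeasureTheory.measureReal_mono fun ω hω => ?_)⟩ <;>
    refine le_trans (Set.mem_ofPred_eq ▸ hω) ?_
  · exact ZOClipSMD.bound_le hD hσ.le (by positivity) hK hL
  · rw [Real.rpow_neg hT'.le] at hτe
    exact ZOClipSMD.optimized_bound_le (Real.sqrt_nonneg _) (ZOClipSMD.aCoef_pos hd hq).le hM₂ hΔ
      hD (Nat.cast_nonneg d) (by positivity) hτ hK hL (ZOClipSMD.sigma_le hd hq hκ hM₂ hΔ hτ) hτe
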